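/- Notation. Vectors in $\mathbb R^3$ carry the Euclidean norm, $3\times3$ matrices the Frobenius norm; $e_3=(0,0,1)$; $\hat\Omega$ is the skew-symmetric matrix with $\hat\Omega v=\Omega\times v$, and $\vee$ is the inverse of the hat map; $\mathrm{Sym}(A)=\frac12(A+A^T)$, $\mathrm{Skew}(A)=\frac12(A-A^T)$, $[A,B]=AB-BA$. A real polynomial is Hurwitz if all its complex roots have negative real part. **System.** Let $\mathbb I$ be a symmetric positive definite $3\times 3$ matrix, $g\in\mathbb R$ and $k_e>0$. The quadcopter is the control system with state $(R,\Omega,x,\dot x)\in \mathrm{SO}(3)\times\mathbb R^3\times\mathbb R^3\times\mathbb R^3$, control torque $\tau\in\mathbb R^3$ and thrust (per mass) $f\ge 0$, $$\dot R=R\hat\Omega,\qquad \mathbb I\dot\Omega=\mathbb I\Omega\times\Omega+\tau,\qquad \ddot x=-ge_3+fRe_3 .$$ **Reference.** Let $(R_0,\Omega_0,x_0,\dot x_0,f_0,\dot f_0)(t)$, $t\ge0$, with $R_0(t)\in\mathrm{SO}(3)$ and continuous reference controls $(u_0,q_0)(t)$, satisfy $$\dot R=R\hat\Omega-k_eR(R^TR-I),\qquad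 \dot\Omega=u,\qquad \ddot x=-ge_3+fRe_3,\qquad \ddot f=q$$ on $[0,\infty)$. Assume that $\Omega_0$, $u_0=\dot\Omega_0$, $f_0$, $\dot f_0$, $q_0=\ddot f_0$ are bounded on $[0,\infty)$ and that $f_0(t)\ge\delta$ for all $t\ge0$, for some constant $\delta>0$. **Controller.** Put $\Delta R=R-R_0$, $\Delta\Omega=\Omega-\Omega_0$, $\Delta x=x-x_0$, $\Delta\dot x=\dot x-\dot x_0$, $\Delta f=f-f_0$, $\Delta\dot f=\dot f-\dot f_0$, and $$Z=R_0^T\Delta R,\quad Z_s=\mathrm{Sym}(Z),\quad Z_k=\mathrm{Skew}(Z),\quad z_k=(z_{k1},z_{k2},z_{k3})=Z_k^\vee,$$ $$A_0=f_0R_0,\qquad B_0=\mathrm{diag}[f_0,-f_0,1].$$ In the formulas below the following symbols are abbreviations: $\dot z_k:=z_k\times\Omega_0+\Delta\Omega$, $\dot Z_k:=\hat{\dot z}_k$, $\dot Z_s:=[Z_s,\hat\Omega_0]-2k_eZ_s$, $$\Delta\ddot x:=(\Delta fR_0+A_0Z_k+A_0Z_s)e_3,$$ $$\Delta\dddot x:=\big(\Delta\dot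 fR_0+A_0\dot Z_k+\Delta f\dot R_0+\dot A_0(Z_s+Z_k)+A_0\dot Z_s\big)e_3,$$ $$C:=2\Delta\dot f\dot R_0+2\dot A_0(\dot Z_s+\dot Z_k)+\Delta f\ddot R_0+\ddot A_0(Z_s+Z_k)+A_0\big([\dot Z_s,\hat\Omega_0]+[Z_s,\hat{\dot\Omega}_0]-2k_e\dot Z_s\big),$$ where $\dot R_0,\ddot R_0,\dot A_0,\ddot A_0,\dot\Omega_0$ are the time derivatives of the reference signals. Given $(v,w)\in\mathbb R^3\times\mathbb R$, the controller $(\tau,f)$ is $$[\tilde u_2,\tilde u_1,\Delta q]^T=B_0^{-1}R_0^T(v-Ce_3),\quad \tilde u_3=w,\quad u=u_0-(z_k\times\Omega_0+\Delta\Omega)\times\Omega_0-z_k\times\dot\Omega_0+\tilde u,$$ $$\tau=-\mathbb I\Omega\times\Omega+\mathbb Iu,\qquad \ddot f=q_0+\Delta q,$$ so that $(f,\dot f)$ are controller states. The input $(v,w)$ is given by one of two laws. (A) $v=-K_3\Delta\dddot x-K_2\Delta\ddot x-K_1\Delta\dot x-K_0\Delta x$ and $w=-a_1\dot z_{k3}-a_0z_{k3}$,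 where $K_0,\dots,K_3\in\mathbb R^{3\times3}$ are any matrices such that $\det(\lambda^4I+\lambda^3K_3+\lambda^2K_2+\lambda K_1+K_0)$ is Hurwitz, and $a_0,a_1>0$. (B) $v=-K_3\Delta\dddot x-K_2\Delta\ddot x-K_1\Delta\dot x-K_0\Delta x-K_I\sigma$ and $w=-a_1\dot z_{k3}-a_0z_{k3}-a_I\rho$ with integral states $\dot\sigma=\Delta x$, $\dot\rho=z_{k3}$ (thus $\sigma=\int_0^t\Delta x$ and $\rho=\int_0^tz_{k3}$ if they start from $0$ at time $0$), where $K_0,\dots,K_3,K_I\in\mathbb R^{3\times 3}$ and $a_0,a_1,a_I\in\mathbb R$ are any gains such that $\det(\lambda^5I+\lambda^4K_3+\lambda^3K_2+\lambda^2K_1+\lambda K_0+K_I)$ and $\lambda^3+a_1\lambda^2+a_0\lambda+a_I$ are Hurwitz. **Theorem.** With either law, the controller $(\tau,f)$ enables the quadcopter to track the reference $(R_0,\Omega_0,x_0,\dot x_0)$ exponentially. Precisely, let $$E(t)=\|\Delta R\|+\|\Delta\Omega\|+\|\Delta x\|+\|\Delta\dot x\|+|\Delta f|+|\Delta\dot f|\quad\big(+\,\|\sigma\|+|\rho|\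 \text{for law (B)}\big).$$ There are constants $r,c,\mu>0$ such that for every initial time $t_0\ge0$ and every initial state with $R(t_0)\in\mathrm{SO}(3)$ and $E(t_0)<r$, the closed loop has a solution on $[t_0,\infty)$, and every such solution satisfies, for all $t\ge t_0$, $$f(t)\ge0\qquad\text{and}\qquad E(t)\le c\,e^{-\mu(t-t_0)}E(t_0).$$ -/

import Mathlib

open scoped Matrix Matrix.Norms.Frobenius Polynomial

noncomputable section

/-! Vectors of `ℝ³` are functions `Fin 3 → ℝ`; `3 × 3` matrices carry the Frobenius norm. -/

namespace Quadcopter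

/-- Vectors of `ℝ³`. -/
abbrev Vec := Fin 3 → ℝ

/-- Real `3 × 3` matrices. -/
abbrev Mat := Matrix (Fin 3) (Fin 3) ℝ

/-- The Euclidean norm on `ℝ³`. -/
def euclNorm (a : Vec) : ℝ := ‖WithLp.toLp 2 a‖

/-- The rotation group `SO(3)` as a set of matrices. -/
def SO3 : Set Mat := {R | R ∈ Matrix.specialOrthogonalGroup (Fin 3) ℝ}

/-- The third standard basis vector. -/
def e3 : Vec := ![0, 0, 1]

/-- The hat map from `ℝ³` to the skew-symmetric matrices. -/
def hat (a : Vec) : Mat :=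
  !![0, -a 2, a 1;
     a 2, 0, -a 0;
     -a 1, a 0, 0]

/-- The vee map, inverse to `hat` on skew-symmetric matrices. -/
def vee (A : Mat) : Vec := ![A 2 1, A 0 2, A 1 0]

/-- Symmetric part of a matrix. -/
def symPart (A : Mat) : Mat := (1 / 2 : ℝ) • (A + Aᵀ)

/-- Skew-symmetric part of a matrix. -/
def skewPart (A : Mat) : Mat := (1 / 2 : ℝ) • (A - Aᵀ)

/-- State of the quadcopter together with the two states of the dynamic extension of the thrust:
attitude `R`, body angular velocity `Ω`, position `x`, velocity `v`, thrust (per mass) `f` and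
thrust rate `fdot`. -/
structure QuadState where
  R : Mat
  Ω : Vec
  x : Vec
  v : Vec
  f : ℝ
  fdot : ℝ

/-- `S` solves, on `[t₀, ∞)`, the extended equations of motion in the ambient space
`Ṙ = R Ω̂ - kₑ R (Rᵀ R - I)`, `Ω̇ = u`, `ẍ = -g e₃ + f R e₃`, `f̈ = q`. -/
structure IsAmbientSolution (g ke t₀ : ℝ) (S : ℝ → QuadState) (u : ℝ → Vec) (q : ℝ → ℝ) :
    Prop where
  deriv_R : ∀ t ≥ t₀, HasDerivWithinAt (fun s => (S s).R)
    ((S t).R * hat (S t).Ω - ke • ((S t).R * ((S t).Rᵀ * (S t).R - 1))) (Set.Ici t₀) t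
  deriv_Ω : ∀ t ≥ t₀, HasDerivWithinAt (fun s => (S s).Ω) (u t) (Set.Ici t₀) t
  deriv_x : ∀ t ≥ t₀, HasDerivWithinAt (fun s => (S s).x) (S t).v (Set.Ici t₀) t
  deriv_v : ∀ t ≥ t₀, HasDerivWithinAt (fun s => (S s).v)
    (-(g • e3) + (S t).f • ((S t).R *ᵥ e3)) (Set.Ici t₀) t
  deriv_f : ∀ t ≥ t₀, HasDerivWithinAt (fun s => (S s).f) (S t).fdot (Set.Ici t₀) t
  deriv_fdot : ∀ t ≥ t₀, HasDerivWithinAt (fun s => (S s).fdot) (q t) (Set.Ici t₀) t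

/-- `(R, Ω, x, ẋ)` solves, on `[t₀, ∞)`, the equations of motion of the quadcopter on
`SO(3) × ℝ³ × ℝ³ × ℝ³`, with inertia matrix `J`, torque `τ` and thrust `f`:
`Ṙ = R Ω̂`, `J Ω̇ = J Ω × Ω + τ`, `ẍ = -g e₃ + f R e₃`. -/
structure IsQuadcopterSolution (J : Mat) (g t₀ : ℝ) (R : ℝ → Mat) (Ω x v : ℝ → Vec)
    (τ : ℝ → Vec) (f : ℝ → ℝ) : Prop where
  mem_SO3 : ∀ t ≥ t₀, R t ∈ SO3
  deriv_R : ∀ t ≥ t₀, HasDerivWithinAt R (R t * hat (Ω t)) (Set.Ici t₀) t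
  deriv_Ω : ∀ t ≥ t₀, HasDerivWithinAt (fun s => J *ᵥ Ω s)
    (crossProduct (J *ᵥ Ω t) (Ω t) + τ t) (Set.Ici t₀) t
  deriv_x : ∀ t ≥ t₀, HasDerivWithinAt x (v t) (Set.Ici t₀) t
  deriv_v : ∀ t ≥ t₀, HasDerivWithinAt v (-(g • e3) + f t • (R t *ᵥ e3)) (Set.Ici t₀) t

/-! ### Reference signals at a fixed time

`P` is the reference state `(R₀, Ω₀, x₀, ẋ₀, f₀, ḟ₀)` at that time and `u₀`, `q₀` are the reference
controls; along a reference trajectory in `SO(3)` one has `Ω̇₀ = u₀`, `f̈₀ = q₀`, `Ṙ₀ = R₀ Ω̂₀`. -/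

/-- `Ṙ₀`. -/
def dR₀ (P : QuadState) : Mat := P.R * hat P.Ω

/-- `R̈₀`, the derivative of `R₀ Ω̂₀`. -/
def ddR₀ (P : QuadState) (u₀ : Vec) : Mat := dR₀ P * hat P.Ω + P.R * hat u₀

/-- `A₀ = f₀ R₀`. -/
def A₀ (P : QuadState) : Mat := P.f • P.R

/-- `Ȧ₀`. -/
def dA₀ (P : QuadState) : Mat := P.fdot • P.R + P.f • dR₀ P

/-- `Ä₀`. -/
def ddA₀ (P : QuadState) (u₀ : Vec) (q₀ : ℝ) : Mat :=
  q₀ • P.R + (2 * P.fdot) • dR₀ P + P.f • ddR₀ P u₀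

/-- `B₀ = diag [f₀, -f₀, 1]`. -/
def B₀ (P : QuadState) : Mat := Matrix.diagonal ![P.f, -P.f, 1]

/-! ### Coordinates of the linearized system

Here `P` is the reference state and `S` the actual state at the same time. -/

/-- `Z = R₀ᵀ ΔR` with `ΔR = R - R₀`. -/
def Z (P S : QuadState) : Mat := P.Rᵀ * (S.R - P.R)

/-- `Z_s = Sym Z`. -/
def Zs (P S : QuadState) : Mat := symPart (Z P S)

/-- `Z_k = Skew Z`. -/
def Zk (P S : QuadState) : Mat := skewPart (Z P S)

/-- `z_k = Z_k^∨`. -/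
def zk (P S : QuadState) : Vec := vee (Zk P S)

/-- `ż_k = z_k × Ω₀ + ΔΩ`, by the linearized equation. -/
def dzk (P S : QuadState) : Vec := crossProduct (zk P S) P.Ω + (S.Ω - P.Ω)

/-- `Ż_k`, the matrix of `ż_k`. -/
def dZk (P S : QuadState) : Mat := hat (dzk P S)

/-- `Ż_s = [Z_s, Ω̂₀] - 2 kₑ Z_s`, by the linearized equation. -/
def dZs (ke : ℝ) (P S : QuadState) : Mat := ⁅Zs P S, hat P.Ω⁆ - (2 * ke) • Zs P S

/-- The coordinate `Δẍ = (Δf R₀ + A₀ Z_k + A₀ Z_s) e₃`. -/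
def ddΔx (P S : QuadState) : Vec :=
  ((S.f - P.f) • P.R + A₀ P * Zk P S + A₀ P * Zs P S) *ᵥ e3

/-- The third-derivative coordinate of `Δx`:
`(Δḟ R₀ + A₀ Ż_k + Δf Ṙ₀ + Ȧ₀ (Z_s + Z_k) + A₀ ([Z_s, Ω̂₀] - 2 kₑ Z_s)) e₃`. -/
def dddΔx (ke : ℝ) (P S : QuadState) : Vec :=
  ((S.fdot - P.fdot) • P.R + A₀ P * dZk P S + (S.f - P.f) • dR₀ P
    + dA₀ P * (Zs P S + Zk P S) + A₀ P * dZs ke P S) *ᵥ e3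

/-- The matrix
`C = 2 Δḟ Ṙ₀ + 2 Ȧ₀ (Ż_s + Ż_k) + Δf R̈₀ + Ä₀ (Z_s + Z_k)
  + A₀ ([Ż_s, Ω̂₀] + [Z_s, Ω₀-dot-hat] - 2 kₑ Ż_s)`. -/
def Cmat (ke : ℝ) (P : QuadState) (u₀ : Vec) (q₀ : ℝ) (S : QuadState) : Mat :=
  (2 * (S.fdot - P.fdot)) • dR₀ P + (2 : ℝ) • (dA₀ P * (dZs ke P S + dZk P S))
    + (S.f - P.f) • ddR₀ P u₀ + ddA₀ P u₀ q₀ * (Zs P S + Zk P S)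
    + A₀ P * (⁅dZs ke P S, hat P.Ω⁆ + ⁅Zs P S, hat u₀⁆ - (2 * ke) • dZs ke P S)

/-! ### The controller, as a function of the inputs `(v, w)` of the linear normal form -/

/-- `(ũ₂, ũ₁, Δq) = B₀⁻¹ R₀ᵀ (v - C e₃)`. -/
def auxInput (ke : ℝ) (P : QuadState) (u₀ : Vec) (q₀ : ℝ) (S : QuadState) (v : Vec) : Vec :=
  (B₀ P)⁻¹ *ᵥ (P.Rᵀ *ᵥ (v - Cmat ke P u₀ q₀ S *ᵥ e3))

/-- `ũ = (ũ₁, ũ₂, ũ₃)` with `ũ₃ = w`. -/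
def uTilde (ke : ℝ) (P : QuadState) (u₀ : Vec) (q₀ : ℝ) (S : QuadState) (v : Vec) (w : ℝ) : Vec :=
  ![auxInput ke P u₀ q₀ S v 1, auxInput ke P u₀ q₀ S v 0, w]

/-- `q = q₀ + Δq`. -/
def qControl (ke : ℝ) (P : QuadState) (u₀ : Vec) (q₀ : ℝ) (S : QuadState) (v : Vec) : ℝ :=
  q₀ + auxInput ke P u₀ q₀ S v 2

/-- `u = u₀ + Δu` with `Δu = -(z_k × Ω₀ + ΔΩ) × Ω₀ - z_k × Ω̇₀ + ũ`. -/
def uControl (ke : ℝ) (P : QuadState) (u₀ : Vec) (q₀ : ℝ) (S : QuadState) (v : Vec) (w : ℝ) :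
    Vec :=
  u₀ + (-crossProduct (dzk P S) P.Ω - crossProduct (zk P S) u₀ + uTilde ke P u₀ q₀ S v w)

/-- The torque `τ = -J Ω × Ω + J u`. -/
def torque (J : Mat) (Ω u : Vec) : Vec := -crossProduct (J *ᵥ Ω) Ω + J *ᵥ u

/-- `S` is, on `[t₀, ∞)`, a trajectory of the quadcopter under the controller `(τ, f)` that results
from the inputs `(v, w)` and from the reference `(P, u₀, q₀)`: the thrust `f` is the output of the
dynamic extension `f̈ = q`. -/
structure IsClosedLoop (J : Mat) (g ke : ℝ) (P : ℝ → QuadState) (u₀ : ℝ → Vec) (q₀ : ℝ → ℝ)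
    (t₀ : ℝ) (S : ℝ → QuadState) (v : ℝ → Vec) (w : ℝ → ℝ) : Prop where
  quad : IsQuadcopterSolution J g t₀ (fun t => (S t).R) (fun t => (S t).Ω) (fun t => (S t).x)
    (fun t => (S t).v)
    (fun t => torque J (S t).Ω (uControl ke (P t) (u₀ t) (q₀ t) (S t) (v t) (w t)))
    (fun t => (S t).f)
  deriv_f : ∀ t ≥ t₀, HasDerivWithinAt (fun s => (S s).f) (S t).fdot (Set.Ici t₀) t
  deriv_fdot : ∀ t ≥ t₀, HasDerivWithinAt (fun s => (S s).fdot)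
    (qControl ke (P t) (u₀ t) (q₀ t) (S t) (v t)) (Set.Ici t₀) t

/-! ### The linear laws for `(v, w)` -/

/-- `-K₃ Δx⁽³⁾ - K₂ Δẍ - K₁ Δẋ - K₀ Δx`. -/
def vLaw (K₀ K₁ K₂ K₃ : Mat) (ke : ℝ) (P S : QuadState) : Vec :=
  -(K₃ *ᵥ dddΔx ke P S) - K₂ *ᵥ ddΔx P S - K₁ *ᵥ (S.v - P.v) - K₀ *ᵥ (S.x - P.x)

/-- `-a₁ ż_{k3} - a₀ z_{k3}`. -/
def wLaw (a₀ a₁ : ℝ) (P S : QuadState) : ℝ := -(a₁ * dzk P S 2) - a₀ * zk P S 2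

/-- A real polynomial is Hurwitz if all its complex roots have negative real part. -/
def IsHurwitz (p : ℝ[X]) : Prop := ∀ z : ℂ, Polynomial.aeval z p = 0 → z.re < 0

/-- The polynomial `det (λ⁴ I + λ³ K₃ + λ² K₂ + λ K₁ + K₀)`. -/
def charPoly4 (K₀ K₁ K₂ K₃ : Mat) : ℝ[X] :=
  Matrix.det ((Polynomial.X ^ 4 : ℝ[X]) • (1 : Matrix (Fin 3) (Fin 3) ℝ[X])
    + (Polynomial.X ^ 3 : ℝ[X]) • K₃.map Polynomial.C
    + (Polynomial.X ^ 2 : ℝ[X]) • K₂.map Polynomial.C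
    + (Polynomial.X : ℝ[X]) • K₁.map Polynomial.C + K₀.map Polynomial.C)

/-- The polynomial `det (λ⁵ I + λ⁴ K₃ + λ³ K₂ + λ² K₁ + λ K₀ + K_I)`. -/
def charPoly5 (K₀ K₁ K₂ K₃ KI : Mat) : ℝ[X] :=
  Matrix.det ((Polynomial.X ^ 5 : ℝ[X]) • (1 : Matrix (Fin 3) (Fin 3) ℝ[X])
    + (Polynomial.X ^ 4 : ℝ[X]) • K₃.map Polynomial.C
    + (Polynomial.X ^ 3 : ℝ[X]) • K₂.map Polynomial.C
    + (Polynomial.X ^ 2 : ℝ[X]) • K₁.map Polynomial.C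
    + (Polynomial.X : ℝ[X]) • K₀.map Polynomial.C + KI.map Polynomial.C)

/-- Closed loop with the law `v = -K₃ Δx⁽³⁾ - K₂ Δẍ - K₁ Δẋ - K₀ Δx`,
`w = -a₁ ż_{k3} - a₀ z_{k3}`. -/
def IsPDClosedLoop (J : Mat) (g ke : ℝ) (K₀ K₁ K₂ K₃ : Mat) (a₀ a₁ : ℝ)
    (P : ℝ → QuadState) (u₀ : ℝ → Vec) (q₀ : ℝ → ℝ) (t₀ : ℝ) (S : ℝ → QuadState) : Prop :=
  IsClosedLoop J g ke P u₀ q₀ t₀ S (fun t => vLaw K₀ K₁ K₂ K₃ ke (P t) (S t))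
    (fun t => wLaw a₀ a₁ (P t) (S t))

/-- Closed loop with the law `v = -K₃ Δx⁽³⁾ - K₂ Δẍ - K₁ Δẋ - K₀ Δx - K_I σ`,
`w = -a₁ ż_{k3} - a₀ z_{k3} - a_I ρ`, where `σ` and `ρ` are the integrals of `Δx` and of `z_{k3}`,
carried as controller states (`σ(t) = ∫₀ᵗ Δx` and `ρ(t) = ∫₀ᵗ z_{k3}` if they vanish at time
`0`). -/
structure IsPIDClosedLoop (J : Mat) (g ke : ℝ) (K₀ K₁ K₂ K₃ KI : Mat) (a₀ a₁ aI : ℝ)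
    (P : ℝ → QuadState) (u₀ : ℝ → Vec) (q₀ : ℝ → ℝ) (t₀ : ℝ) (S : ℝ → QuadState)
    (σ : ℝ → Vec) (ρ : ℝ → ℝ) : Prop where
  loop : IsClosedLoop J g ke P u₀ q₀ t₀ S
    (fun t => vLaw K₀ K₁ K₂ K₃ ke (P t) (S t) - KI *ᵥ σ t)
    (fun t => wLaw a₀ a₁ (P t) (S t) - aI * ρ t)
  deriv_σ : ∀ t ≥ t₀, HasDerivWithinAt σ ((S t).x - (P t).x) (Set.Ici t₀) t
  deriv_ρ : ∀ t ≥ t₀, HasDerivWithinAt ρ (zk (P t) (S t) 2) (Set.Ici t₀) t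

/-- The tracking error of the quadcopter:
`‖R - R₀‖ + ‖Ω - Ω₀‖ + ‖x - x₀‖ + ‖ẋ - ẋ₀‖`. -/
def trackingError (P S : QuadState) : ℝ :=
  ‖S.R - P.R‖ + euclNorm (S.Ω - P.Ω) + euclNorm (S.x - P.x) + euclNorm (S.v - P.v)

/-- The error of the states of the dynamic extension: `|f - f₀| + |ḟ - ḟ₀|`. -/
def thrustError (P S : QuadState) : ℝ := |S.f - P.f| + |S.fdot - P.fdot|

end Quadcopter

end

/-! ### Exponential decay of linear semigroups -/

section LinearDecay

open NormedSpace

variable {W : Type*} [NormedAddCommGroup W] [NormedSpace ℂ W] [CompleteSpace W]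

/-! Work with the error e = (ΔR, ΔΩ, Δx, Δẋ, Δf, Δḟ, σ, ρ), integral states included. In closed loop
it solves ė = L(t)e + Q(e). Here L(t) is linear, with coefficients bounded uniformly in time because
the reference is bounded and f₀ ≥ δ, and Q is quadratic (`linField`, `quadField`).

The heart of the proof is a time-dependent linear change of variables. The coordinates y = (Δx, Δẋ,
Δẍ, Δx⁽³⁾, z_{k3}, ż_{k3}, σ, ρ), where Δẍ and Δx⁽³⁾ denote the linearized expressions, satisfy ẏ =
Ay + O(|e|²) with a constant matrix A (`ErrorFlowAt.coord`): C collects every input-free term of the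
next linearized derivative, and B₀⁻¹R₀ᵀ inverts the way the inputs enter. The Hurwitz hypotheses say
that all eigenvalues of A have negative real part (`isStable_pdGains`, `isStable_pidGains`), so
exp(tA) decays exponentially.

Two points involve Z_s, the six dimensions of e that y does not see. In the linearization Z_s is
damped by kₑ, whereas the quadcopter itself obeys Ṙ = RΩ̂ with no such damping. Both are harmless
because on SO(3) one has Z_s = -½ ΔRᵀΔR, which is of second order (`Zs_eq_of_orth`). Hence the
mismatch in kₑ is one more quadratic remainder, and since e is controlled by y and Z_s together
(`isBigO_err_coordNorm`), small errors satisfy |e| ≤ const · |y|.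

From here the argument is Lyapunov's indirect method. As long as e is small the remainder is at most
ε|y|, and Duhamel's formula gives decay (`norm_le_of_perturbed_linear`, `exists_local_decay`); a
continuation argument shows that e never leaves the small ball (`exists_global_decay`). A solution
is produced by truncating the vector field outside the unit ball, where Picard–Lindelöf yields a
global curve; the decay estimate then keeps that curve where the truncation is inactive. The
estimate applies to an arbitrary solution, so uniqueness of the closed loop is never needed. Finally
|Δf| ≤ δ ≤ f₀ gives f ≥ 0. -/

theorem hasDerivAt_exp_smul_apply (A : W →L[ℂ] W) (w : W) (t : ℝ) :
    HasDerivAt (fun s : ℝ => exp (s • A) w) (exp (t • A) (A w)) t := by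
  have h := (ContinuousLinearMap.apply ℂ W w).restrictScalars ℝ |>.hasFDerivAt.comp_hasDerivAt t
    (hasDerivAt_exp_smul_const (𝕂 := ℝ) A t)
  simpa [Function.comp_def] using h

/-- The orbit of a generalized eigenvector is e^{ev·t} times a polynomial in t, and the gap between
Re ev and -ν absorbs the polynomial. The induction on k avoids writing the polynomial: e^{-ev·s}
exp(sA)w has derivative e^{-ev·s} exp(sA)(A - ev)w, and (A - ev)w has order one less. -/
theorem exists_norm_exp_smul_apply_le_of_pow_apply_eq_zero (A : W →L[ℂ] W) {ev : ℂ} {ν : ℝ}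
    (hν : ev.re < -ν) (k : ℕ) (w : W)
    (hw : (((A : Module.End ℂ W) - ev • (1 : Module.End ℂ W)) ^ k) w = 0) :
    ∃ C : ℝ, ∀ t : ℝ, 0 ≤ t → ‖exp (t • A) w‖ ≤ C * Real.exp (-ν * t) := by
  induction k generalizing w with
  | zero => exact ⟨0, fun t _ => by simp_all⟩
  | succ k ih =>
    rw [pow_succ, Module.End.mul_apply] at hw
    obtain ⟨C, hC⟩ := ih _ hw
    set κ : ℝ := -ev.re - ν with hκ
    have hκ0 : 0 < κ := by linarith
    have hC0 : 0 ≤ C := by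
      have := (norm_nonneg _).trans (hC 0 le_rfl)
      simpa using this
    refine ⟨‖w‖ + C / κ, fun t ht => ?_⟩
    have hd : ∀ s : ℝ, HasDerivAt (fun s : ℝ => Complex.exp (-ev * s) • exp (s • A) w)
        (Complex.exp (-ev * s) • exp (s • A) (A w - ev • w)) s := by
      intro s
      have h1 : HasDerivAt (fun s : ℝ => Complex.exp (-ev * s)) (Complex.exp (-ev * s) * -ev) s := by
        have := ((Complex.ofRealCLM.hasDerivAt (x := s)).const_mul (-ev)).cexp
        simpa using this
      have h2 := h1.smul (hasDerivAt_exp_smul_apply A w s)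
      refine h2.congr_deriv ?_
      rw [map_sub, map_smul, smul_sub, mul_smul, neg_smul, smul_neg]
      abel
    have hexp : ∀ s : ℝ, ‖Complex.exp (-ev * s)‖ = Real.exp (-ev.re * s) := by
      intro s; rw [Complex.norm_exp]; simp
    -- The comparison function is ‖w‖ plus a primitive of C e^{κs}; the strict gap κ > 0 keeps this
    -- primitive of the same exponential size.
    have hB : ∀ s : ℝ, HasDerivAt (fun s : ℝ => ‖w‖ + C / κ * Real.exp (κ * s))
        (C * Real.exp (κ * s)) s := by
      intro s
      have := (((hasDerivAt_id s).const_mul κ).exp.const_mul (C / κ)).const_add ‖w‖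
      refine this.congr_deriv ?_
      simp only [id, mul_one]; field_simp
    have key := image_norm_le_of_norm_deriv_right_le_deriv_boundary (a := 0) (b := t)
      (f := fun s : ℝ => Complex.exp (-ev * s) • exp (s • A) w)
      (fun s _ => (hd s).continuousAt.continuousWithinAt)
      (fun s _ => (hd s).hasDerivWithinAt) (B := fun s => ‖w‖ + C / κ * Real.exp (κ * s))
      (by simp; positivity) hB
      (by
        intro s hs
        rw [norm_smul, hexp]
        have := hC s hs.1
        calc Real.exp (-ev.re * s) * ‖exp (s • A) (A w - ev • w)‖
            ≤ Real.exp (-ev.re * s) * (C * Real.exp (-ν * s)) := by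
              gcongr; simpa using this
          _ = C * Real.exp (κ * s) := by
              rw [mul_left_comm, ← Real.exp_add, hκ]; ring_nf)
      (Set.right_mem_Icc.2 ht)
    simp only [norm_smul, hexp] at key
    have h1 : 1 ≤ Real.exp (κ * t) := Real.one_le_exp (by positivity)
    have h2 : Real.exp (-ev.re * t) * Real.exp (ev.re * t) = 1 := by
      rw [← Real.exp_add]; simp
    calc ‖exp (t • A) w‖
        = Real.exp (ev.re * t) * (Real.exp (-ev.re * t) * ‖exp (t • A) w‖) := by
          rw [← mul_assoc, mul_comm (Real.exp _), h2, one_mul]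
      _ ≤ Real.exp (ev.re * t) * ((‖w‖ + C / κ) * Real.exp (κ * t)) := by
          refine mul_le_mul_of_nonneg_left (key.trans ?_) (Real.exp_nonneg _)
          nlinarith [norm_nonneg w]
      _ = _ := by
          rw [mul_left_comm, ← Real.exp_add, hκ]; ring_nf

theorem exists_neg_bound_of_finite {s : Set ℂ} (hs : s.Finite) (h : ∀ z ∈ s, z.re < 0) :
    ∃ ν : ℝ, 0 < ν ∧ ∀ z ∈ s, z.re < -ν := by
  induction s, hs using Set.Finite.induction_on with
  | empty => exact ⟨1, one_pos, by simp⟩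
  | insert _ _ ih =>
    rename_i a s _ _
    obtain ⟨ν, hν, hs⟩ := ih fun z hz => h z (Set.mem_insert_of_mem _ hz)
    have ha := h a (Set.mem_insert _ _)
    refine ⟨min ν (-a.re / 2), lt_min hν (by linarith), ?_⟩
    rintro z (rfl | hz)
    · linarith [min_le_right ν (-z.re / 2)]
    · linarith [min_le_left ν (-a.re / 2), hs z hz]

/-- A linear operator on a finite-dimensional complex space all of whose eigenvalues have negative
real part generates an exponentially decaying semigroup. -/
theorem exists_norm_exp_smul_le [FiniteDimensional ℂ W] (A : W →L[ℂ] W)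
    (hA : ∀ (ev : ℂ) (w : W), w ≠ 0 → A w = ev • w → ev.re < 0) :
    ∃ C : ℝ, 0 < C ∧ ∃ ν : ℝ, 0 < ν ∧ ∀ t : ℝ, 0 ≤ t → ‖exp (t • A)‖ ≤ C * Real.exp (-ν * t) := by
  obtain ⟨ν, hν, hνe⟩ := exists_neg_bound_of_finite
    (Module.End.finite_hasEigenvalue (A : Module.End ℂ W)) (by
      intro z hz
      obtain ⟨w, hw⟩ := hz.exists_hasEigenvector
      exact hA z w hw.2 (by simpa using hw.apply_eq_smul))
  -- The vectors decaying at rate ν, each with its own constant, form a subspace. It contains every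
  -- generalized eigenspace, and over ℂ these span W.
  let D : Submodule ℂ W :=
    { carrier := {w | ∃ C : ℝ, ∀ t : ℝ, 0 ≤ t → ‖exp (t • A) w‖ ≤ C * Real.exp (-ν * t)}
      zero_mem' := ⟨0, by simp⟩
      add_mem' := by
        rintro a b ⟨Ca, ha⟩ ⟨Cb, hb⟩
        refine ⟨Ca + Cb, fun t ht => ?_⟩
        rw [map_add, add_mul]
        exact (norm_add_le _ _).trans (add_le_add (ha t ht) (hb t ht))
      smul_mem' := by
        rintro c a ⟨Ca, ha⟩
        refine ⟨‖c‖ * Ca, fun t ht => ?_⟩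
        rw [map_smul, norm_smul, mul_assoc]
        gcongr
        exact ha t ht }
  have hD : D = ⊤ := by
    rw [eq_top_iff, ← Module.End.iSup_maxGenEigenspace_eq_top (A : Module.End ℂ W)]
    refine iSup_le fun ev w hw => ?_
    obtain ⟨k, hk⟩ := (Module.End.mem_maxGenEigenspace _ _ _).1 hw
    by_cases hev : Module.End.HasEigenvalue (A : Module.End ℂ W) ev
    · exact exists_norm_exp_smul_apply_le_of_pow_apply_eq_zero A (hνe ev hev) k w hk
    · have : w = 0 := by
        have hinj : Function.Injective ((A : Module.End ℂ W) - ev • (1 : Module.End ℂ W)) := by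
          rw [← LinearMap.ker_eq_bot]
          by_contra hne
          exact hev (by
            rw [Module.End.hasEigenvalue_iff, Module.End.eigenspace_def]
            simpa [Algebra.algebraMap_eq_smul_one] using hne)
        have hpow : Function.Injective
            ⇑(((A : Module.End ℂ W) - ev • (1 : Module.End ℂ W)) ^ k) := by
          rw [Module.End.coe_pow]; exact hinj.iterate k
        exact hpow (by rw [hk, map_zero])
      rw [this]; exact zero_mem _
  -- The constants so far depend on the vector; uniform boundedness of the operators e^{νt} exp(tA),
  -- t ≥ 0, turns them into one.
  obtain ⟨C, hC⟩ := banach_steinhaus (𝕜 := ℂ) (E := W) (F := W) (ι := Set.Ici (0 : ℝ))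
    (g := fun t => Real.exp (ν * t) • exp ((t : ℝ) • A)) (by
      intro w
      obtain ⟨C, hC⟩ : w ∈ D := hD ▸ Submodule.mem_top
      refine ⟨C, fun t => ?_⟩
      rw [smul_apply, norm_smul, Real.norm_of_nonneg (Real.exp_nonneg _)]
      calc _ ≤ Real.exp (ν * t) * (C * Real.exp (-ν * t)) := by
            gcongr; exact hC t t.2
        _ = C := by rw [mul_left_comm, ← Real.exp_add]; simp)
  refine ⟨max C 1, by positivity, ν, hν, fun t ht => ?_⟩
  have h := hC ⟨t, ht⟩
  rw [norm_smul, Real.norm_of_nonneg (Real.exp_nonneg _)] at h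
  have h2 : Real.exp (-ν * t) * Real.exp (ν * t) = 1 := by rw [← Real.exp_add]; simp
  calc ‖exp (t • A)‖ = Real.exp (-ν * t) * (Real.exp (ν * t) * ‖exp (t • A)‖) := by
        rw [← mul_assoc, h2, one_mul]
    _ ≤ Real.exp (-ν * t) * max C 1 := by gcongr; exact h.trans (le_max_left _ _)
    _ = _ := mul_comm _ _

/-- Exponential decay persists under perturbations that are small relative to the solution. -/
theorem norm_le_of_perturbed_linear {A : W →L[ℂ] W} {C ν ε : ℝ} (hC : 0 < C) (hν : 0 < ν)
    (hA : ∀ t : ℝ, 0 ≤ t → ‖exp (t • A)‖ ≤ C * Real.exp (-ν * t)) (hε0 : 0 ≤ ε)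
    (hε : C * ε ≤ ν / 4) {t₀ T : ℝ} {ξ h : ℝ → W}
    (hξ : ∀ t ∈ Set.Icc t₀ T, HasDerivWithinAt ξ (A (ξ t) + h t) (Set.Ici t₀) t)
    (hh : ∀ t ∈ Set.Icc t₀ T, ‖h t‖ ≤ ε * ‖ξ t‖) :
    ∀ t ∈ Set.Icc t₀ T, ‖ξ t‖ ≤ 2 * C * Real.exp (-(ν / 2) * (t - t₀)) * ‖ξ t₀‖ := by
  intro t₁ ht₁
  have hcont : ContinuousOn (fun s => Real.exp (ν / 2 * (s - t₀)) * ‖ξ s‖) (Set.Icc t₀ T) := by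
    refine ContinuousOn.mul (by fun_prop) (ContinuousOn.norm fun s hs => ?_)
    exact (hξ s hs).continuousWithinAt.mono Set.Icc_subset_Ici_self
  -- Weight the norm by e^{(ν/2)(s - t₀)} and let m be its maximum on the compact interval. It
  -- suffices to bound m, so Duhamel's formula is needed only at the maximizing time t.
  obtain ⟨t, ht, hmax⟩ := isCompact_Icc.exists_isMaxOn ⟨t₁, ht₁⟩ hcont
  set m : ℝ := Real.exp (ν / 2 * (t - t₀)) * ‖ξ t‖ with hm
  have hm0 : 0 ≤ m := by positivity
  have hle : ∀ s ∈ Set.Icc t₀ T, ‖ξ s‖ ≤ m * Real.exp (-(ν / 2) * (s - t₀)) := by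
    intro s hs
    have h1 : Real.exp (ν / 2 * (s - t₀)) * ‖ξ s‖ ≤ m := hmax hs
    have h2 : Real.exp (-(ν / 2) * (s - t₀)) * Real.exp (ν / 2 * (s - t₀)) = 1 := by
      rw [← Real.exp_add]; simp
    calc ‖ξ s‖ = Real.exp (-(ν / 2) * (s - t₀)) * (Real.exp (ν / 2 * (s - t₀)) * ‖ξ s‖) := by
          rw [← mul_assoc, h2, one_mul]
      _ ≤ Real.exp (-(ν / 2) * (s - t₀)) * m := by gcongr
      _ = _ := mul_comm _ _
  -- Duhamel's formula in differential form: in exp((t - s)A) ξ(s) the term Aξ cancels and only the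
  -- perturbation remains. The curve runs from exp((t - t₀)A) ξ(t₀) to ξ(t).
  have hd : ∀ s ∈ Set.Icc t₀ t, HasDerivWithinAt (fun s => exp ((t - s) • A) (ξ s))
      (exp ((t - s) • A) (h s)) (Set.Ici t₀) s := by
    intro s hs
    have h1 : HasDerivAt (fun s : ℝ => exp ((t - s) • A)) (-(exp ((t - s) • A) * A)) s := by
      have := (hasDerivAt_exp_smul_const (𝕂 := ℝ) A (t - s)).scomp s
        ((hasDerivAt_id s).const_sub t)
      simpa [Function.comp_def] using this
    have h2 := (ContinuousLinearMap.restrictScalarsL ℂ W W ℝ ℝ).hasFDerivAt.comp_hasDerivAt s h1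
    have h3 := h2.hasDerivWithinAt.clm_apply (hξ s ⟨hs.1, hs.2.trans ht.2⟩)
    simpa using h3
  -- The s-independent factor of the derivative bound Cεm e^{-ν(t-s)} e^{-(ν/2)(s-t₀)}; what is left
  -- is e^{(ν/2)s}.
  set K : ℝ := C * ε * m * Real.exp (-ν * t + ν / 2 * t₀) with hK
  have hB : ∀ s : ℝ, HasDerivAt (fun s : ℝ => C * Real.exp (-ν * (t - t₀)) * ‖ξ t₀‖
      + K / (ν / 2) * Real.exp (ν / 2 * s)) (K * Real.exp (ν / 2 * s)) s := by
    intro s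
    have := (((hasDerivAt_id s).const_mul (ν / 2)).exp.const_mul (K / (ν / 2))).const_add
      (C * Real.exp (-ν * (t - t₀)) * ‖ξ t₀‖)
    refine this.congr_deriv ?_
    simp only [id, mul_one]; field_simp
  have key := image_norm_le_of_norm_deriv_right_le_deriv_boundary (a := t₀) (b := t)
    (fun s hs => (hd s hs).continuousWithinAt.mono Set.Icc_subset_Ici_self)
    (fun s hs => (hd s ⟨hs.1, hs.2.le⟩).mono (Set.Ici_subset_Ici.2 hs.1))
    (B := fun s : ℝ => C * Real.exp (-ν * (t - t₀)) * ‖ξ t₀‖ + K / (ν / 2) * Real.exp (ν / 2 * s))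
    (by
      have h1 := (exp ((t - t₀) • A)).le_opNorm (ξ t₀)
      have h2 := mul_le_mul_of_nonneg_right (hA (t - t₀) (by linarith [ht.1])) (norm_nonneg (ξ t₀))
      have h3 : 0 ≤ K / (ν / 2) * Real.exp (ν / 2 * t₀) := by positivity
      linarith) hB
    (by
      intro s hs
      have hs' : s ∈ Set.Icc t₀ T := ⟨hs.1, hs.2.le.trans ht.2⟩
      calc ‖exp ((t - s) • A) (h s)‖ ≤ ‖exp ((t - s) • A)‖ * ‖h s‖ :=
            ContinuousLinearMap.le_opNorm _ _
        _ ≤ (C * Real.exp (-ν * (t - s))) * (ε * (m * Real.exp (-(ν / 2) * (s - t₀)))) := by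
            gcongr
            · exact hA _ (by linarith [hs.2])
            · exact (hh s hs').trans (by gcongr; exact hle s hs')
        _ = C * ε * m * (Real.exp (-ν * (t - s)) * Real.exp (-(ν / 2) * (s - t₀))) := by ring
        _ = K * Real.exp (ν / 2 * s) := by
            rw [hK, mul_assoc _ (Real.exp _) (Real.exp _), ← Real.exp_add, ← Real.exp_add]
            ring_nf)
    (Set.right_mem_Icc.2 ht.1)
  simp only [sub_self, zero_smul, NormedSpace.exp_zero, one_apply_eq_self] at key
  have e1 : Real.exp (ν / 2 * (t - t₀)) * Real.exp (-ν * (t - t₀)) ≤ 1 := by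
    rw [← Real.exp_add, Real.exp_le_one_iff]
    nlinarith [ht.1]
  have e2 : Real.exp (ν / 2 * (t - t₀)) * (K / (ν / 2) * Real.exp (ν / 2 * t))
      = C * ε * m / (ν / 2) := by
    have : Real.exp (ν / 2 * (t - t₀)) * (Real.exp (-ν * t + ν / 2 * t₀) * Real.exp (ν / 2 * t))
        = 1 := by
      rw [← Real.exp_add, ← Real.exp_add, Real.exp_eq_one_iff]; ring
    calc _ = C * ε * m / (ν / 2) * (Real.exp (ν / 2 * (t - t₀)) *
          (Real.exp (-ν * t + ν / 2 * t₀) * Real.exp (ν / 2 * t))) := by rw [hK]; ring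
      _ = _ := by rw [this, mul_one]
  -- Here C ε ≤ ν/4 is used: the perturbation contributes at most m/2, which is absorbed on the left
  -- and leaves the factor 2 in the conclusion.
  have e3 : C * ε * m / (ν / 2) ≤ m / 2 := by
    rw [div_le_iff₀ (by positivity)]
    nlinarith
  have hmle : m ≤ 2 * C * ‖ξ t₀‖ := by
    have h1 := mul_le_mul_of_nonneg_left key (Real.exp_nonneg (ν / 2 * (t - t₀)))
    rw [mul_add, e2, ← hm] at h1
    have h2 : Real.exp (ν / 2 * (t - t₀)) * (C * Real.exp (-ν * (t - t₀)) * ‖ξ t₀‖)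
        ≤ C * ‖ξ t₀‖ := by
      have := mul_le_mul_of_nonneg_right e1 (by positivity : 0 ≤ C * ‖ξ t₀‖)
      linarith
    linarith
  calc ‖ξ t₁‖ ≤ m * Real.exp (-(ν / 2) * (t₁ - t₀)) := hle t₁ ht₁
    _ ≤ 2 * C * ‖ξ t₀‖ * Real.exp (-(ν / 2) * (t₁ - t₀)) := by gcongr
    _ = _ := by ring

end LinearDecay

/-! ### Global solutions of ordinary differential equations -/

section GlobalODE

open Set
open scoped NNReal

variable {E : Type*} [NormedAddCommGroup E] [NormedSpace ℝ E]

/-- Picard–Lindelöf on [t₀, t₀ + n + 1] for every n, glued by uniqueness. A globally bounded field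
makes every such interval admissible in a single application. -/
theorem exists_forall_ge_hasDerivWithinAt_of_lipschitz [CompleteSpace E] {f : ℝ → E → E} {t₀ : ℝ}
    {K L : ℝ≥0} (hK : ∀ t ≥ t₀, LipschitzWith K (f t)) (hc : ∀ x, ContinuousOn (f · x) (Ici t₀))
    (hL : ∀ t ≥ t₀, ∀ x, ‖f t x‖ ≤ L) (x₀ : E) :
    ∃ α : ℝ → E, α t₀ = x₀ ∧ ∀ t ≥ t₀, HasDerivWithinAt α (f t (α t)) (Ici t₀) t := by
  have hloc : ∀ n : ℕ, ∃ α : ℝ → E, α t₀ = x₀ ∧ ∀ t ∈ Icc t₀ (t₀ + (n + 1)),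
      HasDerivWithinAt α (f t (α t)) (Icc t₀ (t₀ + (n + 1))) t := by
    intro n
    have hmem : t₀ ∈ Icc t₀ (t₀ + ((n : ℝ) + 1)) := ⟨le_rfl, by linarith [n.cast_nonneg (α := ℝ)]⟩
    -- The radius L(n + 1) is the greatest distance that a curve of speed at most L covers in time n
    -- + 1.
    have hPL : IsPicardLindelof f (⟨t₀, hmem⟩ : Icc t₀ (t₀ + ((n : ℝ) + 1))) x₀
        (L * (n + 1)) 0 L K :=
      { lipschitzOnWith := fun t ht => (hK t ht.1).lipschitzOnWith
        continuousOn := fun x _ => (hc x).mono Icc_subset_Ici_self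
        norm_le := fun t ht x _ => hL t ht.1 x
        mul_max_le := by
          simp only [add_sub_cancel_left, sub_self, NNReal.coe_mul, NNReal.coe_add,
            NNReal.coe_natCast, NNReal.coe_one, NNReal.coe_zero, sub_zero]
          rw [max_eq_left (by positivity)] }
    exact hPL.exists_eq_forall_mem_Icc_hasDerivWithinAt₀
  choose α hα₀ hα using hloc
  have hagree : ∀ n m : ℕ, n ≤ m → EqOn (α n) (α m) (Icc t₀ (t₀ + (n + 1))) := by
    intro n m hnm
    have hle : t₀ + ((n : ℝ) + 1) ≤ t₀ + (m + 1) := by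
      have : (n : ℝ) ≤ m := by exact_mod_cast hnm
      linarith
    have hsub : Icc t₀ (t₀ + ((n : ℝ) + 1)) ⊆ Icc t₀ (t₀ + (m + 1)) := Icc_subset_Icc_right hle
    refine ODE_solution_unique_of_mem_Icc_right (v := f) (s := fun _ => univ) (K := K)
      (fun t ht => (hK t ht.1).lipschitzOnWith)
      (fun t ht => (hα n t ht).continuousWithinAt) (fun t ht => ?_) (fun _ _ => mem_univ _)
      (fun t ht => ((hα m t (hsub ht)).mono hsub).continuousWithinAt) (fun t ht => ?_)
      (fun _ _ => mem_univ _) ((hα₀ n).trans (hα₀ m).symm)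
    · exact (hα n t (Ico_subset_Icc_self ht)).mono_of_mem_nhdsWithin (Icc_mem_nhdsGE_of_mem ht)
    · exact (hα m t (hsub (Ico_subset_Icc_self ht))).mono_of_mem_nhdsWithin
        (Icc_mem_nhdsGE_of_mem ⟨ht.1, ht.2.trans_le hle⟩)
  have hglue : ∀ n : ℕ, EqOn (fun t => α ⌈t - t₀⌉₊ t) (α n) (Icc t₀ (t₀ + n)) := by
    intro n t ht
    refine hagree _ n (Nat.ceil_le.2 (by linarith [ht.2])) ⟨ht.1, ?_⟩
    linarith [Nat.le_ceil (t - t₀)]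
  refine ⟨fun t => α ⌈t - t₀⌉₊ t, by simpa using hα₀ 0, fun t ht => ?_⟩
  -- The strict inequality makes [t₀, t₀ + n] a neighbourhood of t within [t₀, ∞), so the derivative
  -- of the n-th local solution is that of the glued curve.
  obtain ⟨n, hn⟩ := exists_nat_gt (t - t₀)
  have htn : t ∈ Icc t₀ (t₀ + n) := ⟨ht, by linarith⟩
  have h1 := (hα n t ⟨ht, by linarith⟩).mono
    (Icc_subset_Icc_right (by linarith) : Icc t₀ (t₀ + (n : ℝ)) ⊆ Icc t₀ (t₀ + (n + 1)))
  have h2 := h1.congr (fun s hs => hglue n hs) (hglue n htn)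
  rw [hglue n htn]
  refine h2.mono_of_mem_nhdsWithin ?_
  rw [← Ici_inter_Iic]
  exact Filter.inter_mem self_mem_nhdsWithin (mem_nhdsWithin_of_mem_nhds (Iic_mem_nhds (by linarith)))

/-- The radial retraction onto the closed unit ball. -/
noncomputable def unitRetraction (x : E) : E := (max 1 ‖x‖)⁻¹ • x

theorem unitRetraction_of_norm_le {x : E} (hx : ‖x‖ ≤ 1) : unitRetraction x = x := by
  simp [unitRetraction, max_eq_left hx]

theorem norm_unitRetraction_le (x : E) : ‖unitRetraction x‖ ≤ 1 := by
  have : 0 < max 1 ‖x‖ := by positivity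
  rw [unitRetraction, norm_smul, norm_inv, Real.norm_of_nonneg this.le, inv_mul_le_iff₀ this,
    mul_one]
  exact le_max_right _ _

theorem lipschitzWith_unitRetraction : LipschitzWith 2 (unitRetraction (E := E)) := by
  refine LipschitzWith.of_dist_le_mul fun x y => ?_
  set a : ℝ := max 1 ‖x‖ with ha
  set b : ℝ := max 1 ‖y‖ with hb
  have ha1 : 1 ≤ a := le_max_left _ _
  have hb1 : 1 ≤ b := le_max_left _ _
  have ha0 : 0 < a := by linarith
  have hb0 : 0 < b := by linarith
  have hab : |b - a| ≤ ‖x - y‖ := by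
    have := abs_max_sub_max_le_max 1 ‖y‖ 1 ‖x‖
    rw [sub_self, abs_zero, max_eq_right (abs_nonneg (‖y‖ - ‖x‖)), ← ha, ← hb] at this
    rw [norm_sub_rev]
    exact this.trans (abs_norm_sub_norm_le y x)
  -- Each summand is at most ‖x - y‖, since 1/a ≤ 1, ‖y/b‖ ≤ 1 and |b - a| ≤ ‖x - y‖. This gives the
  -- Lipschitz constant 2.
  have hdecomp : unitRetraction x - unitRetraction y = a⁻¹ • (x - y) + (a⁻¹ * (b - a)) • b⁻¹ • y := by
    rw [unitRetraction, unitRetraction, ← ha, ← hb, smul_sub, smul_smul]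
    have : a⁻¹ * (b - a) * b⁻¹ = a⁻¹ - b⁻¹ := by field_simp
    rw [this, sub_smul]; abel
  have hy : ‖b⁻¹ • y‖ ≤ 1 := norm_unitRetraction_le y
  have hai : a⁻¹ ≤ 1 := inv_le_one_of_one_le₀ ha1
  rw [dist_eq_norm, dist_eq_norm, hdecomp]
  calc _ ≤ a⁻¹ * ‖x - y‖ + a⁻¹ * |b - a| * ‖b⁻¹ • y‖ := by
        refine (norm_add_le _ _).trans_eq ?_
        rw [norm_smul, norm_smul _ (b⁻¹ • y), norm_mul, norm_inv, Real.norm_of_nonneg ha0.le,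
          Real.norm_eq_abs]
    _ ≤ 1 * ‖x - y‖ + 1 * ‖x - y‖ * 1 := by gcongr
    _ = _ := by simp; ring

/-- A vector field that is bounded and Lipschitz on the unit ball has curves that exist for all
times and are integral curves wherever they lie in the unit ball. -/
theorem exists_continuousOn_hasDerivWithinAt_of_norm_le_one [CompleteSpace E] {f : ℝ → E → E}
    {t₀ : ℝ} {K L : ℝ≥0} (hK : ∀ t ≥ t₀, LipschitzOnWith K (f t) (Metric.closedBall 0 1))
    (hc : ∀ x, ContinuousOn (f · x) (Ici t₀))
    (hL : ∀ t ≥ t₀, ∀ x, ‖x‖ ≤ 1 → ‖f t x‖ ≤ L) (x₀ : E) :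
    ∃ α : ℝ → E, α t₀ = x₀ ∧ ContinuousOn α (Ici t₀) ∧
      ∀ t ≥ t₀, ‖α t‖ ≤ 1 → HasDerivWithinAt α (f t (α t)) (Ici t₀) t := by
  -- Composing the field with the retraction makes it globally bounded and Lipschitz without
  -- changing it on the unit ball.
  obtain ⟨α, hα₀, hα⟩ := exists_forall_ge_hasDerivWithinAt_of_lipschitz
    (f := fun t x => f t (unitRetraction x)) (t₀ := t₀) (K := K * 2) (L := L)
    (fun t ht => by
      rw [← lipschitzOnWith_univ]
      exact (hK t ht).comp lipschitzWith_unitRetraction.lipschitzOnWith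
        fun x _ => by simpa using norm_unitRetraction_le x)
    (fun x => hc _) (fun t ht x => hL t ht _ (norm_unitRetraction_le x)) x₀
  refine ⟨α, hα₀, fun t ht => (hα t ht).continuousWithinAt, fun t ht h => ?_⟩
  have := hα t ht
  rwa [unitRetraction_of_norm_le h] at this

/-- A continuous function that starts below `r` and that is below `r` whenever it has been at most
`r` so far stays below `r`. -/
theorem forall_lt_of_continuation {φ : ℝ → ℝ} {t₀ r : ℝ} (hφ : ContinuousOn φ (Ici t₀))
    (h₀ : φ t₀ < r) (h : ∀ T ≥ t₀, (∀ t ∈ Icc t₀ T, φ t ≤ r) → φ T < r) :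
    ∀ t ≥ t₀, φ t < r := by
  intro t ht
  by_contra! hr
  have hcont : ∀ {s}, ContinuousOn φ (Icc t₀ s) := hφ.mono Icc_subset_Ici_self
  have hclosed : IsCompact {s ∈ Icc t₀ t | φ s = r} :=
    isCompact_Icc.of_isClosed_subset
      (hcont.preimage_isClosed_of_isClosed isClosed_Icc isClosed_singleton) fun s hs => hs.1
  obtain ⟨s, hs, hsr⟩ := intermediate_value_Icc ht hcont ⟨h₀.le, hr⟩
  -- T is the first time at which φ equals r. By the intermediate value theorem φ is at most r
  -- before T, so the continuation hypothesis contradicts φ T = r.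
  obtain ⟨T, ⟨hT, hTr⟩, hmin⟩ := hclosed.exists_isLeast ⟨s, hs, hsr⟩
  refine (h T hT.1 fun s hs => ?_).ne hTr
  by_contra! hlt
  obtain ⟨s', hs', hsr'⟩ := intermediate_value_Icc hs.1 hcont ⟨h₀.le, hlt.le⟩
  have h1 : T ≤ s' := hmin ⟨⟨hs'.1, (hs'.2.trans hs.2).trans hT.2⟩, hsr'⟩
  have h2 : s = T := le_antisymm hs.2 (h1.trans hs'.2)
  rw [h2, hTr] at hlt
  exact lt_irrefl _ hlt

end GlobalODE

noncomputable section

/-! ### Linear and bilinear maps between finite-dimensional spaces -/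

section FiniteDim

open Asymptotics Filter

variable {E F G α : Type*} [NormedAddCommGroup E] [NormedSpace ℝ E] [FiniteDimensional ℝ E]
  [NormedAddCommGroup F] [NormedSpace ℝ F]
  [NormedAddCommGroup G] [NormedSpace ℝ G]

/-- A bilinear map on finite-dimensional spaces as a continuous bilinear map. -/
def bilinToCLM [FiniteDimensional ℝ F] (B : E →ₗ[ℝ] F →ₗ[ℝ] G) : E →L[ℝ] F →L[ℝ] G :=
  LinearMap.toContinuousLinearMap
    ((LinearMap.toContinuousLinearMap : (F →ₗ[ℝ] G) ≃ₗ[ℝ] (F →L[ℝ] G)).toLinearMap ∘ₗ B)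

theorem LinearMap.isBigO_comp_of_finiteDimensional (L : E →ₗ[ℝ] F) {f : α → E} {g : α → ℝ}
    {l : Filter α} (hf : f =O[l] g) : (fun x => L (f x)) =O[l] g :=
  ((LinearMap.toContinuousLinearMap L).isBigO_comp f l).trans hf

theorem LinearMap.isBigO_comp₂_of_finiteDimensional [FiniteDimensional ℝ F]
    (B : E →ₗ[ℝ] F →ₗ[ℝ] G) {f : α → E} {f' : α → F} {g g' : α → ℝ} {l : Filter α} (hf : f =O[l] g) (hf' : f' =O[l] g') :
    (fun x => B (f x) (f' x)) =O[l] fun x => g x * g' x := by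
  have h : (fun x => B (f x) (f' x)) =O[l] fun x => ‖f x‖ * ‖f' x‖ :=
    IsBigO.of_bound ‖bilinToCLM B‖ (Eventually.of_forall fun x => by
      rw [norm_mul, norm_norm, norm_norm, ← mul_assoc]
      exact (bilinToCLM B).le_opNorm₂ (f x) (f' x))
  exact h.trans (hf.norm_left.mul hf'.norm_left)

theorem HasDerivWithinAt.linearMap_comp (L : E →ₗ[ℝ] F) {f : ℝ → E} {f' : E} {s : Set ℝ} {t : ℝ}
    (hf : HasDerivWithinAt f f' s t) : HasDerivWithinAt (fun x => L (f x)) (L f') s t :=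
  (LinearMap.toContinuousLinearMap L).hasFDerivAt.comp_hasDerivWithinAt t hf

theorem HasDerivWithinAt.bilinearMap_comp [FiniteDimensional ℝ F]
    (B : E →ₗ[ℝ] F →ₗ[ℝ] G) {f : ℝ → E} {g : ℝ → F} {f' : E} {g' : F} {s : Set ℝ} {t : ℝ} (hf : HasDerivWithinAt f f' s t)
    (hg : HasDerivWithinAt g g' s t) :
    HasDerivWithinAt (fun x => B (f x) (g x)) (B f' (g t) + B (f t) g') s t :=
  (((bilinToCLM B).hasFDerivAt.comp_hasDerivWithinAt t hf).clm_apply hg :)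

end FiniteDim

namespace Quadcopter

/-! ### The error system -/

/-- Errors of `R, Ω, x, ẋ, f, ḟ` together with the integral states `σ, ρ`. -/
abbrev Err := Mat × Vec × Vec × Vec × ℝ × ℝ × Vec × ℝ

/-- Reference state and reference controls at a fixed time. -/
structure Ref where
  P : QuadState
  u : Vec
  q : ℝ

/-- Gains of a general law. The integral states evolve as `σ̇ = α Δx - β σ`,
`ρ̇ = α z_{k3} - β ρ`. -/
structure Gains where
  ke : ℝ
  K₀ : Mat
  K₁ : Mat
  K₂ : Mat
  K₃ : Mat
  KI : Mat
  a₀ : ℝ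
  a₁ : ℝ
  aI : ℝ
  α : ℝ
  β : ℝ

/-- The state with error `e` relative to `P`. -/
def shift (P : QuadState) (e : Err) : QuadState :=
  ⟨P.R + e.1, P.Ω + e.2.1, P.x + e.2.2.1, P.v + e.2.2.2.1, P.f + e.2.2.2.2.1,
    P.fdot + e.2.2.2.2.2.1⟩

/-- The input `v` of the general law. -/
def vIn (G : Gains) (a : Ref) (e : Err) : Vec :=
  vLaw G.K₀ G.K₁ G.K₂ G.K₃ G.ke a.P (shift a.P e) - G.KI *ᵥ e.2.2.2.2.2.2.1

/-- The input `w` of the general law. -/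
def wIn (G : Gains) (a : Ref) (e : Err) : ℝ :=
  wLaw G.a₀ G.a₁ a.P (shift a.P e) - G.aI * e.2.2.2.2.2.2.2

/-- `(ũ₂, ũ₁, Δq)` for the general law. -/
def auxIn (G : Gains) (a : Ref) (e : Err) : Vec :=
  auxInput G.ke a.P a.u a.q (shift a.P e) (vIn G a e)

/-- `ũ` for the general law. -/
def uTildeIn (G : Gains) (a : Ref) (e : Err) : Vec :=
  uTilde G.ke a.P a.u a.q (shift a.P e) (vIn G a e) (wIn G a e)

/-- The linear part of the error vector field. -/
def linField (G : Gains) (a : Ref) (e : Err) : Err :=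
  (e.1 * hat a.P.Ω + a.P.R * hat e.2.1,
    -crossProduct (dzk a.P (shift a.P e)) a.P.Ω - crossProduct (zk a.P (shift a.P e)) a.u
      + uTildeIn G a e,
    e.2.2.2.1,
    e.2.2.2.2.1 • (a.P.R *ᵥ e3) + a.P.f • (e.1 *ᵥ e3),
    e.2.2.2.2.2.1,
    auxIn G a e 2,
    G.α • e.2.2.1 - G.β • e.2.2.2.2.2.2.1,
    G.α * zk a.P (shift a.P e) 2 - G.β * e.2.2.2.2.2.2.2)

/-- The quadratic part of the error vector field. -/
def quadField (e : Err) : Err :=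
  (e.1 * hat e.2.1, 0, 0, e.2.2.2.2.1 • (e.1 *ᵥ e3), 0, 0, 0, 0)

/-- The vector field of the errors in closed loop. -/
def field (G : Gains) (a : Ref) (e : Err) : Err := linField G a e + quadField e

/-! ### Linear maps in the definitions -/

def hatL : Vec →ₗ[ℝ] Mat where
  toFun := hat
  map_add' a b := by ext i j; fin_cases i <;> fin_cases j <;> simp [hat] <;> ring
  map_smul' c a := by ext i j; fin_cases i <;> fin_cases j <;> simp [hat]

def veeL : Mat →ₗ[ℝ] Vec where
  toFun := vee
  map_add' a b := by ext i; fin_cases i <;> simp [vee]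
  map_smul' c a := by ext i; fin_cases i <;> simp [vee]

def symPartL : Mat →ₗ[ℝ] Mat where
  toFun := symPart
  map_add' a b := by simp only [symPart, Matrix.transpose_add]; module
  map_smul' c a := by simp only [symPart, Matrix.transpose_smul, RingHom.id_apply]; module

def skewPartL : Mat →ₗ[ℝ] Mat where
  toFun := skewPart
  map_add' a b := by simp only [skewPart, Matrix.transpose_add]; module
  map_smul' c a := by simp only [skewPart, Matrix.transpose_smul, RingHom.id_apply]; module

def transposeL : Mat →ₗ[ℝ] Mat := (Matrix.transposeLinearEquiv (Fin 3) (Fin 3) ℝ ℝ).toLinearMap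

def mulVecL : Mat →ₗ[ℝ] Vec →ₗ[ℝ] Vec := Matrix.mulVecBilin ℝ ℝ

theorem hat_sub (a b : Vec) : hat (a - b) = hat a - hat b := map_sub hatL a b
theorem hat_add (a b : Vec) : hat (a + b) = hat a + hat b := map_add hatL a b
theorem vee_sub (a b : Mat) : vee (a - b) = vee a - vee b := map_sub veeL a b
theorem vee_add (a b : Mat) : vee (a + b) = vee a + vee b := map_add veeL a b
theorem symPart_sub (a b : Mat) : symPart (a - b) = symPart a - symPart b := map_sub symPartL a b
theorem symPart_add (a b : Mat) : symPart (a + b) = symPart a + symPart b := map_add symPartL a b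
theorem skewPart_sub (a b : Mat) : skewPart (a - b) = skewPart a - skewPart b :=
  map_sub skewPartL a b
theorem skewPart_add (a b : Mat) : skewPart (a + b) = skewPart a + skewPart b :=
  map_add skewPartL a b

/-! ### The vector field is the linear one plus the quadratic one -/

section Linearity

variable (G : Gains) (a : Ref) (P : QuadState) (ke : ℝ) (e e' : Err)

theorem Z_shift : Z P (shift P e) = P.Rᵀ * e.1 := by simp [Z, shift]

theorem dzk_shift : dzk P (shift P e) = crossProduct (zk P (shift P e)) P.Ω + e.2.1 := by
  simp [dzk, shift]

theorem ddΔx_shift : ddΔx P (shift P e) =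
    (e.2.2.2.2.1 • P.R + A₀ P * Zk P (shift P e) + A₀ P * Zs P (shift P e)) *ᵥ e3 := by
  simp [ddΔx, shift]

theorem dddΔx_shift : dddΔx ke P (shift P e) =
    (e.2.2.2.2.2.1 • P.R + A₀ P * dZk P (shift P e) + e.2.2.2.2.1 • dR₀ P
      + dA₀ P * (Zs P (shift P e) + Zk P (shift P e)) + A₀ P * dZs ke P (shift P e)) *ᵥ e3 := by
  simp [dddΔx, shift]

theorem Cmat_shift (u₀ : Vec) (q₀ : ℝ) : Cmat ke P u₀ q₀ (shift P e) =
    (2 * e.2.2.2.2.2.1) • dR₀ P + (2 : ℝ) • (dA₀ P * (dZs ke P (shift P e) + dZk P (shift P e)))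
    + e.2.2.2.2.1 • ddR₀ P u₀ + ddA₀ P u₀ q₀ * (Zs P (shift P e) + Zk P (shift P e))
    + A₀ P * (⁅dZs ke P (shift P e), hat P.Ω⁆ + ⁅Zs P (shift P e), hat u₀⁆
      - (2 * ke) • dZs ke P (shift P e)) := by
  simp [Cmat, shift]

theorem vIn_shift : vIn G a e =
    -(G.K₃ *ᵥ dddΔx G.ke a.P (shift a.P e)) - G.K₂ *ᵥ ddΔx a.P (shift a.P e) - G.K₁ *ᵥ e.2.2.2.1
      - G.K₀ *ᵥ e.2.2.1 - G.KI *ᵥ e.2.2.2.2.2.2.1 := by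
  simp [vIn, vLaw, shift]

theorem Z_sub : Z P (shift P (e - e')) = Z P (shift P e) - Z P (shift P e') := by
  simp [Z_shift, mul_sub]

theorem Zs_sub : Zs P (shift P (e - e')) = Zs P (shift P e) - Zs P (shift P e') := by
  simp only [Zs, Z_sub, symPart_sub]

theorem Zk_sub : Zk P (shift P (e - e')) = Zk P (shift P e) - Zk P (shift P e') := by
  simp only [Zk, Z_sub, skewPart_sub]

theorem zk_sub : zk P (shift P (e - e')) = zk P (shift P e) - zk P (shift P e') := by
  simp only [zk, Zk_sub, vee_sub]

theorem dzk_sub : dzk P (shift P (e - e')) = dzk P (shift P e) - dzk P (shift P e') := by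
  simp only [dzk_shift, zk_sub, map_sub, LinearMap.sub_apply, Prod.fst_sub, Prod.snd_sub]
  abel

theorem dZk_sub : dZk P (shift P (e - e')) = dZk P (shift P e) - dZk P (shift P e') := by
  simp only [dZk, dzk_sub, hat_sub]

theorem dZs_sub : dZs ke P (shift P (e - e')) = dZs ke P (shift P e) - dZs ke P (shift P e') := by
  simp only [dZs, Zs_sub, Ring.lie_def, sub_mul, mul_sub]
  module

theorem ddΔx_sub : ddΔx P (shift P (e - e')) = ddΔx P (shift P e) - ddΔx P (shift P e') := by
  simp only [ddΔx_shift, Zk_sub, Zs_sub, ← Matrix.sub_mulVec, mul_sub, Prod.fst_sub, Prod.snd_sub]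
  congr 1
  module

theorem dddΔx_sub :
    dddΔx ke P (shift P (e - e')) = dddΔx ke P (shift P e) - dddΔx ke P (shift P e') := by
  simp only [dddΔx_shift, Zk_sub, Zs_sub, dZk_sub, dZs_sub, ← Matrix.sub_mulVec, mul_sub, mul_add,
    Prod.fst_sub, Prod.snd_sub]
  congr 1
  module

theorem Cmat_sub (u₀ : Vec) (q₀ : ℝ) : Cmat ke P u₀ q₀ (shift P (e - e')) =
    Cmat ke P u₀ q₀ (shift P e) - Cmat ke P u₀ q₀ (shift P e') := by
  simp only [Cmat_shift, Zk_sub, Zs_sub, dZk_sub, dZs_sub, Ring.lie_def, sub_mul, mul_sub, mul_add,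
    Prod.fst_sub, Prod.snd_sub, mul_smul_comm, smul_sub]
  module

theorem vIn_sub : vIn G a (e - e') = vIn G a e - vIn G a e' := by
  simp only [vIn_shift, ddΔx_sub, dddΔx_sub, Matrix.mulVec_sub, Prod.fst_sub, Prod.snd_sub]
  abel

theorem wIn_sub : wIn G a (e - e') = wIn G a e - wIn G a e' := by
  simp only [wIn, wLaw, zk_sub, dzk_sub, Prod.snd_sub, Pi.sub_apply]
  ring

theorem auxIn_sub : auxIn G a (e - e') = auxIn G a e - auxIn G a e' := by
  simp only [auxIn, auxInput, vIn_sub, Cmat_sub, ← Matrix.mulVec_sub, Matrix.sub_mulVec]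
  congr 2
  abel

theorem uTildeIn_apply : uTildeIn G a e = ![auxIn G a e 1, auxIn G a e 0, wIn G a e] := rfl

theorem uTildeIn_sub : uTildeIn G a (e - e') = uTildeIn G a e - uTildeIn G a e' := by
  ext i
  fin_cases i <;> simp [uTildeIn_apply, auxIn_sub, wIn_sub]

/-- For a fixed reference, every signal entering the controller is linear in the error.
Compatibility with differences is enough: together with the norm bound on `linField` it gives the
Lipschitz estimate. -/
theorem linField_sub : linField G a (e - e') = linField G a e - linField G a e' := by
  simp only [linField, zk_sub, dzk_sub, uTildeIn_sub, auxIn_sub, hat_sub, map_sub,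
    LinearMap.sub_apply, Prod.fst_sub, Prod.snd_sub, Matrix.sub_mulVec, sub_mul, mul_sub,
    Pi.sub_apply, Prod.mk_sub_mk]
  refine Prod.ext ?_ (Prod.ext ?_ (Prod.ext ?_ (Prod.ext ?_ (Prod.ext ?_ (Prod.ext ?_
    (Prod.ext ?_ ?_)))))) <;> dsimp only <;> module

end Linearity

end Quadcopter

namespace Quadcopter

open Asymptotics Filter Topology

/-! ### Linear bounds, uniform over admissible references -/

section BigO

variable {α : Type*} {l : Filter α} {g g' : α → ℝ}

theorem isBigO_hat {f : α → Vec} (hf : f =O[l] g) : (fun x => hat (f x)) =O[l] g :=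
  LinearMap.isBigO_comp_of_finiteDimensional hatL hf

theorem isBigO_vee {f : α → Mat} (hf : f =O[l] g) : (fun x => vee (f x)) =O[l] g :=
  LinearMap.isBigO_comp_of_finiteDimensional veeL hf

theorem isBigO_symPart {f : α → Mat} (hf : f =O[l] g) : (fun x => symPart (f x)) =O[l] g :=
  LinearMap.isBigO_comp_of_finiteDimensional symPartL hf

theorem isBigO_skewPart {f : α → Mat} (hf : f =O[l] g) : (fun x => skewPart (f x)) =O[l] g :=
  LinearMap.isBigO_comp_of_finiteDimensional skewPartL hf

theorem isBigO_transpose {f : α → Mat} (hf : f =O[l] g) : (fun x => (f x)ᵀ) =O[l] g :=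
  LinearMap.isBigO_comp_of_finiteDimensional transposeL hf

theorem isBigO_apply {f : α → Vec} (hf : f =O[l] g) (i : Fin 3) : (fun x => f x i) =O[l] g :=
  isBigO_pi.1 hf i

theorem isBigO_vec3 {f₀ f₁ f₂ : α → ℝ} (h₀ : f₀ =O[l] g) (h₁ : f₁ =O[l] g) (h₂ : f₂ =O[l] g) :
    (fun x => (![f₀ x, f₁ x, f₂ x] : Vec)) =O[l] g :=
  isBigO_pi.2 fun i => by fin_cases i <;> assumption

theorem isBigO_mulVec₂ {f : α → Mat} {f' : α → Vec} (hf : f =O[l] g) (hf' : f' =O[l] g') :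
    (fun x => f x *ᵥ f' x) =O[l] fun x => g x * g' x :=
  LinearMap.isBigO_comp₂_of_finiteDimensional mulVecL hf hf'

theorem isBigO_cross₂ {f : α → Vec} {f' : α → Vec} (hf : f =O[l] g) (hf' : f' =O[l] g') :
    (fun x => crossProduct (f x) (f' x)) =O[l] fun x => g x * g' x :=
  LinearMap.isBigO_comp₂_of_finiteDimensional crossProduct hf hf'

theorem isBigO_const_one {E : Type*} [NormedAddCommGroup E] (c : E) :
    (fun _ : α => c) =O[l] fun _ => (1 : ℝ) :=
  isBigO_const_const c one_ne_zero l

theorem isBigO_mulVec {f : α → Mat} {f' : α → Vec} (hf : f =O[l] fun _ => (1 : ℝ))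
    (hf' : f' =O[l] g) : (fun x => f x *ᵥ f' x) =O[l] g := by
  simpa using isBigO_mulVec₂ hf hf'

theorem isBigO_mulVec_const {f : α → Mat} (v : Vec) (hf : f =O[l] g) :
    (fun x => f x *ᵥ v) =O[l] g := by
  simpa using isBigO_mulVec₂ hf (isBigO_const_one v)

theorem isBigO_cross {f : α → Vec} {f' : α → Vec} (hf : f =O[l] g)
    (hf' : f' =O[l] fun _ => (1 : ℝ)) : (fun x => crossProduct (f x) (f' x)) =O[l] g := by
  simpa using isBigO_cross₂ hf hf'

theorem isBigO_mul {f f' : α → Mat} (hf : f =O[l] fun _ => (1 : ℝ)) (hf' : f' =O[l] g) :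
    (fun x => f x * f' x) =O[l] g := by
  simpa using hf.mul hf'

theorem isBigO_mul' {f f' : α → Mat} (hf : f =O[l] g) (hf' : f' =O[l] fun _ => (1 : ℝ)) :
    (fun x => f x * f' x) =O[l] g := by
  simpa using hf.mul hf'

theorem isBigO_lie {f f' : α → Mat} (hf : f =O[l] g) (hf' : f' =O[l] fun _ => (1 : ℝ)) :
    (fun x => ⁅f x, f' x⁆) =O[l] g := by
  simpa only [Ring.lie_def] using (isBigO_mul' hf hf').sub (isBigO_mul hf' hf)

theorem isBigO_smul {E : Type*} [NormedAddCommGroup E] [NormedSpace ℝ E] {f : α → ℝ} {f' : α → E}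
    (hf : f =O[l] fun _ => (1 : ℝ)) (hf' : f' =O[l] g) : (fun x => f x • f' x) =O[l] g := by
  simpa using hf.smul hf'

theorem isBigO_smul' {E : Type*} [NormedAddCommGroup E] [NormedSpace ℝ E] {f : α → ℝ} {f' : α → E}
    (hf : f =O[l] g) (hf' : f' =O[l] fun _ => (1 : ℝ)) : (fun x => f x • f' x) =O[l] g := by
  simpa using hf.smul hf'

end BigO

/-- The bounds on the reference. -/
structure IsAdmissible (M δ : ℝ) (a : Ref) : Prop where
  mem_SO3 : a.P.R ∈ SO3
  Ω_le : ‖a.P.Ω‖ ≤ M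
  u_le : ‖a.u‖ ≤ M
  f_le : |a.P.f| ≤ M
  fdot_le : |a.P.fdot| ≤ M
  q_le : |a.q| ≤ M
  le_f : δ ≤ a.P.f

theorem transpose_mul_self_of_mem_SO3 {R : Mat} (h : R ∈ SO3) : Rᵀ * R = 1 := by
  have := (Matrix.mem_specialOrthogonalGroup_iff.1 h).1
  exact (Matrix.mem_orthogonalGroup_iff' (Fin 3) ℝ).1 this

theorem mul_transpose_self_of_mem_SO3 {R : Mat} (h : R ∈ SO3) : R * Rᵀ = 1 :=
  mul_eq_one_comm.1 (transpose_mul_self_of_mem_SO3 h)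

/-- The squared Frobenius norm is tr(RᵀR) = 3; the crude bound 3 in place of √3 suffices. -/
theorem norm_le_of_mem_SO3 {R : Mat} (h : R ∈ SO3) : ‖R‖ ≤ 3 := by
  have htr : (Rᵀ * R).trace = 3 := by
    rw [transpose_mul_self_of_mem_SO3 h, Matrix.trace_one]; simp
  have hsum : ∑ i, ∑ j, ‖R i j‖ ^ (2 : ℝ) = 3 := by
    rw [← htr, Matrix.trace, Finset.sum_comm]
    simp [Matrix.mul_apply, pow_two]
  rw [Matrix.frobenius_norm_def, hsum]
  calc (3 : ℝ) ^ (1 / 2 : ℝ) ≤ 3 ^ (1 : ℝ) := by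
        apply Real.rpow_le_rpow_of_exponent_le <;> norm_num
    _ = 3 := by norm_num

section LinearBounds

variable (M δ : ℝ)

/-- Pairs of an admissible reference and an error. -/
def admFilter : Filter (Ref × Err) := 𝓟 {z | IsAdmissible M δ z.1}

/-- The size of the error. -/
abbrev errNorm (z : Ref × Err) : ℝ := ‖z.2‖

variable {M δ}

/-- Along a principal filter `=O` involves no limit: it asserts one constant valid on the whole set.
The calculus of `IsBigO` therefore serves as bookkeeping for bounds uniform over all admissible
references and all errors. -/
theorem isBigO_one_of_bound {E : Type*} [NormedAddCommGroup E] {f : Ref → E} (C : ℝ)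
    (h : ∀ a, IsAdmissible M δ a → ‖f a‖ ≤ C) : (fun z : Ref × Err => f z.1) =O[admFilter M δ] (fun _ => (1 : ℝ)) :=
  isBigO_principal.2 ⟨C, fun z hz => by simpa using h z.1 hz⟩

theorem isBigO_R : (fun z : Ref × Err => z.1.P.R) =O[admFilter M δ] (fun _ => (1 : ℝ)) :=
  isBigO_one_of_bound (f := fun a => a.P.R) 3 fun _ h => norm_le_of_mem_SO3 h.mem_SO3

theorem isBigO_Ω : (fun z : Ref × Err => z.1.P.Ω) =O[admFilter M δ] (fun _ => (1 : ℝ)) :=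
  isBigO_one_of_bound (f := fun a => a.P.Ω) M fun _ h => h.Ω_le

theorem isBigO_u : (fun z : Ref × Err => z.1.u) =O[admFilter M δ] (fun _ => (1 : ℝ)) := isBigO_one_of_bound (f := fun a => a.u) M fun _ h => h.u_le

theorem isBigO_f : (fun z : Ref × Err => z.1.P.f) =O[admFilter M δ] (fun _ => (1 : ℝ)) :=
  isBigO_one_of_bound (f := fun a => a.P.f) M fun _ h => h.f_le

theorem isBigO_fdot : (fun z : Ref × Err => z.1.P.fdot) =O[admFilter M δ] (fun _ => (1 : ℝ)) :=
  isBigO_one_of_bound (f := fun a => a.P.fdot) M fun _ h => h.fdot_le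

theorem isBigO_q : (fun z : Ref × Err => z.1.q) =O[admFilter M δ] (fun _ => (1 : ℝ)) := isBigO_one_of_bound (f := fun a => a.q) M fun _ h => h.q_le

theorem isBigO_f_inv (hδ : 0 < δ) : (fun z : Ref × Err => (z.1.P.f)⁻¹) =O[admFilter M δ] (fun _ => (1 : ℝ)) :=
  isBigO_one_of_bound (f := fun a => (a.P.f)⁻¹) δ⁻¹ fun _ h => by
    rw [norm_inv, Real.norm_of_nonneg (hδ.le.trans h.le_f)]
    exact inv_anti₀ hδ h.le_f

theorem isBigO_dR₀ : (fun z : Ref × Err => dR₀ z.1.P) =O[admFilter M δ] (fun _ => (1 : ℝ)) :=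
  isBigO_mul isBigO_R (isBigO_hat isBigO_Ω)

theorem isBigO_ddR₀ : (fun z : Ref × Err => ddR₀ z.1.P z.1.u) =O[admFilter M δ] (fun _ => (1 : ℝ)) :=
  (isBigO_mul isBigO_dR₀ (isBigO_hat isBigO_Ω)).add (isBigO_mul isBigO_R (isBigO_hat isBigO_u))

theorem isBigO_A₀ : (fun z : Ref × Err => A₀ z.1.P) =O[admFilter M δ] (fun _ => (1 : ℝ)) := isBigO_smul isBigO_f isBigO_R

theorem isBigO_dA₀ : (fun z : Ref × Err => dA₀ z.1.P) =O[admFilter M δ] (fun _ => (1 : ℝ)) :=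
  (isBigO_smul isBigO_fdot isBigO_R).add (isBigO_smul isBigO_f isBigO_dR₀)

theorem isBigO_ddA₀ : (fun z : Ref × Err => ddA₀ z.1.P z.1.u z.1.q) =O[admFilter M δ] (fun _ => (1 : ℝ)) :=
  ((isBigO_smul isBigO_q isBigO_R).add
    (isBigO_smul (isBigO_fdot.const_mul_left 2) isBigO_dR₀)).add (isBigO_smul isBigO_f isBigO_ddR₀)

theorem isBigO_err {l : Filter (Ref × Err)} : (fun z : Ref × Err => z.2) =O[l] errNorm :=
  isBigO_of_le _ fun z => by simp [errNorm]

theorem isBigO_err₁ {l : Filter (Ref × Err)} : (fun z : Ref × Err => z.2.1) =O[l] errNorm :=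
  isBigO_err.prod_left_fst

theorem isBigO_err₂ {l : Filter (Ref × Err)} : (fun z : Ref × Err => z.2.2.1) =O[l] errNorm :=
  isBigO_err.prod_left_snd.prod_left_fst

theorem isBigO_err₃ {l : Filter (Ref × Err)} : (fun z : Ref × Err => z.2.2.2.1) =O[l] errNorm :=
  isBigO_err.prod_left_snd.prod_left_snd.prod_left_fst

theorem isBigO_err₄ {l : Filter (Ref × Err)} : (fun z : Ref × Err => z.2.2.2.2.1) =O[l] errNorm :=
  isBigO_err.prod_left_snd.prod_left_snd.prod_left_snd.prod_left_fst

theorem isBigO_err₅ {l : Filter (Ref × Err)} : (fun z : Ref × Err => z.2.2.2.2.2.1) =O[l] errNorm :=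
  isBigO_err.prod_left_snd.prod_left_snd.prod_left_snd.prod_left_snd.prod_left_fst

theorem isBigO_err₆ {l : Filter (Ref × Err)} : (fun z : Ref × Err => z.2.2.2.2.2.2.1) =O[l] errNorm :=
  isBigO_err.prod_left_snd.prod_left_snd.prod_left_snd.prod_left_snd.prod_left_snd.prod_left_fst

theorem isBigO_err₇ {l : Filter (Ref × Err)} : (fun z : Ref × Err => z.2.2.2.2.2.2.2.1) =O[l] errNorm :=
  isBigO_err.prod_left_snd.prod_left_snd.prod_left_snd.prod_left_snd.prod_left_snd.prod_left_snd
    |>.prod_left_fst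

theorem isBigO_err₈ {l : Filter (Ref × Err)} : (fun z : Ref × Err => z.2.2.2.2.2.2.2.2) =O[l] errNorm :=
  isBigO_err.prod_left_snd.prod_left_snd.prod_left_snd.prod_left_snd.prod_left_snd.prod_left_snd
    |>.prod_left_snd

theorem isBigO_Z : (fun z : Ref × Err => Z z.1.P (shift z.1.P z.2)) =O[admFilter M δ] errNorm := by
  simp only [Z_shift]
  exact isBigO_mul (isBigO_transpose isBigO_R) isBigO_err₁

theorem isBigO_Zs : (fun z : Ref × Err => Zs z.1.P (shift z.1.P z.2)) =O[admFilter M δ] errNorm :=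
  isBigO_symPart isBigO_Z

theorem isBigO_Zk : (fun z : Ref × Err => Zk z.1.P (shift z.1.P z.2)) =O[admFilter M δ] errNorm :=
  isBigO_skewPart isBigO_Z

theorem isBigO_zk : (fun z : Ref × Err => zk z.1.P (shift z.1.P z.2)) =O[admFilter M δ] errNorm :=
  isBigO_vee isBigO_Zk

theorem isBigO_dzk : (fun z : Ref × Err => dzk z.1.P (shift z.1.P z.2)) =O[admFilter M δ] errNorm := by
  simp only [dzk_shift]
  exact (isBigO_cross isBigO_zk isBigO_Ω).add isBigO_err₂

theorem isBigO_dZk : (fun z : Ref × Err => dZk z.1.P (shift z.1.P z.2)) =O[admFilter M δ] errNorm :=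
  isBigO_hat isBigO_dzk

theorem isBigO_dZs (ke : ℝ) : (fun z : Ref × Err => dZs ke z.1.P (shift z.1.P z.2)) =O[admFilter M δ] errNorm :=
  (isBigO_lie isBigO_Zs (isBigO_hat isBigO_Ω)).sub (isBigO_smul (isBigO_const_one _) isBigO_Zs)

theorem isBigO_ddΔx : (fun z : Ref × Err => ddΔx z.1.P (shift z.1.P z.2)) =O[admFilter M δ] errNorm := by
  simp only [ddΔx_shift]
  exact isBigO_mulVec_const _ (((isBigO_smul' isBigO_err₅ isBigO_R).add
    (isBigO_mul isBigO_A₀ isBigO_Zk)).add (isBigO_mul isBigO_A₀ isBigO_Zs))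

theorem isBigO_dddΔx (ke : ℝ) :
    (fun z : Ref × Err => dddΔx ke z.1.P (shift z.1.P z.2)) =O[admFilter M δ] errNorm := by
  simp only [dddΔx_shift]
  exact isBigO_mulVec_const _ (((((isBigO_smul' isBigO_err₆ isBigO_R).add
    (isBigO_mul isBigO_A₀ isBigO_dZk)).add (isBigO_smul' isBigO_err₅ isBigO_dR₀)).add
    (isBigO_mul isBigO_dA₀ (isBigO_Zs.add isBigO_Zk))).add (isBigO_mul isBigO_A₀ (isBigO_dZs ke)))

theorem isBigO_Cmat (ke : ℝ) :
    (fun z : Ref × Err => Cmat ke z.1.P z.1.u z.1.q (shift z.1.P z.2)) =O[admFilter M δ] errNorm := by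
  simp only [Cmat_shift]
  exact ((((isBigO_smul' (isBigO_err₆.const_mul_left 2) isBigO_dR₀).add
    (isBigO_smul (isBigO_const_one _)
      (isBigO_mul isBigO_dA₀ ((isBigO_dZs ke).add isBigO_dZk)))).add
    (isBigO_smul' isBigO_err₅ isBigO_ddR₀)).add
    (isBigO_mul isBigO_ddA₀ (isBigO_Zs.add isBigO_Zk))).add
    (isBigO_mul isBigO_A₀ (((isBigO_lie (isBigO_dZs ke) (isBigO_hat isBigO_Ω)).add
      (isBigO_lie isBigO_Zs (isBigO_hat isBigO_u))).sub (isBigO_smul (isBigO_const_one _) (isBigO_dZs ke))))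

theorem isBigO_vIn (G : Gains) : (fun z : Ref × Err => vIn G z.1 z.2) =O[admFilter M δ] errNorm := by
  simp only [vIn_shift]
  exact (((((isBigO_mulVec (isBigO_const_one _) (isBigO_dddΔx _)).neg_left).sub
    (isBigO_mulVec (isBigO_const_one _) isBigO_ddΔx)).sub
    (isBigO_mulVec (isBigO_const_one _) isBigO_err₄)).sub
    (isBigO_mulVec (isBigO_const_one _) isBigO_err₃)).sub
    (isBigO_mulVec (isBigO_const_one _) isBigO_err₇)

theorem isBigO_wIn (G : Gains) : (fun z : Ref × Err => wIn G z.1 z.2) =O[admFilter M δ] errNorm := by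
  simp only [wIn, wLaw]
  exact ((((isBigO_apply isBigO_dzk 2).const_mul_left _).neg_left).sub
    ((isBigO_apply isBigO_zk 2).const_mul_left _)).sub (isBigO_err₈.const_mul_left _)

theorem inv_B₀_mulVec {P : QuadState} (hf : P.f ≠ 0) (y : Vec) :
    (B₀ P)⁻¹ *ᵥ y = ![P.f⁻¹ * y 0, -(P.f⁻¹ * y 1), y 2] := by
  have hdet : IsUnit (B₀ P).det := by
    simp [B₀, Matrix.det_diagonal, Fin.prod_univ_three, hf]
  have hy : B₀ P *ᵥ ![P.f⁻¹ * y 0, -(P.f⁻¹ * y 1), y 2] = y := by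
    ext i
    fin_cases i <;> simp [B₀, Matrix.mulVec_diagonal, hf]
  conv_lhs => rw [← hy]
  rw [Matrix.mulVec_mulVec, Matrix.nonsing_inv_mul _ hdet, Matrix.one_mulVec]

theorem isBigO_auxIn (G : Gains) (hδ : 0 < δ) :
    (fun z : Ref × Err => auxIn G z.1 z.2) =O[admFilter M δ] errNorm := by
  have h : (fun z : Ref × Err => z.1.P.Rᵀ *ᵥ (vIn G z.1 z.2
      - Cmat G.ke z.1.P z.1.u z.1.q (shift z.1.P z.2) *ᵥ e3)) =O[admFilter M δ] errNorm :=
    isBigO_mulVec (isBigO_transpose isBigO_R)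
      ((isBigO_vIn G).sub (isBigO_mulVec_const _ (isBigO_Cmat _)))
  refine IsBigO.congr' (isBigO_vec3 (isBigO_smul (isBigO_f_inv hδ) (isBigO_apply h 0))
    (isBigO_smul (isBigO_f_inv hδ) (isBigO_apply h 1)).neg_left (isBigO_apply h 2)) ?_
    EventuallyEq.rfl
  refine eventually_principal.2 fun z hz => ?_
  have hf : z.1.P.f ≠ 0 := (hδ.trans_le hz.le_f).ne'
  simp only [auxIn, auxInput, inv_B₀_mulVec hf, smul_eq_mul]

theorem isBigO_uTildeIn (G : Gains) (hδ : 0 < δ) :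
    (fun z : Ref × Err => uTildeIn G z.1 z.2) =O[admFilter M δ] errNorm := by
  simp only [uTildeIn_apply]
  exact isBigO_vec3 (isBigO_apply (isBigO_auxIn G hδ) 1) (isBigO_apply (isBigO_auxIn G hδ) 0)
    (isBigO_wIn G)

/-- The lower bound δ on the thrust enters through B₀⁻¹ alone; the other reference coefficients are
bounded through `M` or orthogonality of R₀. -/
theorem isBigO_linField (G : Gains) (hδ : 0 < δ) :
    (fun z : Ref × Err => linField G z.1 z.2) =O[admFilter M δ] errNorm := by
  unfold linField
  refine IsBigO.prod_left ?_ <| IsBigO.prod_left ?_ <| IsBigO.prod_left ?_ <| IsBigO.prod_left ?_ <|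
    IsBigO.prod_left ?_ <| IsBigO.prod_left ?_ <| IsBigO.prod_left ?_ ?_
  · exact (isBigO_mul' isBigO_err₁ (isBigO_hat isBigO_Ω)).add
      (isBigO_mul isBigO_R (isBigO_hat isBigO_err₂))
  · exact ((isBigO_cross isBigO_dzk isBigO_Ω).neg_left.sub (isBigO_cross isBigO_zk isBigO_u)).add
      (isBigO_uTildeIn G hδ)
  · exact isBigO_err₄
  · exact (isBigO_smul' isBigO_err₅ (isBigO_mulVec_const _ isBigO_R)).add
      (isBigO_smul isBigO_f (isBigO_mulVec_const _ isBigO_err₁))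
  · exact isBigO_err₆
  · exact isBigO_apply (isBigO_auxIn G hδ) 2
  · exact (isBigO_smul (isBigO_const_one _) isBigO_err₃).sub
      (isBigO_smul (isBigO_const_one _) isBigO_err₇)
  · exact ((isBigO_apply isBigO_zk 2).const_mul_left _).sub (isBigO_err₈.const_mul_left _)

theorem exists_norm_linField_le (G : Gains) (hδ : 0 < δ) :
    ∃ C, ∀ a, IsAdmissible M δ a → ∀ e, ‖linField G a e‖ ≤ C * ‖e‖ := by
  obtain ⟨C, hC⟩ := isBigO_principal.1 (isBigO_linField (M := M) G hδ)
  exact ⟨C, fun a ha e => by simpa using hC (a, e) ha⟩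

end LinearBounds

end Quadcopter

namespace Quadcopter

open Set Filter Topology
open scoped NNReal

/-! ### Continuity in time -/

section Continuity

variable {s : Set ℝ}

theorem continuousOn_hat {f : ℝ → Vec} (hf : ContinuousOn f s) :
    ContinuousOn (fun t => hat (f t)) s :=
  (LinearMap.toContinuousLinearMap hatL).continuous.comp_continuousOn hf

theorem continuousOn_vee {f : ℝ → Mat} (hf : ContinuousOn f s) :
    ContinuousOn (fun t => vee (f t)) s :=
  (LinearMap.toContinuousLinearMap veeL).continuous.comp_continuousOn hf

theorem continuousOn_symPart {f : ℝ → Mat} (hf : ContinuousOn f s) :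
    ContinuousOn (fun t => symPart (f t)) s :=
  (LinearMap.toContinuousLinearMap symPartL).continuous.comp_continuousOn hf

theorem continuousOn_skewPart {f : ℝ → Mat} (hf : ContinuousOn f s) :
    ContinuousOn (fun t => skewPart (f t)) s :=
  (LinearMap.toContinuousLinearMap skewPartL).continuous.comp_continuousOn hf

theorem continuousOn_transpose {f : ℝ → Mat} (hf : ContinuousOn f s) :
    ContinuousOn (fun t => (f t)ᵀ) s :=
  (LinearMap.toContinuousLinearMap transposeL).continuous.comp_continuousOn hf

theorem continuousOn_mulVec {f : ℝ → Mat} {f' : ℝ → Vec} (hf : ContinuousOn f s)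
    (hf' : ContinuousOn f' s) : ContinuousOn (fun t => f t *ᵥ f' t) s :=
  ((bilinToCLM mulVecL).continuous.comp_continuousOn hf).clm_apply hf'

theorem continuousOn_cross {f f' : ℝ → Vec} (hf : ContinuousOn f s) (hf' : ContinuousOn f' s) :
    ContinuousOn (fun t => crossProduct (f t) (f' t)) s :=
  ((bilinToCLM crossProduct).continuous.comp_continuousOn hf).clm_apply hf'

theorem continuousOn_vec3 {f₀ f₁ f₂ : ℝ → ℝ} (h₀ : ContinuousOn f₀ s) (h₁ : ContinuousOn f₁ s)
    (h₂ : ContinuousOn f₂ s) : ContinuousOn (fun t => (![f₀ t, f₁ t, f₂ t] : Vec)) s :=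
  continuousOn_pi.2 fun i => by fin_cases i <;> assumption

theorem continuousOn_mul {f f' : ℝ → Mat} (hf : ContinuousOn f s) (hf' : ContinuousOn f' s) :
    ContinuousOn (fun t => f t * f' t) s :=
  hf.mul hf'

theorem continuousOn_lie {f f' : ℝ → Mat} (hf : ContinuousOn f s) (hf' : ContinuousOn f' s) :
    ContinuousOn (fun t => ⁅f t, f' t⁆) s := by
  simp only [Ring.lie_def]
  exact (continuousOn_mul hf hf').sub (continuousOn_mul hf' hf)

theorem continuousOn_smul {f : ℝ → ℝ} {f' : ℝ → Mat} (hf : ContinuousOn f s)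
    (hf' : ContinuousOn f' s) : ContinuousOn (fun t => f t • f' t) s :=
  hf.smul hf'

variable {a : ℝ → Ref}

/-- Continuity of the bounded reference signals. -/
structure RefContinuousOn (a : ℝ → Ref) (s : Set ℝ) : Prop where
  R : ContinuousOn (fun t => (a t).P.R) s
  Ω : ContinuousOn (fun t => (a t).P.Ω) s
  u : ContinuousOn (fun t => (a t).u) s
  f : ContinuousOn (fun t => (a t).P.f) s
  fdot : ContinuousOn (fun t => (a t).P.fdot) s
  q : ContinuousOn (fun t => (a t).q) s

theorem continuousOn_dR₀ (h : RefContinuousOn a s) : ContinuousOn (fun t => dR₀ (a t).P) s :=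
  continuousOn_mul h.R (continuousOn_hat h.Ω)

theorem continuousOn_ddR₀ (h : RefContinuousOn a s) :
    ContinuousOn (fun t => ddR₀ (a t).P (a t).u) s :=
  (continuousOn_mul (continuousOn_dR₀ h) (continuousOn_hat h.Ω)).add
    (continuousOn_mul h.R (continuousOn_hat h.u))

theorem continuousOn_A₀ (h : RefContinuousOn a s) : ContinuousOn (fun t => A₀ (a t).P) s :=
  continuousOn_smul h.f h.R

theorem continuousOn_dA₀ (h : RefContinuousOn a s) : ContinuousOn (fun t => dA₀ (a t).P) s :=
  (continuousOn_smul h.fdot h.R).add (continuousOn_smul h.f (continuousOn_dR₀ h))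

theorem continuousOn_ddA₀ (h : RefContinuousOn a s) :
    ContinuousOn (fun t => ddA₀ (a t).P (a t).u (a t).q) s :=
  ((continuousOn_smul h.q h.R).add
    (continuousOn_smul (continuousOn_const.mul h.fdot) (continuousOn_dR₀ h))).add
    (continuousOn_smul h.f (continuousOn_ddR₀ h))

variable (e : Err)

theorem continuousOn_Zs (h : RefContinuousOn a s) :
    ContinuousOn (fun t => Zs (a t).P (shift (a t).P e)) s := by
  simp only [Zs, Z_shift]
  exact continuousOn_symPart (continuousOn_mul (continuousOn_transpose h.R) continuousOn_const)

theorem continuousOn_Zk (h : RefContinuousOn a s) :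
    ContinuousOn (fun t => Zk (a t).P (shift (a t).P e)) s := by
  simp only [Zk, Z_shift]
  exact continuousOn_skewPart (continuousOn_mul (continuousOn_transpose h.R) continuousOn_const)

theorem continuousOn_zk (h : RefContinuousOn a s) :
    ContinuousOn (fun t => zk (a t).P (shift (a t).P e)) s :=
  continuousOn_vee (continuousOn_Zk e h)

theorem continuousOn_dzk (h : RefContinuousOn a s) :
    ContinuousOn (fun t => dzk (a t).P (shift (a t).P e)) s := by
  simp only [dzk_shift]
  exact (continuousOn_cross (continuousOn_zk e h) h.Ω).add continuousOn_const

theorem continuousOn_dZk (h : RefContinuousOn a s) :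
    ContinuousOn (fun t => dZk (a t).P (shift (a t).P e)) s :=
  continuousOn_hat (continuousOn_dzk e h)

theorem continuousOn_dZs (ke : ℝ) (h : RefContinuousOn a s) :
    ContinuousOn (fun t => dZs ke (a t).P (shift (a t).P e)) s :=
  (continuousOn_lie (continuousOn_Zs e h) (continuousOn_hat h.Ω)).sub
    (continuousOn_smul continuousOn_const (continuousOn_Zs e h))

theorem continuousOn_ddΔx (h : RefContinuousOn a s) :
    ContinuousOn (fun t => ddΔx (a t).P (shift (a t).P e)) s := by
  simp only [ddΔx_shift]
  exact continuousOn_mulVec (((continuousOn_smul continuousOn_const h.R).add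
    (continuousOn_mul (continuousOn_A₀ h) (continuousOn_Zk e h))).add
    (continuousOn_mul (continuousOn_A₀ h) (continuousOn_Zs e h))) continuousOn_const

theorem continuousOn_dddΔx (ke : ℝ) (h : RefContinuousOn a s) :
    ContinuousOn (fun t => dddΔx ke (a t).P (shift (a t).P e)) s := by
  simp only [dddΔx_shift]
  exact continuousOn_mulVec (((((continuousOn_smul continuousOn_const h.R).add
    (continuousOn_mul (continuousOn_A₀ h) (continuousOn_dZk e h))).add
    (continuousOn_smul continuousOn_const (continuousOn_dR₀ h))).add
    (continuousOn_mul (continuousOn_dA₀ h) ((continuousOn_Zs e h).add (continuousOn_Zk e h)))).add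
    (continuousOn_mul (continuousOn_A₀ h) (continuousOn_dZs e ke h))) continuousOn_const

theorem continuousOn_Cmat (ke : ℝ) (h : RefContinuousOn a s) :
    ContinuousOn (fun t => Cmat ke (a t).P (a t).u (a t).q (shift (a t).P e)) s := by
  simp only [Cmat_shift]
  exact ((((continuousOn_smul continuousOn_const (continuousOn_dR₀ h)).add
    (continuousOn_smul continuousOn_const (continuousOn_mul (continuousOn_dA₀ h)
      ((continuousOn_dZs e ke h).add (continuousOn_dZk e h))))).add
    (continuousOn_smul continuousOn_const (continuousOn_ddR₀ h))).add
    (continuousOn_mul (continuousOn_ddA₀ h) ((continuousOn_Zs e h).add (continuousOn_Zk e h)))).add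
    (continuousOn_mul (continuousOn_A₀ h)
      (((continuousOn_lie (continuousOn_dZs e ke h) (continuousOn_hat h.Ω)).add
      (continuousOn_lie (continuousOn_Zs e h) (continuousOn_hat h.u))).sub
      (continuousOn_smul continuousOn_const (continuousOn_dZs e ke h))))

theorem continuousOn_vIn (G : Gains) (h : RefContinuousOn a s) :
    ContinuousOn (fun t => vIn G (a t) e) s := by
  simp only [vIn_shift]
  exact (((((continuousOn_mulVec continuousOn_const (continuousOn_dddΔx e _ h)).neg).sub
    (continuousOn_mulVec continuousOn_const (continuousOn_ddΔx e h))).sub continuousOn_const).sub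
    continuousOn_const).sub continuousOn_const

theorem continuousOn_wIn (G : Gains) (h : RefContinuousOn a s) :
    ContinuousOn (fun t => wIn G (a t) e) s := by
  simp only [wIn, wLaw]
  exact (((continuousOn_const.mul (continuousOn_pi.1 (continuousOn_dzk e h) 2)).neg).sub
    (continuousOn_const.mul (continuousOn_pi.1 (continuousOn_zk e h) 2))).sub continuousOn_const

theorem continuousOn_auxIn (G : Gains) (h : RefContinuousOn a s) (hf0 : ∀ t ∈ s, (a t).P.f ≠ 0) :
    ContinuousOn (fun t => auxIn G (a t) e) s := by
  have h1 : ContinuousOn (fun t => (a t).P.Rᵀ *ᵥ (vIn G (a t) e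
      - Cmat G.ke (a t).P (a t).u (a t).q (shift (a t).P e) *ᵥ e3)) s :=
    continuousOn_mulVec (continuousOn_transpose h.R)
      ((continuousOn_vIn e G h).sub
        (continuousOn_mulVec (continuousOn_Cmat e _ h) continuousOn_const))
  have hi := continuousOn_pi.1 h1
  have hfi := h.f.inv₀ hf0
  refine (continuousOn_vec3 (hfi.mul (hi 0)) (hfi.mul (hi 1)).neg (hi 2)).congr fun t ht => ?_
  simp only [auxIn, auxInput, inv_B₀_mulVec (hf0 t ht), Pi.mul_apply, Pi.neg_apply,
    Pi.inv_apply]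

theorem continuousOn_field (G : Gains) (h : RefContinuousOn a s)
    (hf0 : ∀ t ∈ s, (a t).P.f ≠ 0) : ContinuousOn (fun t => field G (a t) e) s := by
  have haux := continuousOn_pi.1 (continuousOn_auxIn e G h hf0)
  refine ContinuousOn.add ?_ continuousOn_const
  unfold linField
  refine ContinuousOn.prodMk ?_ <| ContinuousOn.prodMk ?_ <| ContinuousOn.prodMk ?_ <|
    ContinuousOn.prodMk ?_ <| ContinuousOn.prodMk ?_ <| ContinuousOn.prodMk ?_ <|
    ContinuousOn.prodMk ?_ ?_
  · exact (continuousOn_mul continuousOn_const (continuousOn_hat h.Ω)).add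
      (continuousOn_mul h.R continuousOn_const)
  · simp only [uTildeIn_apply]
    exact ((continuousOn_cross (continuousOn_dzk e h) h.Ω).neg.sub
      (continuousOn_cross (continuousOn_zk e h) h.u)).add
      (continuousOn_vec3 (haux 1) (haux 0) (continuousOn_wIn e G h))
  · exact continuousOn_const
  · exact ((continuousOn_mulVec h.R continuousOn_const).const_smul e.2.2.2.2.1).add
      (h.f.smul continuousOn_const)
  · exact continuousOn_const
  · exact haux 2
  · exact continuousOn_const
  · exact (continuousOn_const.mul (continuousOn_pi.1 (continuousOn_zk e h) 2)).sub
      continuousOn_const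

end Continuity

/-! ### Existence of solutions of the error system -/

/-- The bilinear map whose diagonal is `quadField`. -/
def quadFieldL : Err →ₗ[ℝ] Err →ₗ[ℝ] Err :=
  LinearMap.mk₂ ℝ (fun e e' => (e.1 * hat e'.2.1, 0, 0, e.2.2.2.2.1 • (e'.1 *ᵥ e3), 0, 0, 0, 0))
    (fun a b c => by simp [add_mul, add_smul])
    (fun r a b => by simp [mul_smul])
    (fun a b c => by simp [hat_add, mul_add, Matrix.add_mulVec])
    (fun r a b => by
      have : hat (r • b.2.1) = r • hat b.2.1 := map_smul hatL r b.2.1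
      simp only [Prod.smul_fst, Prod.smul_snd, this, Matrix.smul_mulVec, mul_smul_comm,
        Prod.smul_mk, smul_zero, smul_comm r a.2.2.2.2.1])

theorem quadFieldL_self (e : Err) : quadFieldL e e = quadField e := rfl

theorem norm_quadFieldL_le (e e' : Err) :
    ‖quadFieldL e e'‖ ≤ ‖bilinToCLM quadFieldL‖ * ‖e‖ * ‖e'‖ :=
  (bilinToCLM quadFieldL).le_opNorm₂ e e'

/-- The quadratic part is only locally Lipschitz, hence the restriction to the unit ball.
Polarization, Q(e) - Q(e') = B(e - e', e) + B(e', e - e'), gives the estimate there. -/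
theorem exists_lipschitz_field {M δ : ℝ} (hδ : 0 < δ) (G : Gains) :
    ∃ K : ℝ≥0, ∀ a, IsAdmissible M δ a →
      LipschitzOnWith K (field G a) (Metric.closedBall 0 1) ∧ ∀ e, ‖e‖ ≤ 1 → ‖field G a e‖ ≤ K := by
  obtain ⟨C, hC⟩ := exists_norm_linField_le (M := M) G hδ
  set B := ‖bilinToCLM quadFieldL‖ with hB
  have hB0 : 0 ≤ B := (bilinToCLM quadFieldL).opNorm_nonneg
  refine ⟨NNReal.mk (max C 0 + B + B) (by positivity), fun a ha => ⟨?_, fun e he => ?_⟩⟩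
  · refine LipschitzOnWith.of_dist_le_mul fun e he e' he' => ?_
    simp only [Metric.mem_closedBall, dist_zero_right] at he he'
    rw [dist_eq_norm, dist_eq_norm, NNReal.coe_mk]
    have h1 : field G a e - field G a e'
        = linField G a (e - e') + quadFieldL (e - e') e + quadFieldL e' (e - e') := by
      simp only [field, linField_sub, map_sub, LinearMap.sub_apply, ← quadFieldL_self]
      abel
    rw [h1]
    calc _ ≤ ‖linField G a (e - e')‖ + ‖quadFieldL (e - e') e‖ + ‖quadFieldL e' (e - e')‖ :=
          norm_add₃_le
      _ ≤ max C 0 * ‖e - e'‖ + B * ‖e - e'‖ * 1 + B * 1 * ‖e - e'‖ := by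
          gcongr
          · exact (hC a ha _).trans (by gcongr; exact le_max_left _ _)
          · exact (norm_quadFieldL_le _ _).trans (by gcongr)
          · exact (norm_quadFieldL_le _ _).trans (by gcongr)
      _ = _ := by ring
  · rw [NNReal.coe_mk]
    calc ‖field G a e‖ ≤ ‖linField G a e‖ + ‖quadFieldL e e‖ := norm_add_le _ _
      _ ≤ max C 0 * 1 + B * 1 * 1 := by
          gcongr
          · exact (hC a ha _).trans (by gcongr; exact le_max_left _ _)
          · exact (norm_quadFieldL_le _ _).trans (by gcongr)
      _ ≤ _ := by linarith

/-- The curve of reference data. -/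
def refCurve (P : ℝ → QuadState) (u : ℝ → Vec) (q : ℝ → ℝ) (t : ℝ) : Ref := ⟨P t, u t, q t⟩

/-- The hypotheses on the reference, on `[0, ∞)`. -/
structure IsReference (M δ : ℝ) (P : ℝ → QuadState) (u : ℝ → Vec) (q : ℝ → ℝ) : Prop where
  adm : ∀ t ≥ 0, IsAdmissible M δ (refCurve P u q t)
  deriv_R : ∀ t ≥ 0, HasDerivWithinAt (fun s => (P s).R) ((P t).R * hat (P t).Ω) (Ici 0) t
  deriv_Ω : ∀ t ≥ 0, HasDerivWithinAt (fun s => (P s).Ω) (u t) (Ici 0) t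
  deriv_f : ∀ t ≥ 0, HasDerivWithinAt (fun s => (P s).f) (P t).fdot (Ici 0) t
  deriv_fdot : ∀ t ≥ 0, HasDerivWithinAt (fun s => (P s).fdot) (q t) (Ici 0) t

theorem exists_error_curve {M δ : ℝ} (hδ : 0 < δ) (G : Gains) {P : ℝ → QuadState} {u : ℝ → Vec}
    {q : ℝ → ℝ} (hP : IsReference M δ P u q) (hu : ContinuousOn u (Ici 0))
    (hq : ContinuousOn q (Ici 0)) {t₀ : ℝ} (ht₀ : 0 ≤ t₀) (e₀ : Err) :
    ∃ e : ℝ → Err, e t₀ = e₀ ∧ ContinuousOn e (Ici t₀) ∧ ∀ t ≥ t₀, ‖e t‖ ≤ 1 →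
      HasDerivWithinAt e (field G (refCurve P u q t) (e t)) (Ici t₀) t := by
  obtain ⟨K, hK⟩ := exists_lipschitz_field (M := M) hδ G
  refine exists_continuousOn_hasDerivWithinAt_of_norm_le_one
    (f := fun t => field G (refCurve P u q t)) (K := K) (L := K)
    (fun t ht => (hK _ (hP.adm t (ht₀.trans ht))).1) (fun e => ?_)
    (fun t ht => (hK _ (hP.adm t (ht₀.trans ht))).2) e₀
  refine ContinuousOn.mono ?_ (Ici_subset_Ici.2 ht₀)
  exact continuousOn_field e G
    { R := fun t ht => (hP.deriv_R t ht).continuousWithinAt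
      Ω := fun t ht => (hP.deriv_Ω t ht).continuousWithinAt
      u := hu
      f := fun t ht => (hP.deriv_f t ht).continuousWithinAt
      fdot := fun t ht => (hP.deriv_fdot t ht).continuousWithinAt
      q := hq } fun t ht => (hδ.trans_le (hP.adm t ht).le_f).ne'

end Quadcopter

namespace Quadcopter

/-! ### Time derivatives of the linearizing coordinates -/

/-- Bracketing with a skew matrix preserves both the symmetric and the skew part, and on skew
matrices the bracket is the cross product. This is why the linearized equations of Z_s and z_k
decouple. -/
theorem vee_skewPart_lie_hat (A : Mat) (b : Vec) :
    vee (skewPart ⁅A, hat b⁆) = crossProduct (vee (skewPart A)) b := by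
  ext i
  fin_cases i <;>
  simp [vee, skewPart, hat, Ring.lie_def, Matrix.mul_apply, Fin.sum_univ_three, cross_apply,
    Matrix.vecMul, dotProduct] <;>
  ring

theorem transpose_hat (b : Vec) : (hat b)ᵀ = -hat b := by
  ext i j; fin_cases i <;> fin_cases j <;> simp [hat]

theorem symPart_hat (b : Vec) : symPart (hat b) = 0 := by
  simp [symPart, transpose_hat]

theorem skewPart_hat (b : Vec) : skewPart (hat b) = hat b := by
  simp only [skewPart, transpose_hat]; module

theorem vee_hat (b : Vec) : vee (hat b) = b := by
  ext i; fin_cases i <;> simp [vee, hat]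

theorem hat_vee_skewPart (A : Mat) : hat (vee (skewPart A)) = skewPart A := by
  ext i j
  fin_cases i <;> fin_cases j <;> simp [vee, skewPart, hat] <;> ring

theorem symPart_lie_hat (A : Mat) (b : Vec) : symPart ⁅A, hat b⁆ = ⁅symPart A, hat b⁆ := by
  simp only [symPart, Ring.lie_def, Matrix.transpose_sub, Matrix.transpose_mul, transpose_hat,
    mul_add, add_mul, smul_mul_assoc, mul_smul_comm, neg_mul, mul_neg]
  module

theorem symPart_add_skewPart (A : Mat) : symPart A + skewPart A = A := by
  simp only [symPart, skewPart]; module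

theorem Zs_add_Zk (P S : QuadState) : Zs P S + Zk P S = Z P S := symPart_add_skewPart _

theorem hat_zk (P S : QuadState) : hat (zk P S) = Zk P S := hat_vee_skewPart _

/-- The nonlinear part of `Ż_s`. -/
def remZs (ke : ℝ) (P : QuadState) (e : Err) : Mat :=
  (2 * ke) • Zs P (shift P e) + symPart (Z P (shift P e) * hat e.2.1)

/-- The nonlinear part of `ż_k`. -/
def remzk (P : QuadState) (e : Err) : Vec := vee (skewPart (Z P (shift P e) * hat e.2.1))

/-- The nonlinear part of the derivative of `dddΔx`. -/
def remdddΔx (ke : ℝ) (P : QuadState) (e : Err) : Vec :=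
  (A₀ P * hat (crossProduct (remzk P e) P.Ω) + dA₀ P * (remZs ke P e + hat (remzk P e))
    + A₀ P * (⁅remZs ke P e, hat P.Ω⁆ - (2 * ke) • remZs ke P e)) *ᵥ e3

theorem hat_mulVec_e3 (b : Vec) : hat b *ᵥ e3 = ![b 1, -b 0, 0] := by
  ext i
  fin_cases i <;> simp [hat, e3, Matrix.mulVec, dotProduct, Fin.sum_univ_three]

theorem thrust_smul_hat_mulVec (f s : ℝ) (b : Vec) :
    s • e3 + f • (hat b *ᵥ e3) = ![f * b 1, -(f * b 0), s] := by
  rw [hat_mulVec_e3]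
  ext i
  fin_cases i <;> simp [e3]

/-- The choice of the inputs decouples the dynamics. -/
theorem aux_decoupling (G : Gains) (a : Ref) (e : Err) (hf : a.P.f ≠ 0) (hR : a.P.R * a.P.Rᵀ = 1) :
    (auxIn G a e 2 • a.P.R + A₀ a.P * hat (uTildeIn G a e)) *ᵥ e3
      = vIn G a e - Cmat G.ke a.P a.u a.q (shift a.P e) *ᵥ e3 := by
  have h1 : (auxIn G a e 2 • a.P.R + A₀ a.P * hat (uTildeIn G a e)) *ᵥ e3
      = a.P.R *ᵥ (auxIn G a e 2 • e3 + a.P.f • (hat (uTildeIn G a e) *ᵥ e3)) := by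
    simp only [A₀, Matrix.add_mulVec, Matrix.smul_mulVec, ← Matrix.mulVec_mulVec,
      Matrix.mulVec_add, Matrix.mulVec_smul]
  rw [h1, thrust_smul_hat_mulVec]
  set y : Vec := vIn G a e - Cmat G.ke a.P a.u a.q (shift a.P e) *ᵥ e3 with hy
  -- In the frame R₀ the inputs produce the vector B₀(ũ₂, ũ₁, Δq). The swap of ũ₁ and ũ₂ and the
  -- sign in B₀ come from Ω̂e₃ = (Ω₂, -Ω₁, 0).
  have h2 : (![a.P.f * uTildeIn G a e 1, -(a.P.f * uTildeIn G a e 0), auxIn G a e 2] : Vec)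
      = a.P.Rᵀ *ᵥ y := by
    have h3 : auxIn G a e = ![a.P.f⁻¹ * (a.P.Rᵀ *ᵥ y) 0, -(a.P.f⁻¹ * (a.P.Rᵀ *ᵥ y) 1),
        (a.P.Rᵀ *ᵥ y) 2] := inv_B₀_mulVec hf _
    ext i
    fin_cases i <;> simp [uTildeIn_apply, h3, hf]
  rw [h2, Matrix.mulVec_mulVec, hR, Matrix.one_mulVec]

/-! ### Derivatives of the coordinates along the error flow -/

section Derivatives

variable {G : Gains} {P : ℝ → QuadState} {u : ℝ → Vec} {q : ℝ → ℝ} {e : ℝ → Err} {s : Set ℝ} {t : ℝ}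

/-- The reference equations and the error equation at time `t`. -/
structure ErrorFlowAt (G : Gains) (P : ℝ → QuadState) (u : ℝ → Vec) (q : ℝ → ℝ) (e : ℝ → Err)
    (s : Set ℝ) (t : ℝ) : Prop where
  orth : (P t).R * (P t).Rᵀ = 1
  f_ne : (P t).f ≠ 0
  R : HasDerivWithinAt (fun τ => (P τ).R) (dR₀ (P t)) s t
  Ω : HasDerivWithinAt (fun τ => (P τ).Ω) (u t) s t
  f : HasDerivWithinAt (fun τ => (P τ).f) (P t).fdot s t
  fdot : HasDerivWithinAt (fun τ => (P τ).fdot) (q t) s t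
  e : HasDerivWithinAt e (field G (refCurve P u q t) (e t)) s t

namespace ErrorFlowAt

theorem e₁ (h : ErrorFlowAt G P u q e s t) : HasDerivWithinAt (fun τ => (e τ).1)
    ((e t).1 * hat (P t).Ω + (P t).R * hat (e t).2.1 + (e t).1 * hat (e t).2.1) s t :=
  HasDerivWithinAt.linearMap_comp (LinearMap.fst ℝ Mat _) h.e

theorem e₂ (h : ErrorFlowAt G P u q e s t) : HasDerivWithinAt (fun τ => (e τ).2.1)
    (-crossProduct (dzk (P t) (shift (P t) (e t))) (P t).Ω
      - crossProduct (zk (P t) (shift (P t) (e t))) (u t)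
      + uTildeIn G (refCurve P u q t) (e t)) s t := by
  have h2 := HasDerivWithinAt.linearMap_comp (LinearMap.fst ℝ Vec _ ∘ₗ LinearMap.snd ℝ Mat _) h.e
  refine h2.congr_deriv ?_
  simp [field, linField, quadField, refCurve]

theorem e₃ (h : ErrorFlowAt G P u q e s t) :
    HasDerivWithinAt (fun τ => (e τ).2.2.1) (e t).2.2.2.1 s t := by
  have h2 := HasDerivWithinAt.linearMap_comp
    (LinearMap.fst ℝ Vec _ ∘ₗ LinearMap.snd ℝ Vec _ ∘ₗ LinearMap.snd ℝ Mat _) h.e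
  refine h2.congr_deriv ?_
  simp [field, linField, quadField]

theorem e₄ (h : ErrorFlowAt G P u q e s t) : HasDerivWithinAt (fun τ => (e τ).2.2.2.1)
    (ddΔx (P t) (shift (P t) (e t)) + (e t).2.2.2.2.1 • ((e t).1 *ᵥ e3)) s t := by
  have h2 := HasDerivWithinAt.linearMap_comp
    (LinearMap.fst ℝ Vec _ ∘ₗ LinearMap.snd ℝ Vec _ ∘ₗ LinearMap.snd ℝ Vec _
      ∘ₗ LinearMap.snd ℝ Mat _) h.e
  refine h2.congr_deriv ?_
  -- Since Z_s + Z_k = R₀ᵀΔR and R₀R₀ᵀ = 1, the expression Δẍ is exactly the linear part of the true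
  -- acceleration error; only Δf ΔR e₃ is left over.
  have h3 : A₀ (P t) * Zk (P t) (shift (P t) (e t)) + A₀ (P t) * Zs (P t) (shift (P t) (e t))
      = (P t).f • (e t).1 := by
    rw [← mul_add, add_comm, Zs_add_Zk, Z_shift, A₀, smul_mul_assoc, ← mul_assoc, h.orth, one_mul]
  rw [ddΔx_shift, add_assoc _ (A₀ _ * _), h3]
  simp [field, linField, quadField, refCurve, Matrix.add_mulVec, Matrix.smul_mulVec]

theorem e₅ (h : ErrorFlowAt G P u q e s t) :
    HasDerivWithinAt (fun τ => (e τ).2.2.2.2.1) (e t).2.2.2.2.2.1 s t := by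
  have h2 := HasDerivWithinAt.linearMap_comp
    (LinearMap.fst ℝ ℝ _ ∘ₗ LinearMap.snd ℝ Vec _ ∘ₗ LinearMap.snd ℝ Vec _
      ∘ₗ LinearMap.snd ℝ Vec _ ∘ₗ LinearMap.snd ℝ Mat _) h.e
  refine h2.congr_deriv ?_
  simp [field, linField, quadField]

theorem e₆ (h : ErrorFlowAt G P u q e s t) :
    HasDerivWithinAt (fun τ => (e τ).2.2.2.2.2.1) (auxIn G (refCurve P u q t) (e t) 2) s t := by
  have h2 := HasDerivWithinAt.linearMap_comp
    (LinearMap.fst ℝ ℝ _ ∘ₗ LinearMap.snd ℝ ℝ _ ∘ₗ LinearMap.snd ℝ Vec _ ∘ₗ LinearMap.snd ℝ Vec _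
      ∘ₗ LinearMap.snd ℝ Vec _ ∘ₗ LinearMap.snd ℝ Mat _) h.e
  refine h2.congr_deriv ?_
  simp [field, linField, quadField]

theorem e₇ (h : ErrorFlowAt G P u q e s t) :
    HasDerivWithinAt (fun τ => (e τ).2.2.2.2.2.2.1)
      (G.α • (e t).2.2.1 - G.β • (e t).2.2.2.2.2.2.1) s t := by
  have h2 := HasDerivWithinAt.linearMap_comp
    (LinearMap.fst ℝ Vec _ ∘ₗ LinearMap.snd ℝ ℝ _ ∘ₗ LinearMap.snd ℝ ℝ _ ∘ₗ LinearMap.snd ℝ Vec _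
      ∘ₗ LinearMap.snd ℝ Vec _ ∘ₗ LinearMap.snd ℝ Vec _ ∘ₗ LinearMap.snd ℝ Mat _) h.e
  refine h2.congr_deriv ?_
  simp [field, linField, quadField]

theorem e₈ (h : ErrorFlowAt G P u q e s t) :
    HasDerivWithinAt (fun τ => (e τ).2.2.2.2.2.2.2)
      (G.α * zk (P t) (shift (P t) (e t)) 2 - G.β * (e t).2.2.2.2.2.2.2) s t := by
  have h2 := HasDerivWithinAt.linearMap_comp
    (LinearMap.snd ℝ Vec _ ∘ₗ LinearMap.snd ℝ ℝ _ ∘ₗ LinearMap.snd ℝ ℝ _ ∘ₗ LinearMap.snd ℝ Vec _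
      ∘ₗ LinearMap.snd ℝ Vec _ ∘ₗ LinearMap.snd ℝ Vec _ ∘ₗ LinearMap.snd ℝ Mat _) h.e
  refine h2.congr_deriv ?_
  simp [field, linField, quadField, refCurve]

theorem dR₀ (h : ErrorFlowAt G P u q e s t) :
    HasDerivWithinAt (fun τ => Quadcopter.dR₀ (P τ)) (ddR₀ (P t) (u t)) s t :=
  h.R.mul (h.Ω.linearMap_comp hatL)

theorem A₀ (h : ErrorFlowAt G P u q e s t) :
    HasDerivWithinAt (fun τ => Quadcopter.A₀ (P τ)) (Quadcopter.dA₀ (P t)) s t :=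
  (h.f.smul h.R).congr_deriv (by rw [dA₀, add_comm])

theorem dA₀ (h : ErrorFlowAt G P u q e s t) :
    HasDerivWithinAt (fun τ => Quadcopter.dA₀ (P τ)) (ddA₀ (P t) (u t) (q t)) s t :=
  ((h.fdot.smul h.R).add (h.f.smul h.dR₀)).congr_deriv (by rw [ddA₀]; module)

theorem Z (h : ErrorFlowAt G P u q e s t) :
    HasDerivWithinAt (fun τ => Quadcopter.Z (P τ) (shift (P τ) (e τ)))
      (⁅Quadcopter.Z (P t) (shift (P t) (e t)), hat (P t).Ω⁆ + hat (e t).2.1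
        + Quadcopter.Z (P t) (shift (P t) (e t)) * hat (e t).2.1) s t := by
  simp only [Z_shift]
  refine ((h.R.linearMap_comp transposeL).mul h.e₁).congr_deriv ?_
  have h1 : (P t).Rᵀ * (P t).R = 1 := mul_eq_one_comm.1 h.orth
  have h2 : transposeL (Quadcopter.dR₀ (P t)) = -hat (P t).Ω * (P t).Rᵀ := by
    change (Quadcopter.dR₀ (P t))ᵀ = _
    rw [Quadcopter.dR₀, Matrix.transpose_mul, transpose_hat]
  have h3 : transposeL (P t).R = (P t).Rᵀ := rfl
  rw [h2, h3, Ring.lie_def, mul_add, mul_add, ← mul_assoc _ (P t).R, h1, one_mul]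
  simp only [neg_mul, mul_assoc]
  abel

/-- The linearized equation carries -2kₑZ_s, absent from the motion on SO(3). Adding and subtracting
it places 2kₑZ_s in `remZs`, which is of second order on SO(3). -/
theorem Zs (h : ErrorFlowAt G P u q e s t) :
    HasDerivWithinAt (fun τ => Quadcopter.Zs (P τ) (shift (P τ) (e τ)))
      (dZs G.ke (P t) (shift (P t) (e t)) + remZs G.ke (P t) (e t)) s t := by
  refine (h.Z.linearMap_comp symPartL).congr_deriv ?_
  change symPart _ = _
  rw [symPart_add, symPart_add, symPart_lie_hat, symPart_hat, dZs, remZs]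
  rw [← Quadcopter.Zs]
  abel

theorem zk (h : ErrorFlowAt G P u q e s t) :
    HasDerivWithinAt (fun τ => Quadcopter.zk (P τ) (shift (P τ) (e τ)))
      (Quadcopter.dzk (P t) (shift (P t) (e t)) + remzk (P t) (e t)) s t := by
  refine (h.Z.linearMap_comp (veeL ∘ₗ skewPartL)).congr_deriv ?_
  change vee (skewPart _) = _
  rw [skewPart_add, skewPart_add, vee_add, vee_add, vee_skewPart_lie_hat, skewPart_hat, vee_hat,
    dzk_shift, remzk]
  rfl

theorem Zk (h : ErrorFlowAt G P u q e s t) :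
    HasDerivWithinAt (fun τ => Quadcopter.Zk (P τ) (shift (P τ) (e τ)))
      (dZk (P t) (shift (P t) (e t)) + hat (remzk (P t) (e t))) s t := by
  simp only [← hat_zk]
  exact (h.zk.linearMap_comp hatL).congr_deriv (hat_add _ _)

/-- The terms -ż_k × Ω₀ - z_k × Ω̇₀ in the feedback cancel the derivative of z_k × Ω₀ up to the
remainder, so z_k becomes a double integrator driven by ũ. -/
theorem dzk (h : ErrorFlowAt G P u q e s t) :
    HasDerivWithinAt (fun τ => Quadcopter.dzk (P τ) (shift (P τ) (e τ)))
      (crossProduct (remzk (P t) (e t)) (P t).Ω + uTildeIn G (refCurve P u q t) (e t)) s t := by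
  simp only [dzk_shift (P _)]
  refine ((h.zk.bilinearMap_comp crossProduct h.Ω).add h.e₂).congr_deriv ?_
  rw [map_add, LinearMap.add_apply]
  abel

theorem dZk (h : ErrorFlowAt G P u q e s t) :
    HasDerivWithinAt (fun τ => Quadcopter.dZk (P τ) (shift (P τ) (e τ)))
      (hat (crossProduct (remzk (P t) (e t)) (P t).Ω)
        + hat (uTildeIn G (refCurve P u q t) (e t))) s t :=
  (h.dzk.linearMap_comp hatL).congr_deriv (hat_add _ _)

theorem dZs (h : ErrorFlowAt G P u q e s t) :
    HasDerivWithinAt (fun τ => Quadcopter.dZs G.ke (P τ) (shift (P τ) (e τ)))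
      (⁅Quadcopter.dZs G.ke (P t) (shift (P t) (e t)), hat (P t).Ω⁆
        + ⁅Quadcopter.Zs (P t) (shift (P t) (e t)), hat (u t)⁆
        - (2 * G.ke) • Quadcopter.dZs G.ke (P t) (shift (P t) (e t))
        + (⁅remZs G.ke (P t) (e t), hat (P t).Ω⁆ - (2 * G.ke) • remZs G.ke (P t) (e t))) s t := by
  have hΩ := h.Ω.linearMap_comp hatL
  have h1 := ((h.Zs.mul hΩ).sub (hΩ.mul h.Zs)).sub (h.Zs.const_smul (2 * G.ke))
  refine h1.congr_deriv ?_
  change (_ * hat _ + _ * hat _) - (hat _ * _ + hat _ * _) - _ = _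
  simp only [Ring.lie_def, add_mul, mul_add, smul_add]
  abel

theorem ddΔx (h : ErrorFlowAt G P u q e s t) :
    HasDerivWithinAt (fun τ => Quadcopter.ddΔx (P τ) (shift (P τ) (e τ)))
      (dddΔx G.ke (P t) (shift (P t) (e t))
        + (Quadcopter.A₀ (P t) * (remZs G.ke (P t) (e t) + hat (remzk (P t) (e t)))) *ᵥ e3) s t := by
  simp only [ddΔx_shift]
  have h1 := (((h.e₅.smul h.R).add (h.A₀.mul h.Zk)).add (h.A₀.mul h.Zs)).linearMap_comp
    (mulVecL.flip e3)
  refine h1.congr_deriv ?_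
  change _ *ᵥ e3 = _
  rw [dddΔx_shift, ← Matrix.add_mulVec]
  congr 1
  simp only [mul_add]
  abel

/-- Differentiating produces (Δq R₀ + A₀ũ̂)e₃, the input-free terms Ce₃, and a remainder. By
`aux_decoupling` the first two add up to v. -/
theorem dddΔx (h : ErrorFlowAt G P u q e s t) :
    HasDerivWithinAt (fun τ => Quadcopter.dddΔx G.ke (P τ) (shift (P τ) (e τ)))
      (vIn G (refCurve P u q t) (e t) + remdddΔx G.ke (P t) (e t)) s t := by
  simp only [dddΔx_shift]
  have h1 := (((((h.e₆.smul h.R).add (h.A₀.mul h.dZk)).add (h.e₅.smul h.dR₀)).add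
    (h.dA₀.mul (h.Zs.add h.Zk))).add (h.A₀.mul h.dZs)).linearMap_comp (mulVecL.flip e3)
  refine h1.congr_deriv ?_
  change _ *ᵥ e3 = _
  have h2 := aux_decoupling G (refCurve P u q t) (e t) h.f_ne h.orth
  rw [eq_sub_iff_add_eq] at h2
  rw [← h2, Cmat_shift, remdddΔx, ← Matrix.add_mulVec, ← Matrix.add_mulVec]
  congr 1
  simp only [refCurve, mul_add, mul_sub, mul_smul_comm, Pi.add_apply]
  module

end ErrorFlowAt

end Derivatives

end Quadcopter

namespace Quadcopter

open Asymptotics Filter Topology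

/-! ### The linear normal form -/

/-- Values of the coordinates `(Δx, Δẋ, Δẍ, Δx⁽³⁾, z_{k3}, ż_{k3}, σ, ρ)`. -/
abbrev Coord := Vec × Vec × Vec × Vec × ℝ × ℝ × Vec × ℝ

/-- Complex vectors. -/
abbrev VecC := Fin 3 → ℂ

/-- The complexification of `Coord`. -/
abbrev CoordC := VecC × VecC × VecC × VecC × ℂ × ℂ × VecC × ℂ

/-- The coordinates of the normal form. -/
def coord (ke : ℝ) (P : QuadState) (e : Err) : Coord :=
  (e.2.2.1, e.2.2.2.1, ddΔx P (shift P e), dddΔx ke P (shift P e), zk P (shift P e) 2,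
    dzk P (shift P e) 2, e.2.2.2.2.2.2.1, e.2.2.2.2.2.2.2)

/-- The closed-loop linear vector field of the normal form. -/
def sys (G : Gains) (y : Coord) : Coord :=
  (y.2.1, y.2.2.1, y.2.2.2.1,
    -(G.K₃ *ᵥ y.2.2.2.1) - G.K₂ *ᵥ y.2.2.1 - G.K₁ *ᵥ y.2.1 - G.K₀ *ᵥ y.1
      - G.KI *ᵥ y.2.2.2.2.2.2.1,
    y.2.2.2.2.2.1,
    -(G.a₁ * y.2.2.2.2.2.1) - G.a₀ * y.2.2.2.2.1 - G.aI * y.2.2.2.2.2.2.2,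
    G.α • y.1 - G.β • y.2.2.2.2.2.2.1,
    G.α * y.2.2.2.2.1 - G.β * y.2.2.2.2.2.2.2)

/-- A real matrix as a complex one. -/
def matC (K : Mat) : Matrix (Fin 3) (Fin 3) ℂ := K.map Complex.ofReal

/-- The complexification of `sys`. -/
def sysC (G : Gains) : CoordC →ₗ[ℂ] CoordC where
  toFun y :=
    (y.2.1, y.2.2.1, y.2.2.2.1,
      -(matC G.K₃ *ᵥ y.2.2.2.1) - matC G.K₂ *ᵥ y.2.2.1 - matC G.K₁ *ᵥ y.2.1 - matC G.K₀ *ᵥ y.1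
        - matC G.KI *ᵥ y.2.2.2.2.2.2.1,
      y.2.2.2.2.2.1,
      -(G.a₁ * y.2.2.2.2.2.1) - G.a₀ * y.2.2.2.2.1 - G.aI * y.2.2.2.2.2.2.2,
      (G.α : ℂ) • y.1 - (G.β : ℂ) • y.2.2.2.2.2.2.1,
      G.α * y.2.2.2.2.1 - G.β * y.2.2.2.2.2.2.2)
  map_add' y y' := by
    simp only [Prod.fst_add, Prod.snd_add, Matrix.mulVec_add, Prod.mk_add_mk]
    refine Prod.ext rfl (Prod.ext rfl (Prod.ext rfl (Prod.ext ?_ (Prod.ext rfl (Prod.ext ?_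
      (Prod.ext ?_ ?_)))))) <;> dsimp only <;> first | module | ring
  map_smul' c y := by
    simp only [Prod.smul_fst, Prod.smul_snd, Matrix.mulVec_smul, Prod.smul_mk, RingHom.id_apply,
      smul_eq_mul]
    refine Prod.ext rfl (Prod.ext rfl (Prod.ext rfl (Prod.ext ?_ (Prod.ext rfl (Prod.ext ?_
      (Prod.ext ?_ ?_)))))) <;> dsimp only <;> first | module | ring

/-- The inclusion of real vectors in complex ones. -/
def castVec (x : Vec) : VecC := fun i => (x i : ℂ)

/-- The inclusion of real coordinates in complex ones. -/
def castCoord : Coord →ₗ[ℝ] CoordC where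
  toFun y := (castVec y.1, castVec y.2.1, castVec y.2.2.1, castVec y.2.2.2.1, y.2.2.2.2.1,
    y.2.2.2.2.2.1, castVec y.2.2.2.2.2.2.1, y.2.2.2.2.2.2.2)
  map_add' y y' := by
    refine Prod.ext ?_ (Prod.ext ?_ (Prod.ext ?_ (Prod.ext ?_ (Prod.ext ?_ (Prod.ext ?_
      (Prod.ext ?_ ?_)))))) <;> first | (funext i; simp [castVec]) | simp
  map_smul' c y := by
    refine Prod.ext ?_ (Prod.ext ?_ (Prod.ext ?_ (Prod.ext ?_ (Prod.ext ?_ (Prod.ext ?_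
      (Prod.ext ?_ ?_)))))) <;> first | (funext i; simp [castVec]) | simp

theorem norm_castVec (x : Vec) : ‖castVec x‖ = ‖x‖ := by
  simp [castVec, Pi.norm_def]

/-- With sup norms on the products complexification is isometric, so decay proved from complex
eigenvalues passes to the real system with no change of constants. -/
theorem norm_castCoord (y : Coord) : ‖castCoord y‖ = ‖y‖ := by
  simp [castCoord, Prod.norm_def, norm_castVec]

theorem castVec_mulVec (K : Mat) (x : Vec) : castVec (K *ᵥ x) = matC K *ᵥ castVec x := by
  ext i
  simp [castVec, matC, Matrix.mulVec, dotProduct]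

theorem castCoord_sys (G : Gains) (y : Coord) : castCoord (sys G y) = sysC G (castCoord y) := by
  have hsub : ∀ a b : Vec, castVec (a - b) = castVec a - castVec b := fun a b => by
    ext i; simp [castVec]
  have hneg : ∀ a : Vec, castVec (-a) = -castVec a := fun a => by ext i; simp [castVec]
  have hsmul : ∀ (c : ℝ) (a : Vec), castVec (c • a) = (c : ℂ) • castVec a := fun c a => by
    ext i; simp [castVec]
  simp [castCoord, sys, sysC, hsub, hneg, hsmul, castVec_mulVec]

/-- The nonlinear remainder in the normal form. -/
def remCoord (ke : ℝ) (P : QuadState) (e : Err) : Coord :=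
  (0, e.2.2.2.2.1 • (e.1 *ᵥ e3), (A₀ P * (remZs ke P e + hat (remzk P e))) *ᵥ e3,
    remdddΔx ke P e, remzk P e 2, crossProduct (remzk P e) P.Ω 2, 0, 0)

/-- All dependence of the linear part on the reference has disappeared: `sys` involves only the
gains. The laws v and w are linear in exactly these coordinates, which closes the system. -/
theorem ErrorFlowAt.coord {G : Gains} {P : ℝ → QuadState} {u : ℝ → Vec} {q : ℝ → ℝ} {e : ℝ → Err}
    {s : Set ℝ} {t : ℝ} (h : ErrorFlowAt G P u q e s t) :
    HasDerivWithinAt (fun τ => Quadcopter.coord G.ke (P τ) (e τ))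
      (sys G (Quadcopter.coord G.ke (P t) (e t)) + remCoord G.ke (P t) (e t)) s t := by
  have hzk := hasDerivWithinAt_pi.1 h.zk 2
  have hdzk := hasDerivWithinAt_pi.1 h.dzk 2
  have h1 := h.e₃.prodMk <| h.e₄.prodMk <| h.ddΔx.prodMk <| h.dddΔx.prodMk <| hzk.prodMk <|
    hdzk.prodMk <| h.e₇.prodMk h.e₈
  refine h1.congr_deriv ?_
  have hw : uTildeIn G (refCurve P u q t) (e t) 2 = wIn G (refCurve P u q t) (e t) := by
    simp [uTildeIn_apply]
  simp only [Pi.add_apply, hw]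
  simp only [sys, remCoord, Quadcopter.coord, vIn_shift, wIn, wLaw, refCurve, Prod.mk_add_mk,
    add_zero]
  rw [add_comm (crossProduct _ _ 2)]

/-! ### Eigenvalues of the normal form -/

/-- A nonzero kernel vector of the matrix polynomial evaluated at ev makes its determinant vanish
there, so ev is a root of a Hurwitz polynomial. -/
theorem matC_det_eq_zero {n : ℕ} (p : ℝ[X]) (D : Matrix (Fin n) (Fin n) ℝ[X]) (hp : p = D.det)
    (hH : IsHurwitz p) {ev : ℂ} {w : Fin n → ℂ} (hw : w ≠ 0)
    (h : D.map (Polynomial.aeval ev) *ᵥ w = 0) : ev.re < 0 := by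
  refine hH ev ?_
  have h1 : (D.map (Polynomial.aeval ev)).det = 0 := Matrix.exists_mulVec_eq_zero_iff.1 ⟨w, hw, h⟩
  rw [hp]
  exact ((Polynomial.aeval (R := ℝ) ev).toRingHom.map_det D).trans h1

theorem map_aeval_smul_one (ev : ℂ) (k : ℕ) :
    ((Polynomial.X ^ k : ℝ[X]) • (1 : Matrix (Fin 3) (Fin 3) ℝ[X])).map (Polynomial.aeval ev)
      = ev ^ k • 1 := by
  ext i j
  by_cases h : i = j <;> simp [h]

theorem map_aeval_smul_map_C (ev : ℂ) (k : ℕ) (K : Mat) :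
    ((Polynomial.X ^ k : ℝ[X]) • K.map Polynomial.C).map (Polynomial.aeval ev)
      = ev ^ k • matC K := by
  ext i j
  simpa [matC] using mul_comm _ _

theorem map_aeval_X_smul_map_C (ev : ℂ) (K : Mat) :
    ((Polynomial.X : ℝ[X]) • K.map Polynomial.C).map (Polynomial.aeval ev) = ev • matC K := by
  ext i j
  simpa [matC] using mul_comm _ _

theorem map_aeval_map_C (ev : ℂ) (K : Mat) :
    (K.map Polynomial.C).map (Polynomial.aeval ev) = matC K := by
  ext i j
  simp [matC]

/-- Every eigenvalue of the closed-loop normal form has negative real part. -/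
def IsStable (G : Gains) : Prop :=
  ∀ (ev : ℂ) (w : CoordC), w ≠ 0 → sysC G w = ev • w → ev.re < 0

theorem sysC_eq_smul_iff (G : Gains) (ev : ℂ) (w : CoordC) : sysC G w = ev • w ↔
    w.2.1 = ev • w.1 ∧ w.2.2.1 = ev • w.2.1 ∧ w.2.2.2.1 = ev • w.2.2.1 ∧
    -(matC G.K₃ *ᵥ w.2.2.2.1) - matC G.K₂ *ᵥ w.2.2.1 - matC G.K₁ *ᵥ w.2.1 - matC G.K₀ *ᵥ w.1
        - matC G.KI *ᵥ w.2.2.2.2.2.2.1 = ev • w.2.2.2.1 ∧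
    w.2.2.2.2.2.1 = ev * w.2.2.2.2.1 ∧
    -(G.a₁ * w.2.2.2.2.2.1) - G.a₀ * w.2.2.2.2.1 - G.aI * w.2.2.2.2.2.2.2
      = ev * w.2.2.2.2.2.1 ∧
    (G.α : ℂ) • w.1 - (G.β : ℂ) • w.2.2.2.2.2.2.1 = ev • w.2.2.2.2.2.2.1 ∧
    G.α * w.2.2.2.2.1 - G.β * w.2.2.2.2.2.2.2 = ev * w.2.2.2.2.2.2.2 := by
  simp only [sysC, LinearMap.coe_mk, AddHom.coe_mk, Prod.ext_iff, Prod.smul_fst, Prod.smul_snd,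
    smul_eq_mul]

/-- The gains of the law without integral action; the unused integral states decay freely. -/
def pdGains (ke : ℝ) (K₀ K₁ K₂ K₃ : Mat) (a₀ a₁ : ℝ) : Gains :=
  ⟨ke, K₀, K₁, K₂, K₃, 0, a₀, a₁, 0, 0, 1⟩

/-- The gains of the law with integral action. -/
def pidGains (ke : ℝ) (K₀ K₁ K₂ K₃ KI : Mat) (a₀ a₁ aI : ℝ) : Gains :=
  ⟨ke, K₀, K₁, K₂, K₃, KI, a₀, a₁, aI, 1, 0⟩

/-- The imaginary part reads Im z (2 Re z + a₁) = 0. If Re z ≥ 0 then z is real and nonnegative, and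
the left-hand side is at least a₀ > 0. -/
theorem re_neg_of_quadratic {a₀ a₁ : ℝ} (h₀ : 0 < a₀) (h₁ : 0 < a₁) {z : ℂ}
    (h : z ^ 2 + a₁ * z + a₀ = 0) : z.re < 0 := by
  have hre := congrArg Complex.re h
  have him := congrArg Complex.im h
  simp [pow_two] at hre him
  by_contra! hz
  have h2 : z.im * (2 * z.re + a₁) = 0 := by linarith
  rcases mul_eq_zero.1 h2 with h3 | h3
  · rw [h3] at hre
    nlinarith
  · linarith

/-- The chains of integrators force an eigenvector to be (x, λx, λ²x, λ³x, z, λz, σ, ρ). If x ≠ 0 it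
lies in the kernel of the quartic matrix polynomial; if z ≠ 0 then λ is a root of the scalar
quadratic; otherwise only the auxiliary integral states remain and λ = -1. -/
theorem isStable_pdGains {ke : ℝ} {K₀ K₁ K₂ K₃ : Mat} {a₀ a₁ : ℝ}
    (hK : IsHurwitz (charPoly4 K₀ K₁ K₂ K₃)) (h₀ : 0 < a₀) (h₁ : 0 < a₁) :
    IsStable (pdGains ke K₀ K₁ K₂ K₃ a₀ a₁) := by
  intro ev w hw h
  rw [sysC_eq_smul_iff] at h
  obtain ⟨x, v, a, j, z, y, σ, ρ⟩ := w
  dsimp only at h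
  obtain ⟨rfl, rfl, rfl, h4, rfl, h6, h7, h8⟩ := h
  simp only [pdGains, Complex.ofReal_zero, Complex.ofReal_one, zero_smul, one_smul, zero_sub,
    zero_mul, one_mul, sub_zero] at h4 h6 h7 h8
  by_cases hx : x = 0
  · by_cases hz : z = 0
    · have hev : ev = -1 := by
        have hσρ : σ ≠ 0 ∨ ρ ≠ 0 := by
          by_contra! hcon
          exact hw (by simp [hx, hz, hcon.1, hcon.2])
        rcases hσρ with hσ | hρ
        · rw [← neg_one_smul ℂ σ] at h7
          exact (smul_left_injective ℂ hσ h7).symm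
        · rw [← neg_one_mul] at h8
          exact (mul_right_cancel₀ hρ h8).symm
      simp [hev]
    · refine re_neg_of_quadratic h₀ h₁ (z := ev) (mul_right_cancel₀ hz ?_)
      linear_combination -h6
  · refine matC_det_eq_zero _ _ rfl hK hx ?_
    have hKI : matC (0 : Mat) = 0 := by ext; simp [matC]
    rw [hKI, Matrix.zero_mulVec, sub_zero, ← sub_eq_zero] at h4
    rw [← neg_zero, ← h4]
    simp only [Matrix.map_add _ (map_add (Polynomial.aeval ev)), map_aeval_smul_one,
      map_aeval_smul_map_C, map_aeval_X_smul_map_C, map_aeval_map_C, Matrix.add_mulVec,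
      Matrix.smul_mulVec, Matrix.mulVec_smul, Matrix.one_mulVec]
    module

/-- The integrators now begin at σ and ρ: x = λσ and z = λρ. An eigenvector is determined by (σ, ρ),
and the degrees in the characteristic polynomials rise to five and three. -/
theorem isStable_pidGains {ke : ℝ} {K₀ K₁ K₂ K₃ KI : Mat} {a₀ a₁ aI : ℝ}
    (hK : IsHurwitz (charPoly5 K₀ K₁ K₂ K₃ KI))
    (ha : IsHurwitz (Polynomial.X ^ 3 + Polynomial.C a₁ * Polynomial.X ^ 2
        + Polynomial.C a₀ * Polynomial.X + Polynomial.C aI)) :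
    IsStable (pidGains ke K₀ K₁ K₂ K₃ KI a₀ a₁ aI) := by
  intro ev w hw h
  rw [sysC_eq_smul_iff] at h
  obtain ⟨x, v, a, j, z, y, σ, ρ⟩ := w
  simp only [pidGains, Complex.ofReal_zero, Complex.ofReal_one, zero_smul, one_smul,
    zero_mul, one_mul, sub_zero] at h
  obtain ⟨rfl, rfl, rfl, h4, rfl, h6, rfl, rfl⟩ := h
  by_cases hσ : σ = 0
  · have hρ : ρ ≠ 0 := by
      rintro rfl
      exact hw (by simp [hσ])
    refine ha ev (mul_right_cancel₀ hρ ?_)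
    simp only [map_add, map_mul, map_pow, Polynomial.aeval_X, Polynomial.aeval_C,
      Complex.coe_algebraMap]
    linear_combination -h6
  · refine matC_det_eq_zero _ _ rfl hK hσ ?_
    rw [← sub_eq_zero] at h4
    rw [← neg_zero, ← h4]
    simp only [Matrix.map_add _ (map_add (Polynomial.aeval ev)), map_aeval_smul_one,
      map_aeval_smul_map_C, map_aeval_X_smul_map_C, map_aeval_map_C, Matrix.add_mulVec,
      Matrix.smul_mulVec, Matrix.mulVec_smul, Matrix.one_mulVec]
    module

/-- Exponential decay of the linear normal form. -/
theorem IsStable.exists_decay {G : Gains} (hG : IsStable G) :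
    ∃ C : ℝ, 0 < C ∧ ∃ ν : ℝ, 0 < ν ∧ ∀ t : ℝ, 0 ≤ t →
      ‖NormedSpace.exp (t • LinearMap.toContinuousLinearMap (sysC G))‖ ≤ C * Real.exp (-ν * t) :=
  exists_norm_exp_smul_le _ fun ev w hw h => hG ev w hw h

end Quadcopter

namespace Quadcopter

open Asymptotics Filter Topology

/-! ### Quadratic bounds and equivalence of the coordinates with the error -/

section Estimates

variable {M δ : ℝ}

/-- Pairs of an admissible reference and an error with orthogonal actual attitude. -/
def orthSet (M δ : ℝ) : Set (Ref × Err) :=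
  {z | IsAdmissible M δ z.1 ∧ (z.1.P.R + z.2.1)ᵀ * (z.1.P.R + z.2.1) = 1}

theorem orthFilter_le : 𝓟 (orthSet M δ) ≤ admFilter M δ :=
  principal_mono.2 fun _ h => h.1

/-- Expand (R₀ + ΔR)ᵀ(R₀ + ΔR) = 1: the first-order terms are 2Z_s, so they equal minus the
second-order term. This is the only place where orthogonality of the actual attitude improves the
order of an estimate. -/
theorem Zs_eq_of_orth {P : QuadState} {e : Err} (hR : P.Rᵀ * P.R = 1)
    (h : (P.R + e.1)ᵀ * (P.R + e.1) = 1) : Zs P (shift P e) = -((1 / 2 : ℝ) • (e.1ᵀ * e.1)) := by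
  rw [Matrix.transpose_add, mul_add, add_mul, add_mul, hR, add_assoc, add_eq_left] at h
  have h2 : P.Rᵀ * e.1 + e.1ᵀ * P.R = -(e.1ᵀ * e.1) := by
    rw [eq_neg_iff_add_eq_zero, ← h]; abel
  rw [Zs, Z_shift, symPart, Matrix.transpose_mul, Matrix.transpose_transpose, h2, smul_neg]

theorem isBigO_Zs_sq : (fun z : Ref × Err => Zs z.1.P (shift z.1.P z.2))
    =O[𝓟 (orthSet M δ)] fun z => errNorm z * errNorm z := by
  have h1 : (fun z : Ref × Err => -((1 / 2 : ℝ) • (z.2.1ᵀ * z.2.1)))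
      =O[𝓟 (orthSet M δ)] fun z => errNorm z * errNorm z :=
    (isBigO_smul (isBigO_const_one _) ((isBigO_transpose isBigO_err₁).mul isBigO_err₁)).neg_left
  refine h1.congr' (eventually_principal.2 fun z hz => ?_) EventuallyEq.rfl
  exact (Zs_eq_of_orth (transpose_mul_self_of_mem_SO3 hz.1.mem_SO3) hz.2).symm

theorem isBigO_Z_mul_hat : (fun z : Ref × Err => Z z.1.P (shift z.1.P z.2) * hat z.2.2.1)
    =O[𝓟 (orthSet M δ)] fun z => errNorm z * errNorm z :=
  (isBigO_Z.mono orthFilter_le).mul (isBigO_hat isBigO_err₂)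

theorem isBigO_remZs (ke : ℝ) : (fun z : Ref × Err => remZs ke z.1.P z.2)
    =O[𝓟 (orthSet M δ)] fun z => errNorm z * errNorm z :=
  (isBigO_smul (isBigO_const_one _) isBigO_Zs_sq).add (isBigO_symPart isBigO_Z_mul_hat)

theorem isBigO_remzk : (fun z : Ref × Err => remzk z.1.P z.2)
    =O[𝓟 (orthSet M δ)] fun z => errNorm z * errNorm z :=
  isBigO_vee (isBigO_skewPart isBigO_Z_mul_hat)

theorem isBigO_remdddΔx (ke : ℝ) : (fun z : Ref × Err => remdddΔx ke z.1.P z.2)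
    =O[𝓟 (orthSet M δ)] fun z => errNorm z * errNorm z := by
  have hΩ := isBigO_Ω.mono (orthFilter_le (M := M) (δ := δ))
  have hA := isBigO_A₀.mono (orthFilter_le (M := M) (δ := δ))
  have hdA := isBigO_dA₀.mono (orthFilter_le (M := M) (δ := δ))
  exact isBigO_mulVec_const _ (((isBigO_mul hA (isBigO_hat (isBigO_cross isBigO_remzk hΩ))).add
    (isBigO_mul hdA ((isBigO_remZs ke).add (isBigO_hat isBigO_remzk)))).add
    (isBigO_mul hA ((isBigO_lie (isBigO_remZs ke) (isBigO_hat hΩ)).sub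
      (isBigO_smul (isBigO_const_one _) (isBigO_remZs ke)))))

theorem isBigO_remCoord (ke : ℝ) : (fun z : Ref × Err => remCoord ke z.1.P z.2)
    =O[𝓟 (orthSet M δ)] fun z => errNorm z * errNorm z := by
  have hΩ := isBigO_Ω.mono (orthFilter_le (M := M) (δ := δ))
  have hA := isBigO_A₀.mono (orthFilter_le (M := M) (δ := δ))
  unfold remCoord
  refine IsBigO.prod_left (isBigO_zero _ _) <| IsBigO.prod_left ?_ <| IsBigO.prod_left ?_ <|
    IsBigO.prod_left (isBigO_remdddΔx ke) <| IsBigO.prod_left (isBigO_apply isBigO_remzk 2) <|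
    IsBigO.prod_left (isBigO_apply (isBigO_cross isBigO_remzk hΩ) 2) <|
    IsBigO.prod_left (isBigO_zero _ _) (isBigO_zero _ _)
  · exact isBigO_err₅.smul (isBigO_mulVec_const _ isBigO_err₁)
  · exact isBigO_mulVec_const _ (isBigO_mul hA ((isBigO_remZs ke).add (isBigO_hat isBigO_remzk)))

theorem isBigO_coord (ke : ℝ) : (fun z : Ref × Err => coord ke z.1.P z.2)
    =O[admFilter M δ] errNorm :=
  IsBigO.prod_left isBigO_err₃ <| IsBigO.prod_left isBigO_err₄ <|
    IsBigO.prod_left isBigO_ddΔx <| IsBigO.prod_left (isBigO_dddΔx ke) <|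
    IsBigO.prod_left (isBigO_apply isBigO_zk 2) <| IsBigO.prod_left (isBigO_apply isBigO_dzk 2) <|
    IsBigO.prod_left isBigO_err₇ isBigO_err₈

/-- The size of the coordinates and of `Z_s`. -/
def coordNorm (ke : ℝ) (z : Ref × Err) : ℝ := ‖coord ke z.1.P z.2‖ + ‖Zs z.1.P (shift z.1.P z.2)‖

/-- Recovering the thrust and the horizontal part of a rotation rate. -/
theorem isBigO_of_thrust {g : Ref × Err → ℝ} {s : Ref × Err → ℝ} {b : Ref × Err → Vec}
    (hδ : 0 < δ)
    (h : (fun z => s z • e3 + z.1.P.f • (hat (b z) *ᵥ e3)) =O[admFilter M δ] g)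
    (hb : (fun z => b z 2) =O[admFilter M δ] g) :
    s =O[admFilter M δ] g ∧ b =O[admFilter M δ] g := by
  simp only [thrust_smul_hat_mulVec] at h
  have hi := isBigO_pi.1 h
  refine ⟨hi 2, isBigO_pi.2 fun i => ?_⟩
  have hf : ∀ᶠ z in admFilter M δ, z.1.P.f ≠ 0 :=
    eventually_principal.2 fun z hz => (hδ.trans_le hz.le_f).ne'
  fin_cases i
  · refine (isBigO_smul (isBigO_f_inv hδ) (hi 1).neg_left).congr' ?_ EventuallyEq.rfl
    filter_upwards [hf] with z hz
    simp [hz]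
  · refine (isBigO_smul (isBigO_f_inv hδ) (hi 0)).congr' ?_ EventuallyEq.rfl
    filter_upwards [hf] with z hz
    simp [hz]
  · exact hb

/-- The change of variables is inverted in triangular order. The value of Δẍ, with its Z_s term
removed, yields Δf, z_{k1} and z_{k2}; together with z_{k3} this gives Z. The value of Δx⁽³⁾ then
yields Δḟ and ż_k in the same way. Finally ΔR = R₀Z and ΔΩ = ż_k - z_k × Ω₀. -/
theorem isBigO_err_coordNorm (ke : ℝ) (hδ : 0 < δ) :
    (fun z : Ref × Err => z.2) =O[admFilter M δ] coordNorm ke := by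
  have hc : (fun z : Ref × Err => coord ke z.1.P z.2) =O[admFilter M δ] coordNorm ke :=
    isBigO_of_le _ fun z => by
      rw [coordNorm, Real.norm_of_nonneg (by positivity)]
      exact le_add_of_nonneg_right (norm_nonneg _)
  have hZs : (fun z : Ref × Err => Zs z.1.P (shift z.1.P z.2)) =O[admFilter M δ] coordNorm ke :=
    isBigO_of_le _ fun z => by
      rw [coordNorm, Real.norm_of_nonneg (by positivity)]
      exact le_add_of_nonneg_left (norm_nonneg _)
  have hx := hc.prod_left_fst
  have hc2 := hc.prod_left_snd
  have hv := hc2.prod_left_fst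
  have hc3 := hc2.prod_left_snd
  have hdd := hc3.prod_left_fst
  have hc4 := hc3.prod_left_snd
  have hddd := hc4.prod_left_fst
  have hc5 := hc4.prod_left_snd
  have hzk3 := hc5.prod_left_fst
  have hc6 := hc5.prod_left_snd
  have hdzk3 := hc6.prod_left_fst
  have hc7 := hc6.prod_left_snd
  have hσ := hc7.prod_left_fst
  have hρ := hc7.prod_left_snd
  clear hc hc2 hc3 hc4 hc5 hc6 hc7
  have horth : ∀ᶠ z in admFilter M δ, z.1.P.Rᵀ * z.1.P.R = 1 :=
    eventually_principal.2 fun z hz => transpose_mul_self_of_mem_SO3 hz.mem_SO3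
  have hRT := isBigO_transpose (isBigO_R (M := M) (δ := δ))
  have h1 : (fun z : Ref × Err => z.2.2.2.2.2.1 • e3
      + z.1.P.f • (hat (zk z.1.P (shift z.1.P z.2)) *ᵥ e3)) =O[admFilter M δ] coordNorm ke := by
    refine (isBigO_mulVec hRT (hdd.sub
      (isBigO_mulVec_const e3 (isBigO_mul isBigO_A₀ hZs)))).congr' ?_ EventuallyEq.rfl
    filter_upwards [horth] with z hz
    have e1 : ddΔx z.1.P (shift z.1.P z.2) - (A₀ z.1.P * Zs z.1.P (shift z.1.P z.2)) *ᵥ e3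
        = (z.1.P.R * (z.2.2.2.2.2.1 • 1 + z.1.P.f • hat (zk z.1.P (shift z.1.P z.2)))) *ᵥ e3 := by
      rw [ddΔx_shift, ← Matrix.sub_mulVec, hat_zk, A₀]
      congr 1
      simp only [mul_add, mul_smul_comm, smul_mul_assoc, mul_one]
      abel
    rw [e1, Matrix.mulVec_mulVec, ← mul_assoc, hz, one_mul, Matrix.add_mulVec, Matrix.smul_mulVec,
      Matrix.smul_mulVec, Matrix.one_mulVec]
  obtain ⟨hf, hzk⟩ := isBigO_of_thrust hδ h1 hzk3
  have hZk : (fun z : Ref × Err => Zk z.1.P (shift z.1.P z.2)) =O[admFilter M δ] coordNorm ke := by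
    simpa only [hat_zk] using isBigO_hat hzk
  have hZ := hZs.add hZk
  have hdZs : (fun z : Ref × Err => dZs ke z.1.P (shift z.1.P z.2))
      =O[admFilter M δ] coordNorm ke :=
    (isBigO_lie hZs (isBigO_hat isBigO_Ω)).sub (isBigO_smul (isBigO_const_one _) hZs)
  have h2 : (fun z : Ref × Err => z.2.2.2.2.2.2.1 • e3
      + z.1.P.f • (hat (dzk z.1.P (shift z.1.P z.2)) *ᵥ e3)) =O[admFilter M δ] coordNorm ke := by
    refine (isBigO_mulVec hRT (hddd.sub (isBigO_mulVec_const e3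
      (((isBigO_smul' hf isBigO_dR₀).add (isBigO_mul isBigO_dA₀ hZ)).add
        (isBigO_mul isBigO_A₀ hdZs))))).congr' ?_ EventuallyEq.rfl
    filter_upwards [horth] with z hz
    have e1 : dddΔx ke z.1.P (shift z.1.P z.2) - (z.2.2.2.2.2.1 • dR₀ z.1.P
          + dA₀ z.1.P * (Zs z.1.P (shift z.1.P z.2) + Zk z.1.P (shift z.1.P z.2))
          + A₀ z.1.P * dZs ke z.1.P (shift z.1.P z.2)) *ᵥ e3
        = (z.1.P.R * (z.2.2.2.2.2.2.1 • 1
          + z.1.P.f • hat (dzk z.1.P (shift z.1.P z.2)))) *ᵥ e3 := by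
      rw [dddΔx_shift, ← Matrix.sub_mulVec]
      congr 1
      simp only [dZk, A₀, mul_add, mul_smul_comm, smul_mul_assoc, mul_one]
      abel
    rw [e1, Matrix.mulVec_mulVec, ← mul_assoc, hz, one_mul, Matrix.add_mulVec, Matrix.smul_mulVec,
      Matrix.smul_mulVec, Matrix.one_mulVec]
  obtain ⟨hfd, hdzk⟩ := isBigO_of_thrust hδ h2 hdzk3
  refine IsBigO.prod_left ?_ <| IsBigO.prod_left ?_ <| IsBigO.prod_left hx <| IsBigO.prod_left hv <|
    IsBigO.prod_left hf <| IsBigO.prod_left hfd <| IsBigO.prod_left hσ hρ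
  · refine (isBigO_mul isBigO_R hZ).congr' ?_ EventuallyEq.rfl
    filter_upwards [horth] with z hz
    rw [Zs_add_Zk, Z_shift, ← mul_assoc, mul_eq_one_comm.1 hz, one_mul]
  · refine (hdzk.sub (isBigO_cross hzk isBigO_Ω)).congr_left fun z => ?_
    rw [dzk_shift]
    abel

end Estimates

/-- Small errors decay exponentially as long as they stay small. -/
theorem exists_local_decay {M δ : ℝ} (hδ : 0 < δ) {G : Gains} (hG : IsStable G) :
    ∃ r : ℝ, 0 < r ∧ ∃ c : ℝ, 0 < c ∧ ∃ ν : ℝ, 0 < ν ∧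
      ∀ (P : ℝ → QuadState) (u : ℝ → Vec) (q : ℝ → ℝ) (e : ℝ → Err) (t₀ T : ℝ),
        (∀ t ∈ Set.Icc t₀ T, ErrorFlowAt G P u q e (Set.Ici t₀) t ∧
          (refCurve P u q t, e t) ∈ orthSet M δ ∧ ‖e t‖ ≤ r) →
        ∀ t ∈ Set.Icc t₀ T, ‖e t‖ ≤ c * Real.exp (-ν * (t - t₀)) * ‖e t₀‖ := by
  obtain ⟨C, hC0, ν, hν0, hdecay⟩ := hG.exists_decay
  obtain ⟨C₁, hC₁0, hC₁⟩ := (isBigO_err_coordNorm (M := M) G.ke hδ).exists_pos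
  obtain ⟨C₂, hC₂0, hC₂⟩ := (isBigO_Zs_sq (M := M) (δ := δ)).exists_pos
  obtain ⟨C₃, hC₃0, hC₃⟩ := (isBigO_coord (M := M) (δ := δ) G.ke).exists_pos
  obtain ⟨C₄, hC₄0, hC₄⟩ := (isBigO_remCoord (M := M) (δ := δ) G.ke).exists_pos
  have hC₁' := eventually_principal.1 (isBigOWith_iff.1 hC₁)
  have hC₂' := eventually_principal.1 (isBigOWith_iff.1 hC₂)
  have hC₃' := eventually_principal.1 (isBigOWith_iff.1 hC₃)
  have hC₄' := eventually_principal.1 (isBigOWith_iff.1 hC₄)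
  -- The first entry gives C₁C₂r ≤ 1/2, so Z_s can be absorbed into ‖e‖; the second gives C ·
  -- (2C₁C₄r) ≤ ν/4, the smallness required by `norm_le_of_perturbed_linear`.
  set r : ℝ := min (1 / (2 * C₁ * C₂)) (ν / (8 * C * C₁ * C₄)) with hr
  have hr0 : 0 < r := by positivity
  have hr1 : 2 * C₁ * C₂ * r ≤ 1 := by
    have := min_le_left (1 / (2 * C₁ * C₂)) (ν / (8 * C * C₁ * C₄))
    rw [← hr, le_div_iff₀ (by positivity)] at this
    linarith
  have hr2 : 8 * C * C₁ * C₄ * r ≤ ν := by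
    have := min_le_right (1 / (2 * C₁ * C₂)) (ν / (8 * C * C₁ * C₄))
    rw [← hr, le_div_iff₀ (by positivity)] at this
    linarith
  refine ⟨r, hr0, 4 * C₁ * C * C₃, by positivity, ν / 2, by positivity, ?_⟩
  intro P u q e t₀ T h t ht
  -- The coordinates alone control a small error: ‖e‖ ≤ C₁(‖y‖ + C₂‖e‖²), and the last term is at
  -- most ‖e‖/2.
  have hlow : ∀ t ∈ Set.Icc t₀ T, ‖e t‖ ≤ 2 * C₁ * ‖coord G.ke (P t) (e t)‖ := by
    intro t ht
    obtain ⟨-, hmem, hle⟩ := h t ht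
    have h1 := hC₁' _ hmem.1
    have h2 := hC₂' _ hmem
    simp only [coordNorm, errNorm, refCurve, norm_mul, norm_norm] at h1 h2
    rw [Real.norm_of_nonneg (by positivity)] at h1
    have h3 : C₁ * (C₂ * (‖e t‖ * ‖e t‖)) ≤ ‖e t‖ / 2 := by
      have : C₁ * C₂ * ‖e t‖ ≤ 1 / 2 := by
        have : C₁ * C₂ * ‖e t‖ ≤ C₁ * C₂ * r := by gcongr
        linarith
      nlinarith [norm_nonneg (e t)]
    have h4 := mul_le_mul_of_nonneg_left h2 hC₁0.le
    linarith
  have hcoord := norm_le_of_perturbed_linear (A := LinearMap.toContinuousLinearMap (sysC G))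
    (C := C) (ν := ν) (ε := 2 * C₁ * C₄ * r) hC0 hν0 hdecay (by positivity) (by linarith)
    (t₀ := t₀) (T := T) (ξ := fun t => castCoord (coord G.ke (P t) (e t)))
    (h := fun t => castCoord (remCoord G.ke (P t) (e t)))
    (fun t ht => by
      have h1 := (h t ht).1.coord.linearMap_comp castCoord
      rw [map_add, castCoord_sys] at h1
      exact h1)
    (fun t ht => by
      obtain ⟨-, hmem, hle⟩ := h t ht
      have h1 := hC₄' _ hmem
      simp only [errNorm, refCurve, norm_mul, norm_norm] at h1
      rw [norm_castCoord, norm_castCoord]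
      calc _ ≤ C₄ * (‖e t‖ * ‖e t‖) := h1
        _ ≤ C₄ * (r * (2 * C₁ * ‖coord G.ke (P t) (e t)‖)) := by gcongr; exact hlow t ht
        _ = _ := by ring)
    t ht
  simp only [norm_castCoord] at hcoord
  have h0 : t₀ ∈ Set.Icc t₀ T := ⟨le_rfl, ht.1.trans ht.2⟩
  have hup := hC₃' _ (h t₀ h0).2.1.1
  simp only [errNorm, refCurve, norm_norm] at hup
  calc ‖e t‖ ≤ 2 * C₁ * ‖coord G.ke (P t) (e t)‖ := hlow t ht
    _ ≤ 2 * C₁ * (2 * C * Real.exp (-(ν / 2) * (t - t₀)) * (C₃ * ‖e t₀‖)) := by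
        gcongr
        exact hcoord.trans (by gcongr)
    _ = _ := by ring

end Quadcopter

namespace Quadcopter

open Set

/-! ### Invariance of the rotation group -/

theorem mem_SO3_iff {R : Mat} : R ∈ SO3 ↔ R * Rᵀ = 1 ∧ R.det = 1 := by
  change R ∈ Matrix.specialOrthogonalGroup (Fin 3) ℝ ↔ _
  rw [Matrix.mem_specialOrthogonalGroup_iff, Matrix.mem_orthogonalGroup_iff]

/-- RRᵀ has derivative zero because Ω̂ is skew, so the determinant is ±1 throughout, and by
continuity it cannot jump from 1 to -1. -/
theorem mem_SO3_of_deriv {R : ℝ → Mat} {Ω : ℝ → Vec} {t₀ T : ℝ}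
    (hR : ∀ t ∈ Icc t₀ T, HasDerivWithinAt R (R t * hat (Ω t)) (Ici t₀) t) (h₀ : R t₀ ∈ SO3) :
    ∀ t ∈ Icc t₀ T, R t ∈ SO3 := by
  have hd : ∀ t ∈ Icc t₀ T, HasDerivWithinAt (fun τ => R τ * (R τ)ᵀ) 0 (Ici t₀) t := by
    intro t ht
    refine ((hR t ht).mul ((hR t ht).linearMap_comp transposeL)).congr_deriv ?_
    change _ * (R t)ᵀ + R t * (R t * hat (Ω t))ᵀ = 0
    rw [Matrix.transpose_mul, transpose_hat, neg_mul, mul_neg, mul_assoc]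
    exact add_neg_cancel _
  have horth : ∀ t ∈ Icc t₀ T, R t * (R t)ᵀ = 1 := by
    intro t ht
    have h1 := constant_of_has_deriv_right_zero (f := fun τ => R τ * (R τ)ᵀ)
      (fun t ht => (hd t ht).continuousWithinAt.mono Icc_subset_Ici_self)
      (fun t ht => (hd t (Ico_subset_Icc_self ht)).mono (Ici_subset_Ici.2 ht.1)) t ht
    exact h1.trans (mem_SO3_iff.1 h₀).1
  intro t ht
  refine mem_SO3_iff.2 ⟨horth t ht, ?_⟩
  have hsq : ∀ τ ∈ Icc t₀ T, (R τ).det = 1 ∨ (R τ).det = -1 := by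
    intro τ hτ
    have h1 := congrArg Matrix.det (horth τ hτ)
    rw [Matrix.det_mul, Matrix.det_transpose, Matrix.det_one] at h1
    exact mul_self_eq_one_iff.1 h1
  refine (hsq t ht).resolve_right fun hneg => ?_
  have hsub : Icc t₀ t ⊆ Icc t₀ T := Icc_subset_Icc_right ht.2
  have hcont : ContinuousOn (fun τ => (R τ).det) (Icc t₀ t) := by
    have hc : ContinuousOn R (Icc t₀ t) := fun τ hτ =>
      (hR τ (hsub hτ)).continuousWithinAt.mono Icc_subset_Ici_self
    exact (continuous_id.matrix_det (R := ℝ) (n := Fin 3)).comp_continuousOn hc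
  obtain ⟨τ, hτ, h0⟩ := intermediate_value_Icc' ht.1 hcont
    (show (0 : ℝ) ∈ Icc (R t).det (R t₀).det by
      rw [hneg, (mem_SO3_iff.1 h₀).2]; constructor <;> norm_num)
  rcases hsq τ (hsub hτ) with h | h <;> simp_all

/-! ### Global decay of the error -/

theorem IsReference.errorFlowAt {M δ : ℝ} (hδ : 0 < δ) {G : Gains} {P : ℝ → QuadState}
    {u : ℝ → Vec} {q : ℝ → ℝ} (hP : IsReference M δ P u q) {t₀ t : ℝ} (ht₀ : 0 ≤ t₀) (ht : t₀ ≤ t)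
    {e : ℝ → Err} (he : HasDerivWithinAt e (field G (refCurve P u q t) (e t)) (Ici t₀) t) :
    ErrorFlowAt G P u q e (Ici t₀) t := by
  have h0 : 0 ≤ t := ht₀.trans ht
  have hsub : Ici t₀ ⊆ Ici (0 : ℝ) := Ici_subset_Ici.2 ht₀
  exact
    { orth := mul_transpose_self_of_mem_SO3 (hP.adm t h0).mem_SO3
      f_ne := (hδ.trans_le (hP.adm t h0).le_f).ne'
      R := (hP.deriv_R t h0).mono hsub
      Ω := (hP.deriv_Ω t h0).mono hsub
      f := (hP.deriv_f t h0).mono hsub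
      fdot := (hP.deriv_fdot t h0).mono hsub
      e := he }

theorem ErrorFlowAt.deriv_shift_R {G : Gains} {P : ℝ → QuadState} {u : ℝ → Vec} {q : ℝ → ℝ}
    {e : ℝ → Err} {s : Set ℝ} {t : ℝ} (h : ErrorFlowAt G P u q e s t) :
    HasDerivWithinAt (fun τ => (P τ).R + (e τ).1)
      (((P t).R + (e t).1) * hat ((P t).Ω + (e t).2.1)) s t := by
  refine (h.R.add h.e₁).congr_deriv ?_
  rw [hat_add, Quadcopter.dR₀, mul_add, add_mul, add_mul]
  abel

/-- The differential equation is assumed only while ‖e‖ ≤ 1, so that the statement covers both the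
curve of the truncated field and genuine closed-loop solutions. -/
theorem exists_global_decay {M δ : ℝ} (hδ : 0 < δ) {G : Gains} (hG : IsStable G) :
    ∃ r : ℝ, 0 < r ∧ ∃ c : ℝ, 0 < c ∧ ∃ ν : ℝ, 0 < ν ∧
      ∀ (P : ℝ → QuadState) (u : ℝ → Vec) (q : ℝ → ℝ), IsReference M δ P u q →
      ∀ t₀ ≥ 0, ∀ e : ℝ → Err, ContinuousOn e (Ici t₀) →
        (∀ t ≥ t₀, ‖e t‖ ≤ 1 →
          HasDerivWithinAt e (field G (refCurve P u q t) (e t)) (Ici t₀) t) →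
        (P t₀).R + (e t₀).1 ∈ SO3 → ‖e t₀‖ < r →
        ∀ t ≥ t₀, ‖e t‖ ≤ c * Real.exp (-ν * (t - t₀)) * ‖e t₀‖ ∧ ‖e t‖ ≤ 1 ∧ ‖e t‖ ≤ δ ∧
          (P t).R + (e t).1 ∈ SO3 := by
  obtain ⟨r₁, hr₁, c, hc, ν, hν, hloc⟩ := exists_local_decay (M := M) hδ hG
  -- r₁ is the range of the local estimate, 1 the region where the equation is known to hold, and δ
  -- the margin that keeps the thrust nonnegative.
  set r₂ : ℝ := min r₁ (min 1 δ) with hr₂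
  have hr₂0 : 0 < r₂ := by positivity
  have h21 : r₂ ≤ r₁ := min_le_left _ _
  have h2one : r₂ ≤ 1 := (min_le_right _ _).trans (min_le_left _ _)
  have h2δ : r₂ ≤ δ := (min_le_right _ _).trans (min_le_right _ _)
  -- Dividing by c + 1 makes both ‖e t₀‖ and c‖e t₀‖ strictly less than r₂, as the start and the
  -- step of the continuation argument require.
  refine ⟨r₂ / (c + 1), by positivity, c, hc, ν, hν, ?_⟩
  intro P u q hP t₀ ht₀ e hcont hode hSO hsmall
  have hsmall' : (c + 1) * ‖e t₀‖ < r₂ := by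
    rwa [lt_div_iff₀ (by positivity), mul_comm] at hsmall
  have hstep : ∀ T, (∀ t ∈ Icc t₀ T, ‖e t‖ ≤ r₂) → ∀ t ∈ Icc t₀ T,
      ‖e t‖ ≤ c * Real.exp (-ν * (t - t₀)) * ‖e t₀‖ ∧ (P t).R + (e t).1 ∈ SO3 := by
    intro T hT
    have hflow : ∀ t ∈ Icc t₀ T, ErrorFlowAt G P u q e (Ici t₀) t := fun t ht =>
      hP.errorFlowAt hδ ht₀ ht.1 (hode t ht.1 ((hT t ht).trans h2one))
    have hSO' := mem_SO3_of_deriv (R := fun τ => (P τ).R + (e τ).1)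
      (Ω := fun τ => (P τ).Ω + (e τ).2.1) (fun t ht => (hflow t ht).deriv_shift_R) hSO
    refine fun t ht => ⟨hloc P u q e t₀ T (fun t ht => ⟨hflow t ht, ⟨?_, ?_⟩, ?_⟩) t ht, hSO' t ht⟩
    · exact hP.adm t (ht₀.trans ht.1)
    · exact transpose_mul_self_of_mem_SO3 (hSO' t ht)
    · exact (hT t ht).trans h21
  have hbound : ∀ t ≥ t₀, ‖e t‖ < r₂ := by
    refine forall_lt_of_continuation hcont.norm ?_ fun T hT0 hT => ?_
    · nlinarith [norm_nonneg (e t₀)]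
    · have h1 := (hstep T hT T ⟨hT0, le_rfl⟩).1
      have h2 : Real.exp (-ν * (T - t₀)) ≤ 1 := by
        rw [Real.exp_le_one_iff]; nlinarith
      have h3 : c * Real.exp (-ν * (T - t₀)) * ‖e t₀‖ ≤ c * 1 * ‖e t₀‖ := by gcongr
      nlinarith [norm_nonneg (e t₀)]
  intro t ht
  obtain ⟨h1, h2⟩ := hstep t (fun τ hτ => (hbound τ hτ.1).le) t ⟨ht, le_rfl⟩
  exact ⟨h1, (hbound t ht).le.trans h2one, (hbound t ht).le.trans h2δ, h2⟩

/-! ### Closed loops and the error system -/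

/-- The error of `S` relative to `P`, together with the integral states. -/
def toErr (P S : QuadState) (σ : Vec) (ρ : ℝ) : Err :=
  (S.R - P.R, S.Ω - P.Ω, S.x - P.x, S.v - P.v, S.f - P.f, S.fdot - P.fdot, σ, ρ)

theorem shift_toErr (P S : QuadState) (σ : Vec) (ρ : ℝ) : shift P (toErr P S σ ρ) = S := by
  simp [shift, toErr]

theorem toErr_shift (P : QuadState) (e : Err) :
    toErr P (shift P e) e.2.2.2.2.2.2.1 e.2.2.2.2.2.2.2 = e := by
  simp [shift, toErr]

/-- The closed loop with the general law. -/
structure IsGeneralLoop (J : Mat) (g : ℝ) (G : Gains) (P : ℝ → QuadState) (u : ℝ → Vec)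
    (q : ℝ → ℝ) (t₀ : ℝ) (S : ℝ → QuadState) (σ : ℝ → Vec) (ρ : ℝ → ℝ) : Prop where
  loop : IsClosedLoop J g G.ke P u q t₀ S
    (fun t => vIn G (refCurve P u q t) (toErr (P t) (S t) (σ t) (ρ t)))
    (fun t => wIn G (refCurve P u q t) (toErr (P t) (S t) (σ t) (ρ t)))
  deriv_σ : ∀ t ≥ t₀,
    HasDerivWithinAt σ (G.α • ((S t).x - (P t).x) - G.β • σ t) (Ici t₀) t
  deriv_ρ : ∀ t ≥ t₀,
    HasDerivWithinAt ρ (G.α * zk (P t) (S t) 2 - G.β * ρ t) (Ici t₀) t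

theorem uControl_eq (G : Gains) (a : Ref) (e : Err) :
    uControl G.ke a.P a.u a.q (shift a.P e) (vIn G a e) (wIn G a e)
      = a.u + (-crossProduct (dzk a.P (shift a.P e)) a.P.Ω
        - crossProduct (zk a.P (shift a.P e)) a.u + uTildeIn G a e) := rfl

theorem qControl_eq (G : Gains) (a : Ref) (e : Err) :
    qControl G.ke a.P a.u a.q (shift a.P e) (vIn G a e) = a.q + auxIn G a e 2 := rfl

section Loop

variable {J : Mat} {g : ℝ} {G : Gains} {P : ℝ → QuadState} {u : ℝ → Vec} {q : ℝ → ℝ} {t₀ : ℝ}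

/-- The torque cancels the gyroscopic term and leaves J Ω̇ = J u, so invertibility of J gives Ω̇ =
u. The reference lies in SO(3), hence its kₑ term vanishes. -/
theorem IsGeneralLoop.hasDerivWithinAt_toErr {ke : ℝ} (hJ : IsUnit J.det)
    (hP : IsAmbientSolution g ke 0 P u q) (hR : ∀ t ≥ 0, (P t).R ∈ SO3) (ht₀ : 0 ≤ t₀)
    {S : ℝ → QuadState} {σ : ℝ → Vec} {ρ : ℝ → ℝ} (h : IsGeneralLoop J g G P u q t₀ S σ ρ) {t : ℝ}
    (ht : t₀ ≤ t) :
    HasDerivWithinAt (fun τ => toErr (P τ) (S τ) (σ τ) (ρ τ))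
      (field G (refCurve P u q t) (toErr (P t) (S t) (σ t) (ρ t))) (Ici t₀) t := by
  have h0 : 0 ≤ t := ht₀.trans ht
  have hsub : Ici t₀ ⊆ Ici (0 : ℝ) := Ici_subset_Ici.2 ht₀
  set e := toErr (P t) (S t) (σ t) (ρ t) with he
  have hS : S t = shift (P t) e := (shift_toErr _ _ _ _).symm
  have hΩ : HasDerivWithinAt (fun τ => (S τ).Ω)
      (uControl G.ke (P t) (u t) (q t) (S t) (vIn G (refCurve P u q t) e)
        (wIn G (refCurve P u q t) e)) (Ici t₀) t := by
    have h1 := (h.loop.quad.deriv_Ω t ht).linearMap_comp (mulVecL J⁻¹)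
    have h2 : ∀ y, mulVecL J⁻¹ (J *ᵥ y) = y := fun y => by
      change J⁻¹ *ᵥ (J *ᵥ y) = y
      rw [Matrix.mulVec_mulVec, Matrix.nonsing_inv_mul _ hJ, Matrix.one_mulVec]
    simpa only [torque, add_neg_cancel_left, h2] using h1
  have h1 := ((h.loop.quad.deriv_R t ht).sub ((hP.deriv_R t h0).mono hsub)).prodMk <|
    (hΩ.sub ((hP.deriv_Ω t h0).mono hsub)).prodMk <|
    ((h.loop.quad.deriv_x t ht).sub ((hP.deriv_x t h0).mono hsub)).prodMk <|
    ((h.loop.quad.deriv_v t ht).sub ((hP.deriv_v t h0).mono hsub)).prodMk <|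
    ((h.loop.deriv_f t ht).sub ((hP.deriv_f t h0).mono hsub)).prodMk <|
    ((h.loop.deriv_fdot t ht).sub ((hP.deriv_fdot t h0).mono hsub)).prodMk <|
    (h.deriv_σ t ht).prodMk (h.deriv_ρ t ht)
  refine h1.congr_deriv ?_
  rw [transpose_mul_self_of_mem_SO3 (hR t h0), ← he, hS]
  have huc := uControl_eq G (refCurve P u q t) e
  have hqc := qControl_eq G (refCurve P u q t) e
  simp only [refCurve] at huc hqc
  simp only [refCurve, huc, hqc, field, linField, quadField, Prod.mk_add_mk, add_zero]
  refine Prod.ext ?_ (Prod.ext ?_ (Prod.ext ?_ (Prod.ext ?_ (Prod.ext ?_ (Prod.ext ?_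
    (Prod.ext ?_ ?_)))))) <;> dsimp only
  · simp only [shift, hat_add, mul_add, add_mul, sub_self, mul_zero, smul_zero, sub_zero]
    abel
  · abel
  · simp [shift]
  · simp only [shift, Matrix.add_mulVec, smul_add, add_smul]
    abel
  · simp [shift]
  · abel
  · simp [shift, he, toErr]
  · simp [he, toErr]

/-- Converse passage, used for existence: adding an error curve to the reference gives a closed loop
of the quadcopter, provided that the attitude stays in SO(3). -/
theorem isGeneralLoop_shift {ke M δ : ℝ} (hδ : 0 < δ) (hP : IsAmbientSolution g ke 0 P u q)
    (hPr : IsReference M δ P u q) (ht₀ : 0 ≤ t₀) {e : ℝ → Err}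
    (he : ∀ t ≥ t₀, HasDerivWithinAt e (field G (refCurve P u q t) (e t)) (Ici t₀) t)
    (hSO : ∀ t ≥ t₀, (P t).R + (e t).1 ∈ SO3) :
    IsGeneralLoop J g G P u q t₀ (fun t => shift (P t) (e t))
      (fun t => (e t).2.2.2.2.2.2.1) (fun t => (e t).2.2.2.2.2.2.2) := by
  have hflow : ∀ t ≥ t₀, ErrorFlowAt G P u q e (Ici t₀) t := fun t ht =>
    hPr.errorFlowAt hδ ht₀ ht (he t ht)
  have hsub : Ici t₀ ⊆ Ici (0 : ℝ) := Ici_subset_Ici.2 ht₀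
  refine ⟨⟨⟨hSO, fun t ht => (hflow t ht).deriv_shift_R, fun t ht => ?_, fun t ht => ?_,
    fun t ht => ?_⟩, fun t ht => ?_, fun t ht => ?_⟩, fun t ht => ?_, fun t ht => ?_⟩
  · simp only [toErr_shift]
    have h1 := (((hflow t ht).Ω.add (hflow t ht).e₂).linearMap_comp (mulVecL J))
    refine h1.congr_deriv ?_
    rw [torque, add_neg_cancel_left]
    rfl
  · exact ((hP.deriv_x t (ht₀.trans ht)).mono hsub).add (hflow t ht).e₃
  · refine (((hP.deriv_v t (ht₀.trans ht)).mono hsub).add (hflow t ht).e₄).congr_deriv ?_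
    have h3 : A₀ (P t) * Zk (P t) (shift (P t) (e t)) + A₀ (P t) * Zs (P t) (shift (P t) (e t))
        = (P t).f • (e t).1 := by
      rw [← mul_add, add_comm, Zs_add_Zk, Z_shift, A₀, smul_mul_assoc, ← mul_assoc,
        (hflow t ht).orth, one_mul]
    rw [ddΔx_shift, add_assoc _ (A₀ _ * _), h3]
    simp only [shift, Matrix.add_mulVec, Matrix.smul_mulVec, add_smul, smul_add]
    abel
  · exact (hflow t ht).f.add (hflow t ht).e₅
  · simp only [toErr_shift]
    exact (hflow t ht).fdot.add (hflow t ht).e₆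
  · refine (hflow t ht).e₇.congr_deriv ?_
    simp [shift]
  · exact (hflow t ht).e₈

end Loop

/-! ### Comparison of norms -/

theorem norm_le_euclNorm (a : Vec) : ‖a‖ ≤ euclNorm a := by
  refine (pi_norm_le_iff_of_nonneg (r := euclNorm a) (norm_nonneg _)).2 fun i => ?_
  exact PiLp.norm_apply_le (WithLp.toLp 2 a) i

theorem euclNorm_le (a : Vec) : euclNorm a ≤ 2 * ‖a‖ := by
  rw [euclNorm, EuclideanSpace.norm_eq]
  refine Real.sqrt_le_iff.2 ⟨by positivity, ?_⟩
  calc ∑ i, ‖a i‖ ^ 2 ≤ ∑ _i : Fin 3, ‖a‖ ^ 2 := by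
        gcongr with i; exact norm_le_pi_norm a i
    _ ≤ (2 * ‖a‖) ^ 2 := by
        simp only [Finset.sum_const, Finset.card_univ, Fintype.card_fin, nsmul_eq_mul]
        push_cast
        nlinarith [sq_nonneg ‖a‖]

/-- The total error. -/
def totalError (P S : QuadState) (σ : Vec) (ρ : ℝ) : ℝ :=
  trackingError P S + thrustError P S + (euclNorm σ + |ρ|)

theorem norm_toErr_le (P S : QuadState) (σ : Vec) (ρ : ℝ) :
    ‖toErr P S σ ρ‖ ≤ totalError P S σ ρ := by
  have hn : ∀ a : Vec, 0 ≤ euclNorm a := fun a => norm_nonneg _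
  have h1 := hn (S.Ω - P.Ω)
  have h2 := hn (S.x - P.x)
  have h3 := hn (S.v - P.v)
  have h4 := hn σ
  have h5 := norm_nonneg (S.R - P.R)
  have h6 := abs_nonneg (S.f - P.f)
  have h7 := abs_nonneg (S.fdot - P.fdot)
  have h8 := abs_nonneg ρ
  have k1 := norm_le_euclNorm (S.Ω - P.Ω)
  have k2 := norm_le_euclNorm (S.x - P.x)
  have k3 := norm_le_euclNorm (S.v - P.v)
  have k4 := norm_le_euclNorm σ
  simp only [toErr, totalError, trackingError, thrustError, Prod.norm_mk, sup_le_iff,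
    Real.norm_eq_abs]
  refine ⟨?_, ?_, ?_, ?_, ?_, ?_, ?_, ?_⟩ <;> linarith

/-- The factor 12 counts 1 for ΔR, 2 for each of the four vectors (Euclidean against sup norm), and
1 for each of the three scalars. -/
theorem totalError_le (P S : QuadState) (σ : Vec) (ρ : ℝ) :
    totalError P S σ ρ ≤ 12 * ‖toErr P S σ ρ‖ := by
  have h := le_refl ‖toErr P S σ ρ‖
  conv_lhs at h => rw [toErr]
  simp only [Prod.norm_mk, sup_le_iff, Real.norm_eq_abs] at h
  obtain ⟨h1, h2, h3, h4, h5, h6, h7, h8⟩ := h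
  have k1 := euclNorm_le (S.Ω - P.Ω)
  have k2 := euclNorm_le (S.x - P.x)
  have k3 := euclNorm_le (S.v - P.v)
  have k4 := euclNorm_le σ
  simp only [totalError, trackingError, thrustError]
  linarith

/-! ### Exponential tracking -/

/-- For existence, the decay estimate confines the truncated curve to the unit ball, where it is a
true error curve. For the decay claim the same estimate is applied to the error of an arbitrary
closed loop. -/
theorem exists_exponential_tracking {J : Mat} (hJ : IsUnit J.det) {g ke M δ : ℝ} (hδ : 0 < δ)
    {G : Gains} (hG : IsStable G) {P : ℝ → QuadState} {u : ℝ → Vec} {q : ℝ → ℝ}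
    (hP : IsAmbientSolution g ke 0 P u q) (hPr : IsReference M δ P u q)
    (hu : ContinuousOn u (Ici 0)) (hq : ContinuousOn q (Ici 0)) :
    ∃ r > 0, ∃ c > 0, ∃ lam > 0, ∀ t₀ ≥ 0, ∀ (S₁ : QuadState) (σ₁ : Vec) (ρ₁ : ℝ),
      S₁.R ∈ SO3 → totalError (P t₀) S₁ σ₁ ρ₁ < r →
      (∃ (S : ℝ → QuadState) (σ : ℝ → Vec) (ρ : ℝ → ℝ), S t₀ = S₁ ∧ σ t₀ = σ₁ ∧ ρ t₀ = ρ₁ ∧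
        IsGeneralLoop J g G P u q t₀ S σ ρ) ∧
      ∀ (S : ℝ → QuadState) (σ : ℝ → Vec) (ρ : ℝ → ℝ), S t₀ = S₁ → σ t₀ = σ₁ → ρ t₀ = ρ₁ →
        IsGeneralLoop J g G P u q t₀ S σ ρ → ∀ t ≥ t₀, 0 ≤ (S t).f ∧
          totalError (P t) (S t) (σ t) (ρ t)
            ≤ c * Real.exp (-lam * (t - t₀)) * totalError (P t₀) S₁ σ₁ ρ₁ := by
  obtain ⟨r, hr, c, hc, ν, hν, hglob⟩ := exists_global_decay (M := M) hδ hG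
  refine ⟨r, hr, 12 * c, by positivity, ν, hν, ?_⟩
  intro t₀ ht₀ S₁ σ₁ ρ₁ hS₁ hr₁
  have hnorm : ‖toErr (P t₀) S₁ σ₁ ρ₁‖ < r := (norm_toErr_le _ _ _ _).trans_lt hr₁
  have hinit : (P t₀).R + (toErr (P t₀) S₁ σ₁ ρ₁).1 ∈ SO3 := by
    simpa [toErr] using hS₁
  constructor
  · obtain ⟨e, he₀, hcont, hode⟩ := exists_error_curve hδ G hPr hu hq ht₀
      (toErr (P t₀) S₁ σ₁ ρ₁)
    have h := hglob P u q hPr t₀ ht₀ e hcont hode (by rwa [he₀]) (by rwa [he₀])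
    refine ⟨_, _, _, ?_, ?_, ?_, isGeneralLoop_shift hδ hP hPr ht₀
      (fun t ht => hode t ht (h t ht).2.1) fun t ht => (h t ht).2.2.2⟩
    · rw [he₀, shift_toErr]
    · rw [he₀, toErr]
    · rw [he₀, toErr]
  · rintro S σ ρ rfl rfl rfl hloop t ht
    have hR : ∀ t ≥ 0, (P t).R ∈ SO3 := fun t ht => (hPr.adm t ht).mem_SO3
    have hd : ∀ t ≥ t₀, _ := fun t ht => hloop.hasDerivWithinAt_toErr hJ hP hR ht₀ ht
    obtain ⟨h1, -, h3, -⟩ := hglob P u q hPr t₀ ht₀ (fun τ => toErr (P τ) (S τ) (σ τ) (ρ τ))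
      (fun t ht => (hd t ht).continuousWithinAt) (fun t ht _ => hd t ht) hinit hnorm t ht
    constructor
    · have h4 : |(S t).f - (P t).f| ≤ δ := by
        refine le_trans ?_ h3
        have h5 := le_refl ‖toErr (P t) (S t) (σ t) (ρ t)‖
        conv_lhs at h5 => rw [toErr]
        simp only [Prod.norm_mk, sup_le_iff, Real.norm_eq_abs] at h5
        exact h5.2.2.2.2.1
      have h5 := (abs_le.1 h4).1
      have h6 := (hPr.adm t (ht₀.trans ht)).le_f
      simp only [refCurve] at h6
      linarith
    · calc _ ≤ 12 * ‖toErr (P t) (S t) (σ t) (ρ t)‖ := totalError_le _ _ _ _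
        _ ≤ 12 * (c * Real.exp (-ν * (t - t₀)) * totalError (P t₀) (S t₀) (σ t₀) (ρ t₀)) := by
            gcongr
            exact h1.trans (by gcongr; exact norm_toErr_le _ _ _ _)
        _ = _ := by ring

/-! ### The two laws as instances of the general one -/

theorem isPIDClosedLoop_iff {J : Mat} {g ke : ℝ} {K₀ K₁ K₂ K₃ KI : Mat} {a₀ a₁ aI : ℝ}
    {P : ℝ → QuadState} {u : ℝ → Vec} {q : ℝ → ℝ} {t₀ : ℝ} {S : ℝ → QuadState} {σ : ℝ → Vec}
    {ρ : ℝ → ℝ} : IsPIDClosedLoop J g ke K₀ K₁ K₂ K₃ KI a₀ a₁ aI P u q t₀ S σ ρ ↔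
      IsGeneralLoop J g (pidGains ke K₀ K₁ K₂ K₃ KI a₀ a₁ aI) P u q t₀ S σ ρ := by
  have hv : ∀ t, vIn (pidGains ke K₀ K₁ K₂ K₃ KI a₀ a₁ aI) (refCurve P u q t)
      (toErr (P t) (S t) (σ t) (ρ t)) = vLaw K₀ K₁ K₂ K₃ ke (P t) (S t) - KI *ᵥ σ t := fun t => by
    simp only [vIn, refCurve, shift_toErr, pidGains]
    rfl
  have hw : ∀ t, wIn (pidGains ke K₀ K₁ K₂ K₃ KI a₀ a₁ aI) (refCurve P u q t)
      (toErr (P t) (S t) (σ t) (ρ t)) = wLaw a₀ a₁ (P t) (S t) - aI * ρ t := fun t => by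
    simp only [wIn, refCurve, shift_toErr, pidGains]
    rfl
  constructor
  · intro h
    refine ⟨?_, fun t ht => ?_, fun t ht => ?_⟩
    · simp only [hv, hw]; exact h.loop
    · simpa [pidGains] using h.deriv_σ t ht
    · simpa [pidGains] using h.deriv_ρ t ht
  · intro h
    refine ⟨?_, fun t ht => ?_, fun t ht => ?_⟩
    · have := h.loop
      simp only [hv, hw] at this
      exact this
    · simpa [pidGains] using h.deriv_σ t ht
    · simpa [pidGains] using h.deriv_ρ t ht

theorem isClosedLoop_pdGains_iff {J : Mat} {g ke : ℝ} {K₀ K₁ K₂ K₃ : Mat} {a₀ a₁ : ℝ}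
    {P : ℝ → QuadState} {u : ℝ → Vec} {q : ℝ → ℝ} {t₀ : ℝ} {S : ℝ → QuadState} {σ : ℝ → Vec}
    {ρ : ℝ → ℝ} : IsPDClosedLoop J g ke K₀ K₁ K₂ K₃ a₀ a₁ P u q t₀ S ↔
      IsClosedLoop J g (pdGains ke K₀ K₁ K₂ K₃ a₀ a₁).ke P u q t₀ S
        (fun t => vIn (pdGains ke K₀ K₁ K₂ K₃ a₀ a₁) (refCurve P u q t)
          (toErr (P t) (S t) (σ t) (ρ t)))
        (fun t => wIn (pdGains ke K₀ K₁ K₂ K₃ a₀ a₁) (refCurve P u q t)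
          (toErr (P t) (S t) (σ t) (ρ t))) := by
  have hv : ∀ t, vIn (pdGains ke K₀ K₁ K₂ K₃ a₀ a₁) (refCurve P u q t)
      (toErr (P t) (S t) (σ t) (ρ t)) = vLaw K₀ K₁ K₂ K₃ ke (P t) (S t) := fun t => by
    simp [vIn, refCurve, shift_toErr, pdGains]
  have hw : ∀ t, wIn (pdGains ke K₀ K₁ K₂ K₃ a₀ a₁) (refCurve P u q t)
      (toErr (P t) (S t) (σ t) (ρ t)) = wLaw a₀ a₁ (P t) (S t) := fun t => by
    simp [wIn, refCurve, shift_toErr, pdGains]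
  simp only [hv, hw]
  rfl

end Quadcopter

end

/-! ### The theorem for both laws -/

theorem mainTheorem6
    -- inertia matrix, gravitational acceleration, gain of the transversal term
    (J : Quadcopter.Mat) (hJ : J.PosDef) (g ke : ℝ) (hke : 0 < ke)
    -- the reference trajectory and the reference controls
    (P : ℝ → Quadcopter.QuadState) (u₀ : ℝ → Quadcopter.Vec) (q₀ : ℝ → ℝ)
    (hP : Quadcopter.IsAmbientSolution g ke 0 P u₀ q₀)
    (hR : ∀ t ≥ 0, (P t).R ∈ Quadcopter.SO3)
    (hu : ContinuousOn u₀ (Set.Ici 0)) (hq : ContinuousOn q₀ (Set.Ici 0))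
    (M : ℝ) (hΩM : ∀ t ≥ 0, Quadcopter.euclNorm (P t).Ω ≤ M)
    (huM : ∀ t ≥ 0, Quadcopter.euclNorm (u₀ t) ≤ M)
    (hfM : ∀ t ≥ 0, |(P t).f| ≤ M) (hfdM : ∀ t ≥ 0, |(P t).fdot| ≤ M)
    (hqM : ∀ t ≥ 0, |q₀ t| ≤ M)
    (δ : ℝ) (hδ : 0 < δ) (hf : ∀ t ≥ 0, δ ≤ (P t).f) :
    (∀ (K₀ K₁ K₂ K₃ : Quadcopter.Mat) (a₀ a₁ : ℝ),
      Quadcopter.IsHurwitz (Quadcopter.charPoly4 K₀ K₁ K₂ K₃) → 0 < a₀ → 0 < a₁ →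
      ∃ r > 0, ∃ c > 0, ∃ lam > 0, ∀ t₀ ≥ 0, ∀ S₁ : Quadcopter.QuadState,
        S₁.R ∈ Quadcopter.SO3 →
        Quadcopter.trackingError (P t₀) S₁ + Quadcopter.thrustError (P t₀) S₁ < r →
        (∃ S : ℝ → Quadcopter.QuadState, S t₀ = S₁ ∧
          Quadcopter.IsPDClosedLoop J g ke K₀ K₁ K₂ K₃ a₀ a₁ P u₀ q₀ t₀ S) ∧
        ∀ S : ℝ → Quadcopter.QuadState, S t₀ = S₁ →
          Quadcopter.IsPDClosedLoop J g ke K₀ K₁ K₂ K₃ a₀ a₁ P u₀ q₀ t₀ S →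
          ∀ t ≥ t₀, 0 ≤ (S t).f ∧
            Quadcopter.trackingError (P t) (S t) + Quadcopter.thrustError (P t) (S t) ≤
              c * Real.exp (-lam * (t - t₀)) *
                (Quadcopter.trackingError (P t₀) S₁ + Quadcopter.thrustError (P t₀) S₁)) ∧
    (∀ (K₀ K₁ K₂ K₃ KI : Quadcopter.Mat) (a₀ a₁ aI : ℝ),
      Quadcopter.IsHurwitz (Quadcopter.charPoly5 K₀ K₁ K₂ K₃ KI) →
      Quadcopter.IsHurwitz (Polynomial.X ^ 3 + Polynomial.C a₁ * Polynomial.X ^ 2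
        + Polynomial.C a₀ * Polynomial.X + Polynomial.C aI) →
      ∃ r > 0, ∃ c > 0, ∃ lam > 0, ∀ t₀ ≥ 0, ∀ (S₁ : Quadcopter.QuadState)
        (σ₁ : Quadcopter.Vec) (ρ₁ : ℝ),
        S₁.R ∈ Quadcopter.SO3 →
        Quadcopter.trackingError (P t₀) S₁ + Quadcopter.thrustError (P t₀) S₁
          + (Quadcopter.euclNorm σ₁ + |ρ₁|) < r →
        (∃ (S : ℝ → Quadcopter.QuadState) (σ : ℝ → Quadcopter.Vec) (ρ : ℝ → ℝ),
          S t₀ = S₁ ∧ σ t₀ = σ₁ ∧ ρ t₀ = ρ₁ ∧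
          Quadcopter.IsPIDClosedLoop J g ke K₀ K₁ K₂ K₃ KI a₀ a₁ aI P u₀ q₀ t₀ S σ ρ) ∧
        ∀ (S : ℝ → Quadcopter.QuadState) (σ : ℝ → Quadcopter.Vec) (ρ : ℝ → ℝ),
          S t₀ = S₁ → σ t₀ = σ₁ → ρ t₀ = ρ₁ →
          Quadcopter.IsPIDClosedLoop J g ke K₀ K₁ K₂ K₃ KI a₀ a₁ aI P u₀ q₀ t₀ S σ ρ →
          ∀ t ≥ t₀, 0 ≤ (S t).f ∧
            Quadcopter.trackingError (P t) (S t) + Quadcopter.thrustError (P t) (S t)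
              + (Quadcopter.euclNorm (σ t) + |ρ t|) ≤
              c * Real.exp (-lam * (t - t₀)) *
                (Quadcopter.trackingError (P t₀) S₁ + Quadcopter.thrustError (P t₀) S₁
                  + (Quadcopter.euclNorm σ₁ + |ρ₁|))) := by
  have hJ' : IsUnit J.det := hJ.det_pos.ne'.isUnit
  have hRef : Quadcopter.IsReference M δ P u₀ q₀ :=
    { adm := fun t ht => ⟨hR t ht, (Quadcopter.norm_le_euclNorm _).trans (hΩM t ht),
        (Quadcopter.norm_le_euclNorm _).trans (huM t ht), hfM t ht, hfdM t ht, hqM t ht, hf t ht⟩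
      deriv_R := fun t ht => by
        have h := hP.deriv_R t ht
        rwa [Quadcopter.transpose_mul_self_of_mem_SO3 (hR t ht), sub_self, mul_zero, smul_zero,
          sub_zero] at h
      deriv_Ω := hP.deriv_Ω
      deriv_f := hP.deriv_f
      deriv_fdot := hP.deriv_fdot }
  constructor
  · intro K₀ K₁ K₂ K₃ a₀ a₁ hK ha₀ ha₁
    obtain ⟨r, hr, c, hc, lam, hlam, h⟩ := Quadcopter.exists_exponential_tracking hJ' hδ
      (Quadcopter.isStable_pdGains (ke := ke) hK ha₀ ha₁) hP hRef hu hq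
    have hzero : ∀ P S : Quadcopter.QuadState, Quadcopter.totalError P S 0 0
        = Quadcopter.trackingError P S + Quadcopter.thrustError P S := fun P S => by
      simp [Quadcopter.totalError, Quadcopter.euclNorm]
    refine ⟨r, hr, c, hc, lam, hlam, fun t₀ ht₀ S₁ hS₁ hE => ?_⟩
    obtain ⟨⟨S, σ, ρ, hS, -, -, hloop⟩, hall⟩ := h t₀ ht₀ S₁ 0 0 hS₁ (by rwa [hzero])
    refine ⟨⟨S, hS, Quadcopter.isClosedLoop_pdGains_iff.2 hloop.loop⟩, fun S hS hloop t ht => ?_⟩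
    -- Law (A) has no integral states. The general loop is completed with σ = ρ = 0, which solve σ̇
    -- = -σ and ρ̇ = -ρ and contribute nothing to the total error.
    have h1 := hall S (fun _ => 0) (fun _ => 0) hS rfl rfl
      ⟨Quadcopter.isClosedLoop_pdGains_iff.1 hloop,
        fun t _ => (hasDerivWithinAt_const t _ 0).congr_deriv (by simp [Quadcopter.pdGains]),
        fun t _ => (hasDerivWithinAt_const t _ 0).congr_deriv (by simp [Quadcopter.pdGains])⟩ t ht
    rwa [hzero, hzero] at h1
  · intro K₀ K₁ K₂ K₃ KI a₀ a₁ aI hK ha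
    simp only [Quadcopter.isPIDClosedLoop_iff]
    exact Quadcopter.exists_exponential_tracking hJ' hδ
      (Quadcopter.isStable_pidGains (ke := ke) hK ha) hP hRef hu hq
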